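/- Let $n\ge 1$, $s\in[1/2,1)$ and $a=1-2s\in(-1,0]$. Points are written $(x,y,t)\in\mathbb R^n\times[0,\infty)\times\mathbb R$; $\nabla$ and $\operatorname{div}$ are taken in $(x,y)$, and $\overline{\mathbb B}_{1/2}=\{(x,y): y\ge 0,\ |x|^2+y^2\le 1/4\}$. Put $$\phi(x,y)=-\frac{|x|^2}{4}+2\left(-\frac{y^{a+1}}{a+1}+\frac{y^2}{2}\right).$$ There is a constant $C=C(n,s)$ with the following property. Let $\tilde W$ be continuous on $\{y\ge 0\}$ with $\tilde W=0$ on $\{y=0\}$ and (closed) support in $\overline{\mathbb B}_{1/2}\times(0,1)$. Assume that $\nabla_x\tilde W$ and $\tilde W_t$ exist in $\{y>0\}$ and are continuous up to $\{y=0\}$, and that $\tilde W$ has a locally integrable weak derivative $\tilde W_y$ in $\{y>0\}$. Let $\tilde W$ be a weak solution of $$\operatorname{div}(y^a\nabla\tilde W)+y^a\tilde W_t=f\quad\text{in }\{y>0\},$$ that is, $\int_{\{y>0\}}y^a(\langle\nabla\tilde W,\nabla\eta\rangle-\tilde W_t\,\eta)=-\int_{\{y>0\}} f\eta$ for all $\eta\in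 C_c^\infty(\{y>0\})$, where $f$ is measurable with $\int_{\{y>0\}} f^2y^{-a}<\infty$. Let $\partial_y^a\tilde W\in L^1_{loc}(\mathbb R^n\times\mathbb R)$ be the weighted normal derivative of $\tilde W$ on $\{y=0\}$, i.e. the (essential) limit of $y^a\tilde W_y(\cdot,y,\cdot)$ as $y\to0^+$, in the sense of distributions in $(x,t)$. Then for all $\alpha>2$, $$\alpha^3\int_{\{y>0\}}e^{2\alpha\phi}\tilde W^2y^a\ \le\ C\int_{\{y>0\}}e^{2\alpha\phi}f^2y^{-a}+C\alpha\int_{\{y=0\}}(\partial_y^a\tilde W)^2 .$$ -/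

import Mathlib

open MeasureTheory Filter Topology
open scoped ContDiff NNReal ENNReal

namespace Carleman

/-- Points `(x, y, t)` of `ℝⁿ × ℝ × ℝ`: tangential variable `x`, extension variable `y`, time `t`. -/
abbrev Pt (n : ℕ) : Type := EuclideanSpace ℝ (Fin n) × ℝ × ℝ

/-- The open thick half-space `{y > 0}`. -/
def openHalf (n : ℕ) : Set (Pt n) := {p | 0 < p.2.1}

/-- The closed thick half-space `{y ≥ 0}`. -/
def closedHalf (n : ℕ) : Set (Pt n) := {p | 0 ≤ p.2.1}

/-- The set `closure 𝔹_{1/2} × (0,1)`, where `𝔹_{1/2}` is the upper half-ball of radius `1/2`. -/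
def halfBallCylinder (n : ℕ) : Set (Pt n) :=
  {p | ‖p.1‖ ^ 2 + p.2.1 ^ 2 ≤ (1 / 2) ^ 2 ∧ 0 ≤ p.2.1 ∧ 0 < p.2.2 ∧ p.2.2 < 1}

/-- The coordinate direction `∂_{x_i}`. -/
noncomputable def dirX {n : ℕ} (i : Fin n) : Pt n := (EuclideanSpace.single i 1, 0, 0)

/-- The coordinate direction `∂_y`. -/
def dirY (n : ℕ) : Pt n := (0, 1, 0)

/-- The coordinate direction `∂_t`. -/
def dirT (n : ℕ) : Pt n := (0, 0, 1)

/-- Smooth functions with compact support in the open half-space `{y > 0}`. -/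
def IsTest {n : ℕ} (η : Pt n → ℝ) : Prop :=
  ContDiff ℝ ∞ η ∧ HasCompactSupport η ∧ tsupport η ⊆ openHalf n

/-- `D` is the (classical) derivative of `W` in direction `v` in `{y > 0}`, and it is continuous up
to `{y = 0}`. -/
def IsDerivContUpTo {n : ℕ} (W : Pt n → ℝ) (v : Pt n) (D : Pt n → ℝ) : Prop :=
  (∀ p ∈ openHalf n, HasLineDerivAt ℝ W (D p) p v) ∧ ContinuousOn D (closedHalf n)

/-- `V` is the weak (distributional) derivative `∂_y W` in `{y > 0}`. -/
def IsWeakDerivY {n : ℕ} (W V : Pt n → ℝ) : Prop :=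
  LocallyIntegrableOn V (openHalf n) ∧
    ∀ η : Pt n → ℝ, IsTest η →
      ∫ p in openHalf n, W p * fderiv ℝ η p (dirY n) = - ∫ p in openHalf n, V p * η p

/-- Weak form of `div (y^a ∇ W) + y^a W_t = f` in `{y > 0}`, where `div` and `∇` are taken in
`(x, y)` and `∇ W = (Wx, Wy)`:
`∫ y^a (⟨∇W, ∇η⟩ - W_t η) = - ∫ f η` for every test function `η`. -/
def IsWeakSol {n : ℕ} (a : ℝ) (Wx : Fin n → Pt n → ℝ) (Wy Wt f : Pt n → ℝ) : Prop :=
  ∀ η : Pt n → ℝ, IsTest η →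
    ∫ p in openHalf n, p.2.1 ^ a *
        ((∑ i, Wx i p * fderiv ℝ η p (dirX i)) + Wy p * fderiv ℝ η p (dirY n) - Wt p * η p)
      = - ∫ p in openHalf n, f p * η p

/-- `g` is the weighted normal derivative `∂_y^a W = lim_{y → 0+} y^a ∂_y W(·, y, ·)` on `{y = 0}`.
As `Wy` is a weak derivative, defined up to null sets only, the limit is an essential limit in `y`,
and it is taken in the sense of distributions in `(x, t)`. -/
def IsWeightedNormalDeriv {n : ℕ} (a : ℝ) (Wy : Pt n → ℝ)
    (g : EuclideanSpace ℝ (Fin n) × ℝ → ℝ) : Prop :=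
  LocallyIntegrable g ∧
    ∀ ζ : EuclideanSpace ℝ (Fin n) × ℝ → ℝ, ContDiff ℝ ∞ ζ → HasCompactSupport ζ →
      Tendsto (fun y : ℝ => ∫ q, y ^ a * Wy (q.1, y, q.2) * ζ q)
        (𝓝[>] (0 : ℝ) ⊓ ae volume) (𝓝 (∫ q, g q * ζ q))

/-- The weight `φ(x, y) = -|x|²/4 + 2 (-y^{a+1}/(a+1) + y²/2)`. -/
noncomputable def phi {n : ℕ} (a : ℝ) (p : Pt n) : ℝ :=
  -(‖p.1‖ ^ 2 / 4) + 2 * (-(p.2.1 ^ (a + 1) / (a + 1)) + p.2.1 ^ 2 / 2)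

end Carleman

/-! Write z = (x,t), let h be the normal part of φ, so h' = 2(y - y^a), and put v = e^{αφ}W, G =
e^{αφ}f. The conjugated equation is split as R + y^a M = G. Here M contains the first-order part:
v_t, the tangential and normal drift terms, and an extra -αv, which is compensated by +α y^a v in R.
Since R M = G M - y^a M² ≤ G² y^{-a}/4, it suffices to bound the integral of R M from below. The
product R M is a sum of three pieces: the y-derivative of a flux, terms that integrate to zero in z
for each fixed y, and a positive commutator (`hasDerivAt_flux`).

The extra -αv is forced by the tangential variables. With S = Δ_x + α²|x|²/4 and K = ∂_t + αx·∇ +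
αn/2 one has ½[S,K] = αS - α³|x|²/2, and the indefinite term α⟨Sv,v⟩ is exactly what -αv cancels
(`isNull_tanSymm_mul_tanSkew`). What remains, -α³|x|²v²/2, is beaten by the normal commutator,
because h' ≤ -1 and h'' ≥ 2 for 0 < y ≤ 1/2 (`commutatorTerm_ge`). For a < 0 the weighted Laplacian
of φ contains y^{a-1}. The resulting singular terms are turned into a nonnegative square, of Hardy
type, by one more flux term. The flux vanishes at y = 1. At y = 0 the expansion W ~ g y^{1-a}/(1-a)
makes it converge to 2αg²/(1-a) times the weight (`tendsto_flux`), which is the boundary term of the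
inequality.

The solution is not regular enough for this computation, so W is first mollified in z only. For
fixed z the mollification U solves an ODE in y with integrable right-hand side. Hence y^a U_y is
absolutely continuous with value g⋆ρ at 0 (`hasDerivAt_of_weak_ode`), and U is smooth in z. This
suffices for the inequality along each normal line (`carleman_inequality_normal`). Integration in z
then removes the tangential terms (`isNull_tangentialTerm`, `IsSolFamily.carleman`), where Fubini is
justified by |U| ≤ B y^{1-a}.

To remove the mollification, α is kept fixed and the mollifiers live at scale at most 1/(4α), where
e^{2αφ} varies by at most a factor 2. A weighted Young inequality (`lintegral_mul_enorm_conv_sq_le`)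
then controls the mollified f and g by the original ones, and Fatou's lemma handles the left side.
The constant obtained is 1. -/

namespace Carleman

/-! ### Distributions on the half-line and the weighted second-order ODE. -/

/-- Smooth functions of one variable with compact support in `(0, ∞)`. -/
def IsTestIoi (χ : ℝ → ℝ) : Prop :=
  ContDiff ℝ ∞ χ ∧ HasCompactSupport χ ∧ tsupport χ ⊆ Set.Ioi 0

theorem exists_Icc_of_isCompact_subset_Ioi {K : Set ℝ} (hK : IsCompact K) (h : K ⊆ Set.Ioi 0) :
    ∃ l L : ℝ, 0 < l ∧ l < L ∧ K ⊆ Set.Ioo l L := by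
  rcases K.eq_empty_or_nonempty with rfl | hne
  · exact ⟨1, 2, one_pos, one_lt_two, Set.empty_subset _⟩
  · obtain ⟨m, hm, hm'⟩ := hK.exists_isLeast hne
    obtain ⟨M, hM, hM'⟩ := hK.exists_isGreatest hne
    have h0 : 0 < m := h hm
    refine ⟨m / 2, M + 1, by positivity, ?_, fun x hx => ⟨?_, ?_⟩⟩
    · linarith [hm' hM]
    · linarith [hm' hx]
    · linarith [hM' hx]

theorem IsTestIoi.exists_Ioo {χ : ℝ → ℝ} (h : IsTestIoi χ) :
    ∃ l L : ℝ, 0 < l ∧ l < L ∧ tsupport χ ⊆ Set.Ioo l L :=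
  exists_Icc_of_isCompact_subset_Ioi h.2.1 h.2.2

theorem isTestIoi_of_subset_Icc {χ : ℝ → ℝ} (h : ContDiff ℝ ∞ χ) {l L : ℝ} (hl : 0 < l)
    (hs : Function.support χ ⊆ Set.Icc l L) : IsTestIoi χ := by
  have : tsupport χ ⊆ Set.Icc l L := closure_minimal hs isClosed_Icc
  exact ⟨h, isCompact_Icc.of_isClosed_subset (isClosed_tsupport χ) this,
    this.trans fun x hx => hl.trans_le hx.1⟩

theorem integrableOn_Icc_of_locallyIntegrableOn_Ioi {w : ℝ → ℝ}
    (hw : LocallyIntegrableOn w (Set.Ioi 0)) {l L : ℝ} (hl : 0 < l) :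
    IntegrableOn w (Set.Icc l L) :=
  hw.integrableOn_compact_subset (fun _ hx => hl.trans_le hx.1) isCompact_Icc

theorem integrable_mul_test {w : ℝ → ℝ} (hw : LocallyIntegrableOn w (Set.Ioi 0)) {χ : ℝ → ℝ}
    (hχ : Continuous χ) {l L : ℝ} (hl : 0 < l) (hs : tsupport χ ⊆ Set.Icc l L) :
    Integrable (fun y => w y * χ y) := by
  have h1 : IntegrableOn (fun y => w y * χ y) (Set.Icc l L) :=
    (integrableOn_Icc_of_locallyIntegrableOn_Ioi hw hl).mul_continuousOn hχ.continuousOn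
      isCompact_Icc
  refine h1.integrable_of_forall_notMem_eq_zero fun x hx => ?_
  rw [image_eq_zero_of_notMem_tsupport fun h => hx (hs h), mul_zero]

theorem IsTestIoi.integrable_mul {w χ : ℝ → ℝ} (hw : LocallyIntegrableOn w (Set.Ioi 0))
    (hχ : IsTestIoi χ) : Integrable (fun y => w y * χ y) := by
  obtain ⟨l, L, hl, -, hs⟩ := hχ.exists_Ioo
  exact integrable_mul_test hw hχ.1.continuous hl (hs.trans Set.Ioo_subset_Icc_self)

theorem IsTestIoi.deriv {χ : ℝ → ℝ} (h : IsTestIoi χ) : IsTestIoi (deriv χ) :=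
  ⟨(contDiff_infty_iff_deriv.1 h.1).2, h.2.1.deriv, (tsupport_deriv_subset).trans h.2.2⟩

/-- The lemma of du Bois-Reymond on `(0, ∞)`. -/
theorem ae_eq_const_of_integral_mul_deriv_eq_zero {w : ℝ → ℝ}
    (hw : LocallyIntegrableOn w (Set.Ioi 0))
    (h : ∀ χ, IsTestIoi χ → ∫ y, w y * deriv χ y = 0) :
    ∃ c, ∀ᵐ y, y ∈ Set.Ioi (0 : ℝ) → w y = c := by
  let b : ContDiffBump (1 : ℝ) := ⟨1 / 4, 1 / 2, by norm_num, by norm_num⟩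
  set χ₀ : ℝ → ℝ := b.normed volume with hχ₀
  have hχ₀s : ContDiff ℝ ∞ χ₀ := b.contDiff_normed
  have hχ₀supp : tsupport χ₀ ⊆ Set.Icc (1 / 2) (3 / 2) := by
    rw [hχ₀, b.tsupport_normed_eq, Real.closedBall_eq_Icc]
    norm_num [b]
  have hχ₀t : IsTestIoi χ₀ := isTestIoi_of_subset_Icc hχ₀s (by norm_num)
    ((subset_tsupport _).trans hχ₀supp)
  have hχ₀i : ∫ y, χ₀ y = 1 := b.integral_normed
  refine ⟨∫ y, w y * χ₀ y, ?_⟩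
  set c := ∫ y, w y * χ₀ y with hc
  have hwc : LocallyIntegrableOn (fun y => w y - c) (Set.Ioi 0) :=
    hw.sub ((locallyIntegrable_const c).locallyIntegrableOn _)
  have := isOpen_Ioi.ae_eq_zero_of_integral_contDiff_smul_eq_zero hwc (fun ψ h1 h2 h3 => ?_)
  · filter_upwards [this] with y hy h0
    linarith [hy h0]
  have hψ : IsTestIoi ψ := ⟨h1, h2, h3⟩
  have hψint : Integrable ψ := h1.continuous.integrable_of_hasCompactSupport h2
  have hχ₀int : Integrable χ₀ := hχ₀s.continuous.integrable_of_hasCompactSupport hχ₀t.2.1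
  -- Removing the mass of `ψ` with the fixed bump `χ₀` gives mean zero, so the primitive `X` of `θ`
  -- again has compact support in the half-line and may be used as a test function.
  set θ : ℝ → ℝ := fun y => ψ y - (∫ x, ψ x) * χ₀ y with hθ
  have hθs : ContDiff ℝ ∞ θ := h1.sub (contDiff_const.mul hχ₀s)
  have hθint : Integrable θ := hψint.sub (hχ₀int.const_mul _)
  have hθ0 : ∫ y, θ y = 0 := by
    rw [hθ, integral_sub hψint (hχ₀int.const_mul _), integral_const_mul, hχ₀i]; ring
  obtain ⟨l, L, hl, hlL, hsub⟩ := exists_Icc_of_isCompact_subset_Ioi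
    (h2.isCompact.union hχ₀t.2.1.isCompact) (Set.union_subset h3 hχ₀t.2.2)
  have hθz : ∀ y, y ∉ Set.Ioo l L → θ y = 0 := fun y hy => by
    have h1 : ψ y = 0 := image_eq_zero_of_notMem_tsupport fun h' => hy (hsub (Or.inl h'))
    have h2 : χ₀ y = 0 := image_eq_zero_of_notMem_tsupport fun h' => hy (hsub (Or.inr h'))
    simp [hθ, h1, h2]
  set X : ℝ → ℝ := fun y => ∫ t in (0 : ℝ)..y, θ t with hX
  have hXd : ∀ y, HasDerivAt X (θ y) y := fun y =>
    intervalIntegral.integral_hasDerivAt_right (hθs.continuous.intervalIntegrable _ _)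
      (hθs.continuous.stronglyMeasurableAtFilter _ _) hθs.continuous.continuousAt
  have hXderiv : deriv X = θ := funext fun y => (hXd y).deriv
  have hXs : ContDiff ℝ ∞ X := contDiff_infty_iff_deriv.2
    ⟨fun y => (hXd y).differentiableAt, by rwa [hXderiv]⟩
  have hXsupp : Function.support X ⊆ Set.Icc l L := by
    intro y hy
    by_contra hcon
    apply hy
    rcases lt_or_ge y l with h' | h'
    · simp only [hX]
      rw [intervalIntegral.integral_congr (g := fun _ => 0) ?_]
      · simp
      · intro t ht
        refine hθz t fun hh => ?_
        have : t ≤ max 0 y := ht.2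
        rcases le_max_iff.1 this with h | h <;> linarith [hh.1]
    · have hyL : L < y := by
        by_contra h''
        exact hcon ⟨h', not_lt.1 h''⟩
      have : ∫ t in (0 : ℝ)..y, θ t = ∫ t, θ t := by
        apply intervalIntegral.integral_eq_integral_of_support_subset
        intro t ht
        by_contra hh
        refine ht (hθz t fun h3 => hh ⟨hl.trans h3.1, h3.2.le.trans hyL.le⟩)
      simp only [hX, this, hθ0]
  have key := h X (isTestIoi_of_subset_Icc hXs hl hXsupp)
  rw [hXderiv] at key
  have i1 := hψ.integrable_mul hw
  have i2 := hχ₀t.integrable_mul hw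
  have e1 : ∫ y, w y * θ y = (∫ y, w y * ψ y) - (∫ x, ψ x) * c := by
    rw [hc, ← integral_const_mul, ← integral_sub i1 (i2.const_mul _)]
    congr 1; ext y; simp only [hθ]; ring
  have e2 : ∫ y, ψ y • (w y - c) = (∫ y, w y * ψ y) - (∫ x, ψ x) * c := by
    rw [← integral_mul_const, ← integral_sub i1 (hψint.mul_const _)]
    congr 1; ext y; simp only [smul_eq_mul]; ring
  rw [e2, ← e1, key]

/-- Integration by parts of a primitive against a test function. -/
theorem integral_primitive_mul_deriv {F : ℝ → ℝ} (hF : ∀ b, 0 ≤ b → IntervalIntegrable F volume 0 b)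
    (c : ℝ) {χ : ℝ → ℝ} (hχ : IsTestIoi χ) :
    ∫ y, (c + ∫ t in (0 : ℝ)..y, F t) * deriv χ y = - ∫ y, F y * χ y := by
  obtain ⟨l, L, hl, hlL, hs⟩ := hχ.exists_Ioo
  have hL : 0 ≤ L := hl.le.trans hlL.le
  set P : ℝ → ℝ := fun y => c + ∫ t in (0 : ℝ)..y, F t with hP
  have hPac : AbsolutelyContinuousOnInterval P 0 L := by
    have h1 : AbsolutelyContinuousOnInterval (fun _ : ℝ => c) 0 L :=
      (contDiff_const.contDiffOn).absolutelyContinuousOnInterval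
    exact h1.fun_add
      ((hF L hL).absolutelyContinuousOnInterval_intervalIntegral (c := 0) (by simp))
  have hχac : AbsolutelyContinuousOnInterval χ 0 L :=
    ((hχ.1.of_le (by simp)).contDiffOn).absolutelyContinuousOnInterval
  have key := hPac.integral_mul_deriv_eq_deriv_mul hχac
  have z0 : χ 0 = 0 := image_eq_zero_of_notMem_tsupport fun h => by
    have := (hs h).1; linarith
  have zL : χ L = 0 := image_eq_zero_of_notMem_tsupport fun h => by
    have := (hs h).2; linarith
  rw [z0, zL, mul_zero, mul_zero, sub_zero, zero_sub] at key
  have e1 : ∫ y in (0 : ℝ)..L, P y * deriv χ y = ∫ y, P y * deriv χ y := by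
    apply intervalIntegral.integral_eq_integral_of_support_subset
    intro y hy
    have h1 : y ∈ tsupport (deriv χ) := by
      by_contra h
      exact hy (by simp [image_eq_zero_of_notMem_tsupport h])
    have := hs (tsupport_deriv_subset h1)
    exact ⟨hl.trans this.1, this.2.le⟩
  have e2 : ∫ y in (0 : ℝ)..L, deriv P y * χ y = ∫ y in (0 : ℝ)..L, F y * χ y := by
    apply intervalIntegral.integral_congr_ae
    filter_upwards [(hF L hL).ae_hasDerivAt_integral] with y hy hy'
    have := (hy (Set.uIoc_subset_uIcc hy') 0 (by simp)).const_add c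
    rw [this.deriv]
  have e3 : ∫ y in (0 : ℝ)..L, F y * χ y = ∫ y, F y * χ y := by
    apply intervalIntegral.integral_eq_integral_of_support_subset
    intro y hy
    have h1 : y ∈ tsupport χ := by
      by_contra h
      exact hy (by simp [image_eq_zero_of_notMem_tsupport h])
    have := hs h1
    exact ⟨hl.trans this.1, this.2.le⟩
  rw [e1, e2, e3] at key
  exact key

theorem continuousOn_primitive_Ici {F : ℝ → ℝ}
    (hF : ∀ b, 0 ≤ b → IntervalIntegrable F volume 0 b) :
    ContinuousOn (fun y => ∫ t in (0 : ℝ)..y, F t) (Set.Ici 0) := by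
  intro x hx
  have hx0 : (0 : ℝ) ≤ x := hx
  have h := intervalIntegral.continuousOn_primitive_interval'
    (hF (x + 1) (by linarith)) (a := 0) (by simp)
  rw [Set.uIcc_of_le (by linarith)] at h
  exact (h x ⟨hx0, by linarith⟩).mono_of_mem_nhdsWithin
    (mem_of_superset (inter_mem_nhdsWithin (Set.Ici (0 : ℝ)) (Iio_mem_nhds (lt_add_one x)))
      fun y hy => ⟨hy.1, le_of_lt hy.2⟩)

/-- Every interval (0,u) has positive measure, so an essential limit at 0⁺ is unique. This is what
makes the weighted normal derivative usable as an initial value. -/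
theorem neBot_nhdsGT_inf_ae : (𝓝[>] (0 : ℝ) ⊓ ae volume).NeBot := by
  rw [inf_comm, inf_neBot_iff_frequently_left]
  intro p hp
  by_contra hcon
  rw [not_frequently] at hcon
  obtain ⟨u, hu, hu'⟩ := mem_nhdsGT_iff_exists_Ioo_subset.1 hcon
  have hnull : volume (Set.Ioo (0 : ℝ) u) = 0 := by
    refine measure_mono_null (t := {y | p y}ᶜ) (fun y hy h => ?_) hp
    exact hu' hy h
  rw [Real.volume_Ioo, ENNReal.ofReal_eq_zero, sub_zero] at hnull
  exact absurd hu (not_lt.2 hnull)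

/-- A weak solution of the one-dimensional equation `(y^a u')' = F` on `(0, ∞)` with weighted normal
derivative `g₀` at `0` is a classical one. -/
theorem hasDerivAt_of_weak_ode {a : ℝ} (ha : a ≤ 0) {u V F : ℝ → ℝ} {g₀ : ℝ}
    (hu : ContinuousOn u (Set.Ioi 0)) (hV : LocallyIntegrableOn V (Set.Ioi 0))
    (hF : ∀ b, 0 ≤ b → IntervalIntegrable F volume 0 b)
    (h1 : ∀ χ, IsTestIoi χ → ∫ y, u y * deriv χ y = - ∫ y, V y * χ y)
    (h2 : ∀ χ, IsTestIoi χ → ∫ y, (y ^ a * V y) * deriv χ y = - ∫ y, F y * χ y)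
    (hg : Tendsto (fun y => y ^ a * V y) (𝓝[>] (0 : ℝ) ⊓ ae volume) (𝓝 g₀)) {y : ℝ} (hy : 0 < y) :
    HasDerivAt u (y ^ (-a) * (g₀ + ∫ t in (0 : ℝ)..y, F t)) y := by
  set P : ℝ → ℝ := fun y => g₀ + ∫ t in (0 : ℝ)..y, F t with hP
  have hPc : ContinuousOn P (Set.Ici 0) := continuousOn_const.add (continuousOn_primitive_Ici hF)
  have hPc' : ContinuousOn P (Set.Ioi 0) := hPc.mono Set.Ioi_subset_Ici_self
  have hPl : LocallyIntegrableOn P (Set.Ioi 0) := hPc'.locallyIntegrableOn measurableSet_Ioi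
  have hYl : LocallyIntegrableOn (fun y => y ^ a * V y) (Set.Ioi 0) :=
    hV.continuousOn_mul (fun y hy => (Real.continuousAt_rpow_const y a
      (Or.inl (ne_of_gt hy))).continuousWithinAt) isOpen_Ioi.isLocallyClosed
  -- The weak flux y^a V and the primitive `P` have the same distributional derivative `F`, hence
  -- differ by a constant; the essential limit at 0 then forces that constant to vanish.
  obtain ⟨c, hc⟩ := ae_eq_const_of_integral_mul_deriv_eq_zero (hYl.sub hPl) (fun χ hχ => by
    have i1 := hχ.deriv.integrable_mul hYl
    have i2 := hχ.deriv.integrable_mul hPl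
    have : ∀ y, ((fun y => y ^ a * V y) - P) y * deriv χ y
        = (y ^ a * V y) * deriv χ y - P y * deriv χ y := fun y => by simp; ring
    simp_rw [this]
    rw [integral_sub i1 i2, h2 χ hχ, hP, integral_primitive_mul_deriv hF g₀ hχ, sub_self])
  have hc0 : c = 0 := by
    have := neBot_nhdsGT_inf_ae
    have hP0 : Tendsto P (𝓝[>] (0 : ℝ) ⊓ ae volume) (𝓝 g₀) := by
      have : Tendsto P (𝓝[>] 0) (𝓝 (P 0)) :=
        ((hPc 0 Set.self_mem_Ici).mono Set.Ioi_subset_Ici_self)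
      simp only [hP, intervalIntegral.integral_same, add_zero] at this
      exact this.mono_left inf_le_left
    have hsub := hg.sub hP0
    rw [sub_self] at hsub
    refine tendsto_nhds_unique (tendsto_const_nhds.congr' ?_) hsub
    have e1 : ∀ᶠ y in 𝓝[>] (0 : ℝ) ⊓ ae volume, y ∈ Set.Ioi (0 : ℝ) :=
      Eventually.filter_mono inf_le_left self_mem_nhdsWithin
    have e2 := Eventually.filter_mono (inf_le_right : 𝓝[>] (0 : ℝ) ⊓ ae volume ≤ ae volume) hc
    filter_upwards [e1, e2] with y hy1 hy2
    exact (hy2 hy1).symm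
  have hVP : ∀ᵐ y, y ∈ Set.Ioi (0 : ℝ) → V y = y ^ (-a) * P y := by
    filter_upwards [hc] with y hy hy0
    have h3 := hy hy0
    simp only [Pi.sub_apply, hc0] at h3
    rw [← sub_eq_zero.1 h3, ← mul_assoc, ← Real.rpow_add hy0, neg_add_cancel, Real.rpow_zero,
      one_mul]
  -- Here a ≤ 0 matters: y^{-a} is continuous up to y = 0, so the second integration may also start
  -- at 0.
  have hYc : ContinuousOn (fun y => y ^ (-a) * P y) (Set.Ici 0) :=
    ((Real.continuous_rpow_const (by linarith)).continuousOn).mul hPc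
  have hQi : ∀ b : ℝ, 0 ≤ b → IntervalIntegrable (fun y => y ^ (-a) * P y) volume 0 b :=
    fun b hb => (hYc.mono (by
      rw [Set.uIcc_of_le hb]; exact Set.Icc_subset_Ici_self)).intervalIntegrable
  set q : ℝ → ℝ := fun y => ∫ t in (0 : ℝ)..y, t ^ (-a) * P t with hq
  have hqc : ContinuousOn q (Set.Ioi 0) :=
    (continuousOn_primitive_Ici hQi).mono Set.Ioi_subset_Ici_self
  have hul : LocallyIntegrableOn u (Set.Ioi 0) := hu.locallyIntegrableOn measurableSet_Ioi
  have hql : LocallyIntegrableOn q (Set.Ioi 0) := hqc.locallyIntegrableOn measurableSet_Ioi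
  obtain ⟨d, hd⟩ := ae_eq_const_of_integral_mul_deriv_eq_zero (hul.sub hql) (fun χ hχ => by
    have i1 := hχ.deriv.integrable_mul hul
    have i2 := hχ.deriv.integrable_mul hql
    have : ∀ y, (u - q) y * deriv χ y = u y * deriv χ y - q y * deriv χ y :=
      fun y => by simp; ring
    simp_rw [this]
    have h3 := integral_primitive_mul_deriv hQi 0 hχ
    simp only [zero_add] at h3
    rw [integral_sub i1 i2, h1 χ hχ, hq, h3, sub_eq_zero]
    congr 1
    apply integral_congr_ae
    filter_upwards [hVP] with y hy
    by_cases h0 : y ∈ Set.Ioi (0 : ℝ)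
    · rw [hy h0]
    · rw [image_eq_zero_of_notMem_tsupport fun h => h0 (hχ.2.2 h), mul_zero, mul_zero])
  have huq : ∀ y ∈ Set.Ioi (0 : ℝ), u y = q y + d := by
    -- Both sides are continuous, so the almost everywhere identity holds at every point.
    have h4 : Set.EqOn u (fun y => q y + d) (Set.Ioi 0) := by
      refine Measure.eqOn_open_of_ae_eq (μ := volume) ?_ isOpen_Ioi hu (hqc.add continuousOn_const)
      rw [Filter.EventuallyEq, ae_restrict_iff' measurableSet_Ioi]
      filter_upwards [hd] with y hy h0
      have := hy h0
      simp only [Pi.sub_apply] at this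
      linarith
    exact h4
  have hqd : HasDerivAt q (y ^ (-a) * P y) y := by
    refine intervalIntegral.integral_hasDerivAt_right (hQi y hy.le) ?_ ?_
    · exact ContinuousOn.stronglyMeasurableAtFilter isOpen_Ioi
        (hYc.mono Set.Ioi_subset_Ici_self) y hy
    · exact hYc.continuousAt (Ici_mem_nhds hy)
  refine (hqd.add_const d).congr_of_eventuallyEq ?_
  filter_upwards [Ioi_mem_nhds hy] with x hx using huq x hx

/-! ### The pointwise commutator identity in the normal variable. -/

theorem absolutelyContinuousOnInterval_of_hasDerivAt {f f' : ℝ → ℝ} {b c : ℝ}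
    (h : ∀ y ∈ Set.uIcc b c, HasDerivAt f (f' y) y) (hc : ContinuousOn f' (Set.uIcc b c)) :
    AbsolutelyContinuousOnInterval f b c := by
  obtain ⟨K, hK⟩ := isCompact_uIcc.exists_bound_of_continuousOn hc
  have hl : LipschitzOnWith (Real.toNNReal K) f (Set.uIcc b c) :=
    (convex_uIcc b c).lipschitzOnWith_of_nnnorm_hasDerivWithin_le
      (fun y hy => (h y hy).hasDerivWithinAt) (fun y hy => by
        rw [← NNReal.coe_le_coe, coe_nnnorm]
        exact (hK y hy).trans (Real.le_coe_toNNReal K))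
  exact hl.absolutelyContinuousOnInterval

theorem hasDerivAt_rpow_div (a : ℝ) {y : ℝ} (hy : 0 < y) :
    HasDerivAt (fun y : ℝ => y ^ a) (a * y ^ a / y) y := by
  have := Real.hasDerivAt_rpow_const (x := y) (p := a) (Or.inl hy.ne')
  rwa [Real.rpow_sub_one hy.ne', ← mul_div_assoc] at this

theorem absolutelyContinuousOnInterval_rpow (a : ℝ) {δ : ℝ} (hδ : 0 < δ) (hδ1 : δ ≤ 1) :
    AbsolutelyContinuousOnInterval (fun y : ℝ => y ^ a) δ 1 := by
  have hpos : ∀ y ∈ Set.uIcc δ 1, 0 < y := fun y hy => by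
    rw [Set.uIcc_of_le hδ1] at hy; exact hδ.trans_le hy.1
  refine absolutelyContinuousOnInterval_of_hasDerivAt
    (fun y hy => hasDerivAt_rpow_div a (hpos y hy)) ?_
  intro y hy
  exact ((continuousAt_const.mul (Real.continuousAt_rpow_const y a
    (Or.inl (hpos y hy).ne'))).div continuousAt_id (hpos y hy).ne').continuousWithinAt

/-- The normal derivative `h'` of the weight. -/
noncomputable def dWeight (a y : ℝ) : ℝ := 2 * (y - y ^ a)

/-- The normal part `y^{-a} (y^a h')'` of `y^{-a} div (y^a ∇φ)`. -/
noncomputable def lapWeight (a y : ℝ) : ℝ := 2 * (-2 * a * y ^ a / y + a + 1)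

/-- The flux functional produced by integrating the normal part of the commutator. -/
noncomputable def flux (a α : ℝ) (v Q p r : ℝ → ℝ) (y : ℝ) : ℝ :=
  Q y * p y - α * (y ^ a * dWeight a y) * (r y * v y)
    - α * dWeight a y * y ^ (-a) * (Q y * Q y)
    - α * (lapWeight a y + 1) * (v y * Q y)
    - (α ^ 3 * dWeight a y ^ 2 + α ^ 2) * (y ^ a * dWeight a y) * (v y * v y)
    - 2 * α * a * (1 - a) * ((y ^ a * y ^ (-1 : ℝ)) * (y ^ a * y ^ (-1 : ℝ))) * (v y * v y)

/-- The terms of the pointwise commutator identity which integrate to zero tangentially. -/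
noncomputable def tangentialTerm (a α X y v Q p pQ r rQ : ℝ) : ℝ :=
  - (Q * pQ) / y ^ a + y ^ a * (r * p - α * (r * v) + α ^ 3 / 2 * X * v ^ 2)
    + α * dWeight a y * (rQ * v - r * Q) + (α ^ 2 * dWeight a y ^ 2 + α) * (y ^ a * (v * p))

/-- The positive part of the pointwise commutator identity. -/
noncomputable def commutatorTerm (a α X y v Q : ℝ) : ℝ :=
  5 * α * Q ^ 2 / y ^ a - 4 * α * a * (Q - (1 - a) * (y ^ a / y) * v) ^ 2 / y
    + y ^ a * v ^ 2 * (α ^ 3 * (2 * dWeight a y ^ 2 * (2 * (1 - a * y ^ a / y))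
      - dWeight a y ^ 2 - X / 2) - α ^ 2)

/-- The multiplier applied to the conjugated equation. -/
noncomputable def multiplier (a α y v Q p : ℝ) : ℝ :=
  p - 2 * α * dWeight a y * Q / y ^ a - α * (lapWeight a y + 1) * v

/-- The conjugated operator minus the multiplier, times `y^a`. -/
noncomputable def remainder (a α y v r S : ℝ) : ℝ :=
  S + y ^ a * r + (α ^ 2 * dWeight a y ^ 2 + α) * (y ^ a * v)

theorem hasDerivAt_dWeight (a : ℝ) {y : ℝ} (hy : 0 < y) :
    HasDerivAt (dWeight a) (2 * (1 - a * y ^ a / y)) y :=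
  ((hasDerivAt_id y).sub (hasDerivAt_rpow_div a hy)).const_mul 2

theorem hasDerivAt_lapWeight (a : ℝ) {y : ℝ} (hy : 0 < y) :
    HasDerivAt (lapWeight a) (-4 * a * (a - 1) * y ^ a / y ^ 2) y := by
  have h1 := (((((hasDerivAt_rpow_div a hy).const_mul (-2 * a)).div (hasDerivAt_id y)
    hy.ne').add_const a).add_const 1).const_mul 2
  refine h1.congr_deriv ?_
  simp only [id]
  field_simp
  ring

/-- This is the core algebraic identity, obtained by expanding the product of remainder and
multiplier and collecting total y-derivatives. The parameter `X` enters the commutator and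
tangential terms with opposite signs and cancels; it serves to move the |x|² term into the
tangential part. Differentiating the y^{a-1} in `lapWeight` leaves a cross term in v and Q. The last
summand of `flux` supplies the rest of the square of Q - (1-a) y^{a-1} v. -/
theorem hasDerivAt_flux (a α X : ℝ) {v Q p r : ℝ → ℝ} {y : ℝ} {pQ rQ S : ℝ} (hy : 0 < y)
    (hv : HasDerivAt v (Q y / y ^ a) y) (hp : HasDerivAt p (pQ / y ^ a) y)
    (hr : HasDerivAt r (rQ / y ^ a) y) (hQ : HasDerivAt Q S y) :
    HasDerivAt (flux a α v Q p r)
      (remainder a α y (v y) (r y) S * multiplier a α y (v y) (Q y) (p y)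
        - commutatorTerm a α X y (v y) (Q y)
        - tangentialTerm a α X y (v y) (Q y) (p y) pQ (r y) rQ) y := by
  have hY := hasDerivAt_rpow_div a hy
  have hY' := hasDerivAt_rpow_div (-a) hy
  have hy1 := hasDerivAt_rpow_div (-1) hy
  have hw := hasDerivAt_dWeight a hy
  have hk := hasDerivAt_lapWeight a hy
  have hYpos : 0 < y ^ a := Real.rpow_pos_of_pos hy a
  have key := (((((hQ.mul hp).sub (((hY.mul hw).const_mul α).mul (hr.mul hv))).sub
    (((hw.const_mul α).mul hY').mul (hQ.mul hQ))).sub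
    (((hk.add_const 1).const_mul α).mul (hv.mul hQ))).sub
    (((((hw.pow 2).const_mul (α ^ 3)).add_const (α ^ 2)).mul (hY.mul hw)).mul (hv.mul hv))).sub
    ((((hY.mul hy1).mul (hY.mul hy1)).const_mul (2 * α * a * (1 - a))).mul (hv.mul hv))
  refine (key.congr_deriv ?_).congr_of_eventuallyEq (Eventually.of_forall fun t => ?_)
  · simp only [Pi.mul_apply, Pi.pow_apply, remainder, multiplier, commutatorTerm, tangentialTerm,
      lapWeight, dWeight, Real.rpow_neg hy.le, Real.rpow_one]
    have hYne := hYpos.ne'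
    have hyne := hy.ne'
    set Y := y ^ a
    field_simp
    ring
  · simp only [flux, Pi.mul_apply, Pi.sub_apply, Pi.pow_apply]

theorem absolutelyContinuousOnInterval_flux (a α : ℝ) {v Q p r : ℝ → ℝ} {δ : ℝ} (hδ : 0 < δ)
    (hδ1 : δ ≤ 1) (hv : AbsolutelyContinuousOnInterval v δ 1)
    (hp : AbsolutelyContinuousOnInterval p δ 1) (hr : AbsolutelyContinuousOnInterval r δ 1)
    (hQ : AbsolutelyContinuousOnInterval Q δ 1) :
    AbsolutelyContinuousOnInterval (flux a α v Q p r) δ 1 := by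
  have hY := absolutelyContinuousOnInterval_rpow a hδ hδ1
  have hY' := absolutelyContinuousOnInterval_rpow (-a) hδ hδ1
  have hy1 := absolutelyContinuousOnInterval_rpow (-1) hδ hδ1
  have hpos : ∀ y ∈ Set.uIcc δ 1, 0 < y := fun y hy => by
    rw [Set.uIcc_of_le hδ1] at hy; exact hδ.trans_le hy.1
  have hcst : ∀ c : ℝ, AbsolutelyContinuousOnInterval (fun _ : ℝ => c) δ 1 := fun c =>
    (contDiff_const.contDiffOn).absolutelyContinuousOnInterval
  have hid : AbsolutelyContinuousOnInterval (fun y : ℝ => y) δ 1 :=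
    (contDiff_id.contDiffOn).absolutelyContinuousOnInterval
  have hw : AbsolutelyContinuousOnInterval (dWeight a) δ 1 := (hid.fun_sub hY).const_mul 2
  have hk : AbsolutelyContinuousOnInterval (lapWeight a) δ 1 := by
    have h1 : AbsolutelyContinuousOnInterval
        (fun y : ℝ => 2 * ((-2 * a) * (y ^ a * y ^ (-1 : ℝ)) + a + 1)) δ 1 :=
      (((((hY.fun_mul hy1).const_mul (-2 * a)).fun_add (hcst a)).fun_add (hcst 1)).const_mul 2)
    have h2 : lapWeight a = fun y : ℝ => 2 * ((-2 * a) * (y ^ a * y ^ (-1 : ℝ)) + a + 1) := by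
      ext y
      simp only [lapWeight, Real.rpow_neg_one]
      ring
    rw [h2]
    exact h1
  exact (((((hQ.fun_mul hp).fun_sub (((hY.fun_mul hw).const_mul α).fun_mul (hr.fun_mul hv))).fun_sub
    (((hw.const_mul α).fun_mul hY').fun_mul (hQ.fun_mul hQ))).fun_sub
    (((hk.fun_add (hcst 1)).const_mul α).fun_mul (hv.fun_mul hQ))).fun_sub
    ((((by simpa only [pow_two] using (hw.fun_mul hw).const_mul (α ^ 3) :
      AbsolutelyContinuousOnInterval (fun y => α ^ 3 * dWeight a y ^ 2) δ 1)).fun_add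
      (hcst (α ^ 2))).fun_mul (hY.fun_mul hw) |>.fun_mul (hv.fun_mul hv))).fun_sub
    ((((hY.fun_mul hy1).fun_mul (hY.fun_mul hy1)).const_mul (2 * α * a * (1 - a))).fun_mul
      (hv.fun_mul hv))

/-- The two terms containing Q are nonnegative because a ≤ 0. Where v ≠ 0, y ≤ 1/2 gives y^a ≥ 1,
hence h' ≤ -1 and h'' ≥ 2, so the α³ coefficient is at least 4 - 1 - 1/2 = 5/2. -/
theorem commutatorTerm_ge {a α X y v Q : ℝ} (ha0 : a ≤ 0) (hα : 2 < α) (hy : 0 < y)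
    (hs : v ≠ 0 → y ≤ 1 / 2 ∧ X ≤ 1) :
    2 * α ^ 3 * (y ^ a * v ^ 2) ≤ commutatorTerm a α X y v Q := by
  have hY : 0 < y ^ a := Real.rpow_pos_of_pos hy a
  have hα0 : 0 < α := by linarith
  have h1 : 0 ≤ 5 * α * Q ^ 2 / y ^ a := by positivity
  have h2 : 0 ≤ -(4 * α * a * (Q - (1 - a) * (y ^ a / y) * v) ^ 2 / y) := by
    have : -(4 * α * a * (Q - (1 - a) * (y ^ a / y) * v) ^ 2 / y)
      = 4 * α * (-a) * (Q - (1 - a) * (y ^ a / y) * v) ^ 2 / y := by ring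
    rw [this]
    have : 0 ≤ -a := by linarith
    positivity
  have h3 : 2 * α ^ 3 * (y ^ a * v ^ 2) ≤
      y ^ a * v ^ 2 * (α ^ 3 * (2 * dWeight a y ^ 2 * (2 * (1 - a * y ^ a / y))
      - dWeight a y ^ 2 - X / 2) - α ^ 2) := by
    by_cases hv : v = 0
    · simp [hv]
    obtain ⟨hy2, hX⟩ := hs hv
    have hY1 : 1 ≤ y ^ a := Real.one_le_rpow_of_pos_of_le_one_of_nonpos hy (by linarith) ha0
    have hd : 1 ≤ dWeight a y ^ 2 := by
      have : dWeight a y ≤ -1 := by unfold dWeight; linarith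
      nlinarith
    have hh : 0 ≤ - (a * y ^ a / y) := by
      have : -(a * y ^ a / y) = (-a) * y ^ a / y := by ring
      rw [this]
      have : 0 ≤ -a := by linarith
      positivity
    have h4 : 5 / 2 ≤ 2 * dWeight a y ^ 2 * (2 * (1 - a * y ^ a / y)) - dWeight a y ^ 2 - X / 2 := by
      nlinarith
    -- The only place where α > 2, rather than positivity, is needed in this bound: the α² loss
    -- costs at most 1/2 of the 5/2, which leaves the factor 2.
    have h5 : α ^ 2 ≤ α ^ 3 / 2 := by nlinarith [sq_nonneg α]
    have h6 : α ^ 3 * (5 / 2) ≤ α ^ 3 * (2 * dWeight a y ^ 2 * (2 * (1 - a * y ^ a / y))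
      - dWeight a y ^ 2 - X / 2) := mul_le_mul_of_nonneg_left h4 (by positivity)
    calc 2 * α ^ 3 * (y ^ a * v ^ 2) = y ^ a * v ^ 2 * (2 * α ^ 3) := by ring
      _ ≤ _ := mul_le_mul_of_nonneg_left (by linarith) (by positivity)
  unfold commutatorTerm
  linarith

/-- Replacing the remainder by G - y^a M and completing the square in M; the factor 1/4 is the
optimal one. -/
theorem remainder_mul_multiplier_le {a α y v Q p r S G : ℝ} (hy : 0 < y)
    (h : remainder a α y v r S + y ^ a * multiplier a α y v Q p = G) :
    remainder a α y v r S * multiplier a α y v Q p ≤ 1 / 4 * (G ^ 2 * y ^ (-a)) := by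
  have hY : 0 < y ^ a := Real.rpow_pos_of_pos hy a
  set M := multiplier a α y v Q p
  have : remainder a α y v r S = G - y ^ a * M := by linarith
  rw [this, Real.rpow_neg hy.le]
  have h2 : 1 / 4 * (G ^ 2 * (y ^ a)⁻¹) - (G - y ^ a * M) * M = y ^ a * (G / (2 * y ^ a) - M) ^ 2 := by
    field_simp
    ring
  have h3 : 0 ≤ y ^ a * (G / (2 * y ^ a) - M) ^ 2 := by positivity
  linarith

/-! ### Conjugation by the weight and asymptotics at the boundary. -/

/-- The conjugating factor `e^{αφ}` as a function of `y`, where `X = |x|²`. -/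
noncomputable def expWeight (a α X y : ℝ) : ℝ :=
  Real.exp (α * (-(X / 4) + 2 * (-(y ^ (a + 1) / (a + 1)) + y ^ 2 / 2)))

/-- The weighted normal derivative of `e^{αφ} u`, where `P` is that of `u`. -/
noncomputable def conjFlux (a α X : ℝ) (u P : ℝ → ℝ) (y : ℝ) : ℝ :=
  expWeight a α X y * (P y + α * (y ^ a * dWeight a y) * u y)

theorem expWeight_pos (a α X y : ℝ) : 0 < expWeight a α X y := Real.exp_pos _

theorem hasDerivAt_expWeight {a : ℝ} (ha : -1 < a) (α X : ℝ) {y : ℝ} (hy : 0 < y) :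
    HasDerivAt (expWeight a α X) (expWeight a α X y * (α * dWeight a y)) y := by
  have h1 := Real.hasDerivAt_rpow_const (x := y) (p := a + 1) (Or.inl hy.ne')
  have h2 := ((((h1.div_const (a + 1)).neg).add (((hasDerivAt_id y).pow 2).div_const 2)).const_mul
    2).const_add (-(X / 4)) |>.const_mul α |>.exp
  refine h2.congr_deriv ?_
  have ha1 : a + 1 ≠ 0 := by linarith
  simp only [expWeight, dWeight, id, Pi.add_apply, Pi.neg_apply, Pi.pow_apply, add_sub_cancel_right]
  field_simp
  push_cast
  ring

theorem continuous_expWeight {a : ℝ} (ha : -1 < a) (α X : ℝ) : Continuous (expWeight a α X) := by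
  have := Real.continuous_rpow_const (q := a + 1) (by linarith)
  unfold expWeight
  fun_prop

theorem hasDerivAt_expWeight_mul {a : ℝ} (ha : -1 < a) (α X : ℝ) {u P : ℝ → ℝ} {y : ℝ} (hy : 0 < y)
    (hu : HasDerivAt u (y ^ (-a) * P y) y) :
    HasDerivAt (fun y => expWeight a α X y * u y) (conjFlux a α X u P y / y ^ a) y := by
  refine ((hasDerivAt_expWeight ha α X hy).mul hu).congr_deriv ?_
  have hY : y ^ a ≠ 0 := (Real.rpow_pos_of_pos hy a).ne'
  rw [conjFlux, Real.rpow_neg hy.le]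
  field_simp
  ring

theorem hasDerivAt_conjFlux {a : ℝ} (ha : -1 < a) (α X : ℝ) {u P : ℝ → ℝ} {F y : ℝ} (hy : 0 < y)
    (hu : HasDerivAt u (y ^ (-a) * P y) y) (hP : HasDerivAt P F y) :
    HasDerivAt (conjFlux a α X u P) (expWeight a α X y * (F + 2 * α * dWeight a y * P y
      + (α ^ 2 * y ^ a * dWeight a y ^ 2 + α * lapWeight a y * y ^ a) * u y)) y := by
  have h1 := (hasDerivAt_expWeight ha α X hy).mul
    (hP.add ((((hasDerivAt_rpow_div a hy).mul (hasDerivAt_dWeight a hy)).const_mul α).mul hu))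
  refine h1.congr_deriv ?_
  have hY : y ^ a ≠ 0 := (Real.rpow_pos_of_pos hy a).ne'
  have hy' := hy.ne'
  simp only [Pi.add_apply, Pi.mul_apply, Real.rpow_neg hy.le, lapWeight, dWeight]
  set Y := y ^ a
  field_simp
  ring

theorem tendsto_rpow_nhdsGT_zero {q : ℝ} (hq : 0 < q) :
    Tendsto (fun y : ℝ => y ^ q) (𝓝[>] 0) (𝓝 0) := by
  have := (Real.continuous_rpow_const hq.le).tendsto 0
  rw [Real.zero_rpow hq.ne'] at this
  exact this.mono_left nhdsWithin_le_nhds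

/-- A solution with zero trace behaves like `y^{1-a}` near `y = 0`. -/
theorem tendsto_rpow_mul_of_hasDerivAt {a : ℝ} (ha0 : a ≤ 0) {u P : ℝ → ℝ} {g₀ : ℝ}
    (hu : ∀ y, 0 < y → HasDerivAt u (y ^ (-a) * P y) y) (hP : Tendsto P (𝓝[>] 0) (𝓝 g₀))
    (u0 : Tendsto u (𝓝[>] 0) (𝓝 0)) :
    Tendsto (fun y => y ^ a / y * u y) (𝓝[>] 0) (𝓝 (g₀ / (1 - a))) := by
  have h1a : 0 < 1 - a := by linarith
  have hpos : ∀ᶠ y : ℝ in 𝓝[>] 0, 0 < y := self_mem_nhdsWithin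
  have key : Tendsto (fun y => u y / y ^ (1 - a)) (𝓝[>] 0) (𝓝 (g₀ / (1 - a))) := by
    refine HasDerivAt.lhopital_zero_nhdsGT (f' := fun y => y ^ (-a) * P y)
      (g' := fun y => (1 - a) * y ^ (1 - a - 1)) ?_ ?_ ?_ u0 (tendsto_rpow_nhdsGT_zero h1a) ?_
    · filter_upwards [hpos] with y hy using hu y hy
    · filter_upwards [hpos] with y hy using Real.hasDerivAt_rpow_const (Or.inl hy.ne')
    · filter_upwards [hpos] with y hy
      exact (mul_pos h1a (Real.rpow_pos_of_pos hy _)).ne'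
    · refine (hP.div_const (1 - a)).congr' ?_
      filter_upwards [hpos] with y hy
      have : (1 : ℝ) - a - 1 = -a := by ring
      have h2 := (Real.rpow_pos_of_pos hy (-a)).ne'
      rw [this]
      field_simp
  refine key.congr' ?_
  filter_upwards [hpos] with y hy
  have h2 := (Real.rpow_pos_of_pos hy a).ne'
  rw [Real.rpow_sub hy, Real.rpow_one]
  field_simp

/-- Individually singular powers of y are regrouped here. Every u is paired with y^{a-1}, a product
with a finite limit at 0, and the powers of y that remain have exponents 1-a, a+1 and 2, all
positive for -1 < a ≤ 0. -/
theorem flux_eq_of_pos {a : ℝ} (α X : ℝ) {u P τ d : ℝ → ℝ} {y : ℝ} (hy : 0 < y) :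
    flux a α (fun y => expWeight a α X y * u y) (conjFlux a α X u P)
      (fun y => expWeight a α X y * τ y) (fun y => expWeight a α X y * d y) y
    = expWeight a α X y ^ 2 *
      ((P y + α * (2 * (y ^ 2 - y ^ (a + 1))) * (y ^ a / y * u y)) * τ y
        - α * (2 * (y ^ 2 - y ^ (a + 1))) * (y ^ a / y * u y) * d y
        - 2 * α * (y ^ (1 - a) - 1) * (P y + α * (2 * (y ^ 2 - y ^ (a + 1))) * (y ^ a / y * u y)) ^ 2
        - α * (-4 * a + (2 * (a + 1) + 1) * y ^ (1 - a)) * (y ^ a / y * u y)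
          * (P y + α * (2 * (y ^ 2 - y ^ (a + 1))) * (y ^ a / y * u y))
        - (α ^ 3 * (4 * (y ^ (1 - a) - 1) ^ 2 * y ^ (a + 1)) + α ^ 2 * y ^ (1 - a))
          * (2 * (y ^ 2 - y ^ (a + 1))) * (y ^ a / y * u y) ^ 2
        - 2 * α * a * (1 - a) * (y ^ a / y * u y) ^ 2) := by
  have hY : y ^ a ≠ 0 := (Real.rpow_pos_of_pos hy a).ne'
  have hy' := hy.ne'
  simp only [flux, conjFlux, lapWeight, dWeight, Real.rpow_neg hy.le, Real.rpow_one,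
    Real.rpow_sub hy, Real.rpow_add hy]
  set Y := y ^ a
  field_simp
  ring

/-- With y^{a-1}u → g₀/(1-a) three terms survive: Q² contributes 2αg₀², the term with `lapWeight`
contributes 4αa g₀²/(1-a), and the square-completing term contributes -2αa g₀²/(1-a). Their sum is
2αg₀²/(1-a). -/
theorem tendsto_flux {a : ℝ} (ha : -1 < a) (ha0 : a ≤ 0) (α X : ℝ) {u P τ d : ℝ → ℝ} {g₀ : ℝ}
    (hu : ∀ y, 0 < y → HasDerivAt u (y ^ (-a) * P y) y) (hP : Tendsto P (𝓝[>] 0) (𝓝 g₀))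
    (u0 : Tendsto u (𝓝[>] 0) (𝓝 0)) (τ0 : Tendsto τ (𝓝[>] 0) (𝓝 0))
    (d0 : Tendsto d (𝓝[>] 0) (𝓝 0)) :
    Tendsto (flux a α (fun y => expWeight a α X y * u y) (conjFlux a α X u P)
      (fun y => expWeight a α X y * τ y) (fun y => expWeight a α X y * d y)) (𝓝[>] 0)
      (𝓝 (Real.exp (-(α * X / 2)) * (2 * α * g₀ ^ 2 / (1 - a)))) := by
  have hm := tendsto_rpow_mul_of_hasDerivAt ha0 hu hP u0
  have hw := tendsto_rpow_nhdsGT_zero (q := 1 - a) (by linarith)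
  have hb := tendsto_rpow_nhdsGT_zero (q := a + 1) (by linarith)
  have hy2 : Tendsto (fun y : ℝ => y ^ 2) (𝓝[>] 0) (𝓝 0) := by
    have : Tendsto (fun y : ℝ => y ^ 2) (𝓝 0) (𝓝 (0 ^ 2)) := (continuous_pow 2).tendsto 0
    rw [zero_pow two_ne_zero] at this
    exact this.mono_left nhdsWithin_le_nhds
  have hz : Tendsto (fun y : ℝ => 2 * (y ^ 2 - y ^ (a + 1))) (𝓝[>] 0) (𝓝 (2 * (0 - 0))) :=
    (hy2.sub hb).const_mul 2
  have he : Tendsto (expWeight a α X) (𝓝[>] 0) (𝓝 (Real.exp (α * (-(X / 4))))) := by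
    have := ((continuous_expWeight ha α X).tendsto 0).mono_left
      (nhdsWithin_le_nhds (s := Set.Ioi 0))
    simpa [expWeight, Real.zero_rpow (by linarith : a + 1 ≠ 0)] using this
  have hq := hP.add ((hz.const_mul α).mul hm)
  have key := (he.pow 2).mul ((((((hq.mul τ0).sub (((hz.const_mul α).mul hm).mul d0)).sub
    (((hw.sub_const 1).const_mul (2 * α)).mul (hq.pow 2))).sub
    (((((hw.const_mul (2 * (a + 1) + 1)).const_add (-4 * a)).const_mul α).mul hm).mul hq)).sub
    (((((((hw.sub_const 1).pow 2).const_mul 4).mul hb).const_mul (α ^ 3)).add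
      (hw.const_mul (α ^ 2))).mul hz |>.mul (hm.pow 2))).sub
    ((hm.pow 2).const_mul (2 * α * a * (1 - a))))
  have hval : Real.exp (-(α * X / 2)) = Real.exp (α * (-(X / 4))) ^ 2 := by
    rw [← Real.exp_nat_mul]; congr 1; push_cast; ring
  have h1a : (1 : ℝ) - a ≠ 0 := by linarith
  rw [hval]
  refine (key.congr' ?_).trans_eq ?_
  · filter_upwards [self_mem_nhdsWithin] with y hy
    rw [flux_eq_of_pos α X hy]
  · congr 1
    field_simp
    ring

/-! ### The Carleman inequality along a normal line. -/

set_option maxHeartbeats 1000000 in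
/-- One-dimensional form of the Carleman inequality at a fixed tangential point: `d` and `τ` stand
for the tangential symmetric and antisymmetric parts of the operator applied to `u`. -/
theorem carleman_inequality_normal {a α X g₀ : ℝ} (ha : -1 < a) (ha0 : a ≤ 0) (hα : 2 < α)
    {u P τ Pτ d Pd f F : ℝ → ℝ}
    (hu : ∀ y, 0 < y → HasDerivAt u (y ^ (-a) * P y) y)
    (hτ : ∀ y, 0 < y → HasDerivAt τ (y ^ (-a) * Pτ y) y)
    (hd : ∀ y, 0 < y → HasDerivAt d (y ^ (-a) * Pd y) y)
    (hF : ∀ b, 0 ≤ b → IntervalIntegrable F volume 0 b)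
    (hP : ∀ y, 0 ≤ y → P y = g₀ + ∫ t in (0 : ℝ)..y, F t)
    (hPτ : ContinuousOn Pτ (Set.Ioi 0)) (hPd : ContinuousOn Pd (Set.Ioi 0))
    (hFf : ∀ y, 0 < y → F y = f y - y ^ a * (τ y + d y))
    (u0 : Tendsto u (𝓝[>] 0) (𝓝 0)) (τ0 : Tendsto τ (𝓝[>] 0) (𝓝 0))
    (d0 : Tendsto d (𝓝[>] 0) (𝓝 0)) (u1 : u 1 = 0) (P1 : P 1 = 0)
    (hs : ∀ y, 0 < y → u y ≠ 0 → y ≤ 1 / 2 ∧ X ≤ 1)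
    (hI : IntegrableOn (fun y => y ^ a * (expWeight a α X y * u y) ^ 2) (Set.Ioc 0 1))
    (hf : IntegrableOn (fun y => (expWeight a α X y * f y) ^ 2 * y ^ (-a)) (Set.Ioc 0 1))
    (hN : IntegrableOn (fun y => tangentialTerm a α X y (expWeight a α X y * u y)
      (conjFlux a α X u P y) (expWeight a α X y * τ y) (conjFlux a α X τ Pτ y)
      (expWeight a α X y * d y) (conjFlux a α X d Pd y)) (Set.Ioc 0 1)) :
    2 * α ^ 3 * (∫ y in Set.Ioc (0 : ℝ) 1, y ^ a * (expWeight a α X y * u y) ^ 2)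
      + (∫ y in Set.Ioc (0 : ℝ) 1, tangentialTerm a α X y (expWeight a α X y * u y)
      (conjFlux a α X u P y) (expWeight a α X y * τ y) (conjFlux a α X τ Pτ y)
      (expWeight a α X y * d y) (conjFlux a α X d Pd y))
      ≤ 1 / 4 * (∫ y in Set.Ioc (0 : ℝ) 1, (expWeight a α X y * f y) ^ 2 * y ^ (-a))
        + 2 * α * (Real.exp (-(α * X / 2)) * g₀ ^ 2) := by
  set e := expWeight a α X with he
  set v : ℝ → ℝ := fun y => e y * u y with hv
  set Q := conjFlux a α X u P with hQ
  set p : ℝ → ℝ := fun y => e y * τ y with hp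
  set pQ := conjFlux a α X τ Pτ with hpQ
  set r : ℝ → ℝ := fun y => e y * d y with hr
  set rQ := conjFlux a α X d Pd with hrQ
  set N : ℝ → ℝ := fun y => tangentialTerm a α X y (v y) (Q y) (p y) (pQ y) (r y) (rQ y) with hNdef
  have hec := continuous_expWeight ha α X
  have hPc : ContinuousOn P (Set.Ici 0) :=
    (continuousOn_const.add (continuousOn_primitive_Ici hF)).congr fun y hy => hP y hy
  have hYc : ∀ q : ℝ, ContinuousOn (fun y : ℝ => y ^ q) (Set.Ioi 0) := fun q y hy =>
    (Real.continuousAt_rpow_const y q (Or.inl (ne_of_gt hy))).continuousWithinAt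
  have hdwc : ContinuousOn (dWeight a) (Set.Ioi 0) := fun y hy =>
    (hasDerivAt_dWeight a hy).continuousAt.continuousWithinAt
  have hcf : ∀ {w Pw : ℝ → ℝ}, (∀ y, 0 < y → HasDerivAt w (y ^ (-a) * Pw y) y) →
      ContinuousOn Pw (Set.Ioi 0) →
      ContinuousOn (fun y => conjFlux a α X w Pw y / y ^ a) (Set.Ioi 0) := by
    intro w Pw hw hPw
    have hwc : ContinuousOn w (Set.Ioi 0) := fun y hy =>
      (hw y hy).continuousAt.continuousWithinAt
    refine ContinuousOn.div (hec.continuousOn.mul (hPw.add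
      ((continuousOn_const.mul ((hYc a).mul hdwc)).mul hwc))) (hYc a)
      fun y hy => (Real.rpow_pos_of_pos hy a).ne'
  set Φ := flux a α v Q p r with hΦ
  set R : ℝ → ℝ := fun y => 2 * α ^ 3 * (y ^ a * v y ^ 2) + N y with hR
  set G : ℝ → ℝ := fun y => 1 / 4 * ((e y * f y) ^ 2 * y ^ (-a)) with hG
  have hRint : IntegrableOn R (Set.Ioc 0 1) := (hI.const_mul _).add hN
  have hGint : IntegrableOn G (Set.Ioc 0 1) := hf.const_mul _
  -- The identity is integrated over [δ,1], away from the singular powers at 0; the limit δ → 0 is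
  -- taken at the end.
  have hmain : ∀ δ ∈ Set.Ioo (0 : ℝ) 1, ∫ y in δ..1, R y ≤ (∫ y in δ..1, G y) + Φ δ := by
    intro δ hδ
    have hsub : Set.uIcc δ 1 ⊆ Set.Ioi 0 := fun y hy => by
      rw [Set.uIcc_of_le hδ.2.le] at hy; exact hδ.1.trans_le hy.1
    have hsub' : Set.Ioc δ 1 ⊆ Set.Ioc 0 1 := Set.Ioc_subset_Ioc_left hδ.1.le
    have hac : ∀ {w Pw : ℝ → ℝ}, (∀ y, 0 < y → HasDerivAt w (y ^ (-a) * Pw y) y) →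
        ContinuousOn Pw (Set.Ioi 0) →
        AbsolutelyContinuousOnInterval (fun y => e y * w y) δ 1 := fun hw hPw =>
      absolutelyContinuousOnInterval_of_hasDerivAt
        (fun y hy => hasDerivAt_expWeight_mul ha α X (hsub hy) (hw y (hsub hy)))
        ((hcf hw hPw).mono hsub)
    have huac : AbsolutelyContinuousOnInterval u δ 1 :=
      absolutelyContinuousOnInterval_of_hasDerivAt (fun y hy => hu y (hsub hy))
        (((hYc (-a)).mul (hPc.mono Set.Ioi_subset_Ici_self)).mono hsub)
    have hcst : ∀ c : ℝ, AbsolutelyContinuousOnInterval (fun _ : ℝ => c) δ 1 := fun c =>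
      (contDiff_const.contDiffOn).absolutelyContinuousOnInterval
    have hPeq : ∀ y, 0 < y → P =ᶠ[𝓝 y] fun y => g₀ + ∫ t in (0 : ℝ)..y, F t := fun y hy => by
      filter_upwards [Ioi_mem_nhds hy] with x hx using hP x (le_of_lt hx)
    have hPac : AbsolutelyContinuousOnInterval (fun y => g₀ + ∫ t in (0 : ℝ)..y, F t) δ 1 :=
      (hcst g₀).fun_add (AbsolutelyContinuousOnInterval.mono
        ((hF 1 zero_le_one).absolutelyContinuousOnInterval_intervalIntegral (c := 0) (by simp))
        (by rw [Set.uIcc_of_le hδ.2.le, Set.uIcc_of_le zero_le_one]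
            exact Set.Icc_subset_Icc_left hδ.1.le))
    have heac : AbsolutelyContinuousOnInterval e δ 1 :=
      absolutelyContinuousOnInterval_of_hasDerivAt
        (fun y hy => hasDerivAt_expWeight ha α X (hsub hy))
        ((hec.continuousOn.mul (continuousOn_const.mul hdwc)).mono hsub)
    have hwac : AbsolutelyContinuousOnInterval (dWeight a) δ 1 :=
      absolutelyContinuousOnInterval_of_hasDerivAt
        (fun y hy => hasDerivAt_dWeight a (hsub hy))
        ((continuousOn_const.mul (continuousOn_const.sub ((continuousOn_const.mul (hYc a)).div
          continuousOn_id fun y hy => ne_of_gt hy))).mono hsub)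
    -- Since `F` is merely integrable, the weighted derivative is only absolutely continuous.
    -- Absolute continuity is read off from the explicit primitive; the fundamental theorem of
    -- calculus then needs the derivative of the flux only almost everywhere.
    set Q' : ℝ → ℝ := fun y => e y * ((g₀ + ∫ t in (0 : ℝ)..y, F t)
      + α * (y ^ a * dWeight a y) * u y) with hQ'
    have hQac : AbsolutelyContinuousOnInterval Q' δ 1 :=
      heac.fun_mul (hPac.fun_add ((((absolutelyContinuousOnInterval_rpow a hδ.1 hδ.2.le).fun_mul
        hwac).const_mul α).fun_mul huac))
    have hQQ : ∀ y, 0 < y → Q y = Q' y := fun y hy => by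
      simp only [hQ, hQ', conjFlux, hP y hy.le, he]
    have hΦac := absolutelyContinuousOnInterval_flux a α hδ.1 hδ.2.le
      (hac hu (hPc.mono Set.Ioi_subset_Ici_self)) (hac hτ hPτ) (hac hd hPd) hQac
    have hΦeq : ∀ y, 0 < y → flux a α v Q' p r y = Φ y := fun y hy => by
      simp only [hΦ, flux, hQQ y hy]
    have hD : ∀ᵐ y, y ∈ Set.uIcc δ 1 → R y ≤ G y - deriv (flux a α v Q' p r) y := by
      filter_upwards [(hF 1 zero_le_one).ae_hasDerivAt_integral] with y hy hyδ
      have hy0 : 0 < y := hsub hyδ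
      have hy01 : y ∈ Set.uIcc (0 : ℝ) 1 := by
        rw [Set.uIcc_of_le hδ.2.le] at hyδ
        rw [Set.uIcc_of_le zero_le_one]
        exact ⟨hy0.le, hyδ.2⟩
      have hPd' : HasDerivAt P (F y) y :=
        ((hy hy01 0 (by simp)).const_add g₀).congr_of_eventuallyEq (hPeq y hy0)
      have hQd := hasDerivAt_conjFlux ha α X hy0 (hu y hy0) hPd'
      have hΦd := hasDerivAt_flux a α X hy0
        (hasDerivAt_expWeight_mul ha α X hy0 (hu y hy0))
        (hasDerivAt_expWeight_mul ha α X hy0 (hτ y hy0))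
        (hasDerivAt_expWeight_mul ha α X hy0 (hd y hy0)) hQd
      have hΦd' := hΦd.congr_of_eventuallyEq (f₁ := flux a α v Q' p r) (by
        filter_upwards [Ioi_mem_nhds hy0] with x hx using hΦeq x hx)
      rw [hΦd'.deriv]
      have hc := commutatorTerm_ge (a := a) (α := α) (X := X) (y := y) (v := v y) (Q := Q y) ha0 hα
        hy0 (fun hne => hs y hy0 (right_ne_zero_of_mul hne))
      have hYne := (Real.rpow_pos_of_pos hy0 a).ne'
      -- The hypothesis of this bound is the conjugated equation: the +α y^a v of the remainder
      -- cancels the -αv of the multiplier, and what is left is e^{αφ} times F + y^a(τ + d) = f.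
      have hm := remainder_mul_multiplier_le (a := a) (α := α) (y := y) (v := v y) (Q := Q y)
        (p := p y) (r := r y) (G := e y * f y)
        (S := expWeight a α X y * (F y + 2 * α * dWeight a y * P y
          + (α ^ 2 * y ^ a * dWeight a y ^ 2 + α * lapWeight a y * y ^ a) * u y)) hy0 (by
          have : f y = F y + y ^ a * (τ y + d y) := by rw [hFf y hy0]; ring
          simp only [remainder, multiplier, this, hQ, conjFlux, hv, hp, hr, he]
          field_simp
          ring)
      simp only [hR, hG, hNdef]
      linarith
    have hRi : IntervalIntegrable R volume δ 1 :=
      (intervalIntegrable_iff_integrableOn_Ioc_of_le hδ.2.le).2 (hRint.mono_set hsub')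
    have hGi : IntervalIntegrable G volume δ 1 :=
      (intervalIntegrable_iff_integrableOn_Ioc_of_le hδ.2.le).2 (hGint.mono_set hsub')
    have hDi := hΦac.intervalIntegrable_deriv
    have hle : ∫ y in δ..1, R y ≤ ∫ y in δ..1, (G y - deriv (flux a α v Q' p r) y) := by
      refine intervalIntegral.integral_mono_ae_restrict hδ.2.le hRi (hGi.sub hDi) ?_
      rw [Filter.EventuallyLE, ae_restrict_iff' measurableSet_Icc]
      filter_upwards [hD] with y hy h
      exact hy (by rwa [Set.uIcc_of_le hδ.2.le])
    rw [intervalIntegral.integral_sub hGi hDi, hΦac.integral_deriv_eq_sub, hΦeq 1 one_pos,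
      hΦeq δ hδ.1] at hle
    have hΦ1 : Φ 1 = 0 := by
      have h1 : v 1 = 0 := by simp [hv, u1]
      have h2 : Q 1 = 0 := by simp [hQ, conjFlux, u1, P1]
      simp [hΦ, flux, h1, h2]
    rw [hΦ1] at hle
    linarith
  have hlimit : ∀ {H : ℝ → ℝ}, IntegrableOn H (Set.Ioc 0 1) →
      Tendsto (fun δ => ∫ y in δ..1, H y) (𝓝[>] 0) (𝓝 (∫ y in Set.Ioc (0 : ℝ) 1, H y)) := by
    intro H hH
    have hHi : IntervalIntegrable H volume 0 1 :=
      (intervalIntegrable_iff_integrableOn_Ioc_of_le zero_le_one).2 hH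
    have h1 := intervalIntegral.continuousOn_primitive_interval_left
      (f := H) (μ := volume) (a := 0) (b := 1) (by
        rw [Set.uIcc_of_le zero_le_one, integrableOn_Icc_iff_integrableOn_Ioc]; exact hH)
    have h2 := h1 0 (by simp)
    rw [ContinuousWithinAt, intervalIntegral.integral_of_le zero_le_one,
      Set.uIcc_of_le zero_le_one] at h2
    refine h2.mono_left (nhdsWithin_le_iff.2 ?_)
    exact mem_of_superset (Ioo_mem_nhdsGT one_pos) Set.Ioo_subset_Icc_self
  have hP0 : Tendsto P (𝓝[>] 0) (𝓝 g₀) := by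
    have h1 := (hPc 0 Set.self_mem_Ici).mono (Set.Ioi_subset_Ici_self (a := (0 : ℝ)))
    rw [ContinuousWithinAt, hP 0 le_rfl, intervalIntegral.integral_same, add_zero] at h1
    exact h1
  have hfin := le_of_tendsto_of_tendsto (hlimit hRint)
    ((hlimit hGint).add (tendsto_flux ha ha0 α X hu hP0 u0 τ0 d0))
    (by filter_upwards [Ioo_mem_nhdsGT (zero_lt_one' ℝ)] with δ hδ using hmain δ hδ)
  simp only [hR, hG] at hfin
  rw [integral_add (hI.const_mul _) hN, integral_const_mul, integral_const_mul] at hfin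
  refine hfin.trans (add_le_add le_rfl ?_)
  -- As a ≤ 0, the denominator is at least 1, and the constant becomes uniform in a.
  have h3 : 2 * α * g₀ ^ 2 / (1 - a) ≤ 2 * α * g₀ ^ 2 :=
    div_le_self (by positivity) (by linarith)
  calc Real.exp (-(α * X / 2)) * (2 * α * g₀ ^ 2 / (1 - a))
      ≤ Real.exp (-(α * X / 2)) * (2 * α * g₀ ^ 2) :=
        mul_le_mul_of_nonneg_left h3 (Real.exp_pos _).le
    _ = _ := by ring

/-! ### Tangential calculus and Gaussian-weighted integrations by parts. -/

/-- The tangential space-time variables `(x, t)`. -/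
abbrev Tan (n : ℕ) : Type := EuclideanSpace ℝ (Fin n) × ℝ

/-- The direction `∂_{x_i}` in the tangential variables. -/
noncomputable def tanX {n : ℕ} (i : Fin n) : Tan n := (EuclideanSpace.single i 1, 0)

/-- The direction `∂_t` in the tangential variables. -/
def tanT (n : ℕ) : Tan n := (0, 1)

/-- Directional derivative. -/
noncomputable def pd {n : ℕ} (v : Tan n) (u : Tan n → ℝ) (z : Tan n) : ℝ := fderiv ℝ u z v

variable {n : ℕ}

instance : (volume : Measure (Tan n)).IsAddHaarMeasure :=
  Measure.prod.instIsAddHaarMeasure _ _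

theorem pd_mul (v : Tan n) {f g : Tan n → ℝ} (hf : ContDiff ℝ ∞ f) (hg : ContDiff ℝ ∞ g)
    (z : Tan n) : pd v (fun z => f z * g z) z = pd v f z * g z + f z * pd v g z := by
  have h := (((hf.differentiable (by simp)) z).hasFDerivAt.mul
    ((hg.differentiable (by simp)) z).hasFDerivAt).fderiv
  simp only [pd]
  rw [show (fun z => f z * g z) = f * g from rfl, h]
  simp
  ring

theorem contDiff_pd (v : Tan n) {f : Tan n → ℝ} (hf : ContDiff ℝ ∞ f) : ContDiff ℝ ∞ (pd v f) :=
  (hf.fderiv_right (m := ∞) (by simp)).clm_apply contDiff_const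

theorem hasCompactSupport_pd (v : Tan n) {f : Tan n → ℝ} (hf : HasCompactSupport f) :
    HasCompactSupport (pd v f) := hf.fderiv_apply (𝕜 := ℝ) v

theorem tsupport_pd_subset (v : Tan n) (f : Tan n → ℝ) : tsupport (pd v f) ⊆ tsupport f :=
  tsupport_fderiv_apply_subset ℝ v

theorem pd_comm (v w : Tan n) {f : Tan n → ℝ} (hf : ContDiff ℝ ∞ f) (z : Tan n) :
    pd v (pd w f) z = pd w (pd v f) z := by
  have hd : Differentiable ℝ (fderiv ℝ f) :=
    (hf.fderiv_right (m := ∞) (by simp)).differentiable (by simp)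
  have h1 : ∀ v w : Tan n, pd v (pd w f) z = fderiv ℝ (fderiv ℝ f) z v w := fun v w => by
    simp only [pd]
    rw [show (pd w f) = fun z => fderiv ℝ f z w from rfl,
      fderiv_clm_apply (hd z) (differentiableAt_const w)]
    simp
  rw [h1, h1]
  exact (hf.contDiffAt.isSymmSndFDerivAt (by simpa using WithTop.coe_le_coe.2 (le_top : (2 : ℕ∞) ≤ ⊤))) v w

/-- Integrable functions with zero integral. -/
def IsNull (ψ : Tan n → ℝ) : Prop := Integrable ψ ∧ ∫ z, ψ z = 0

theorem IsNull.add {ψ θ : Tan n → ℝ} (h : IsNull ψ) (h' : IsNull θ) :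
    IsNull (fun z => ψ z + θ z) :=
  ⟨h.1.add h'.1, by rw [integral_add h.1 h'.1, h.2, h'.2, add_zero]⟩

theorem IsNull.const_mul {ψ : Tan n → ℝ} (h : IsNull ψ) (c : ℝ) : IsNull (fun z => c * ψ z) :=
  ⟨h.1.const_mul c, by rw [integral_const_mul, h.2, mul_zero]⟩

theorem IsNull.sum {ι : Type*} {s : Finset ι} {ψ : ι → Tan n → ℝ} (h : ∀ i ∈ s, IsNull (ψ i)) :
    IsNull (fun z => ∑ i ∈ s, ψ i z) :=
  ⟨integrable_finsetSum s fun i hi => (h i hi).1, by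
    rw [integral_finsetSum s fun i hi => (h i hi).1]
    exact Finset.sum_eq_zero fun i hi => (h i hi).2⟩

theorem isNull_pd (v : Tan n) {f : Tan n → ℝ} (hf : ContDiff ℝ ∞ f) (hc : HasCompactSupport f) :
    IsNull (pd v f) := by
  have i1 : Integrable (pd v f) :=
    (contDiff_pd v hf).continuous.integrable_of_hasCompactSupport (hasCompactSupport_pd v hc)
  refine ⟨i1, ?_⟩
  have i2 : Integrable f := hf.continuous.integrable_of_hasCompactSupport hc
  have := integral_mul_fderiv_eq_neg_fderiv_mul_of_integrable (μ := (volume : Measure (Tan n)))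
    (f := fun _ => (1 : ℝ)) (g := f) (v := v) (by simp) (by simp only [one_mul]; exact i1)
    (by simpa using i2) (fun z _ => differentiableAt_const _)
    (fun z _ => (hf.differentiable (by simp)) z)
  simpa [pd] using this

/-- Compact support of one factor kills the boundary contribution. The derivative of the weight `k`
is a separate argument `k'`, so that each use can supply it already expanded. -/
theorem isNull_divergence (v : Tan n) {k k' f g : Tan n → ℝ} (hk : ContDiff ℝ ∞ k)
    (hk' : ∀ z, pd v k z = k' z) (hf : ContDiff ℝ ∞ f) (hg : ContDiff ℝ ∞ g)
    (hc : HasCompactSupport f) :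
    IsNull (fun z => k' z * (f z * g z) + k z * (pd v f z * g z + f z * pd v g z)) := by
  have h := isNull_pd v (hk.mul (hf.mul hg)) (hc.mul_right.mul_left)
  refine (funext fun z => ?_ : pd v (fun z => k z * (f z * g z)) =
    fun z => k' z * (f z * g z) + k z * (pd v f z * g z + f z * pd v g z)) ▸ h
  rw [pd_mul v hk (hf.mul hg), pd_mul v hf hg, hk']

/-- The Gaussian weight `e^{-α|x|²/2}`. -/
noncomputable def gaussWeight (α : ℝ) (z : Tan n) : ℝ := Real.exp (-(α * ‖z.1‖ ^ 2 / 2))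

theorem contDiff_normSq : ContDiff ℝ ∞ (fun z : Tan n => ‖z.1‖ ^ 2) := contDiff_fst.norm_sq ℝ

theorem contDiff_gaussWeight (α : ℝ) : ContDiff ℝ ∞ (gaussWeight (n := n) α) := by
  unfold gaussWeight
  exact (((contDiff_const.mul contDiff_normSq).div_const 2).neg).exp

theorem contDiff_coord (i : Fin n) : ContDiff ℝ ∞ (fun z : Tan n => z.1 i) :=
  (EuclideanSpace.proj i : EuclideanSpace ℝ (Fin n) →L[ℝ] ℝ).contDiff.comp contDiff_fst

theorem hasFDerivAt_normSq (z : Tan n) : HasFDerivAt (fun z : Tan n => ‖z.1‖ ^ 2)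
    (2 • (innerSL ℝ z.1).comp (ContinuousLinearMap.fst ℝ _ _)) z :=
  (hasFDerivAt_fst (𝕜 := ℝ) (p := z)).norm_sq

theorem pd_tanX_normSq (i : Fin n) (z : Tan n) :
    pd (tanX i) (fun z : Tan n => ‖z.1‖ ^ 2) z = 2 * z.1 i := by
  rw [pd, (hasFDerivAt_normSq z).fderiv]
  simp [tanX, EuclideanSpace.inner_single_right]

theorem pd_tanT_normSq (z : Tan n) : pd (tanT n) (fun z : Tan n => ‖z.1‖ ^ 2) z = 0 := by
  rw [pd, (hasFDerivAt_normSq z).fderiv]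
  simp [tanT]

theorem pd_gaussWeight (v : Tan n) (α : ℝ) (z : Tan n) : pd v (gaussWeight α) z
    = -(α * pd v (fun z : Tan n => ‖z.1‖ ^ 2) z / 2) * gaussWeight α z := by
  have h : HasFDerivAt (fun z : Tan n => Real.exp (-(α * ‖z.1‖ ^ 2 * 2⁻¹))) _ z :=
    ((((hasFDerivAt_normSq z).const_mul α).mul_const (2⁻¹ : ℝ)).neg.exp)
  simp only [pd, (hasFDerivAt_normSq z).fderiv]
  rw [show gaussWeight (n := n) α = fun z => Real.exp (-(α * ‖z.1‖ ^ 2 * 2⁻¹)) from rfl, h.fderiv]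
  simp
  ring

theorem pd_tanX_gaussWeight (i : Fin n) (α : ℝ) (z : Tan n) :
    pd (tanX i) (gaussWeight α) z = -α * z.1 i * gaussWeight α z := by
  rw [pd_gaussWeight, pd_tanX_normSq]; ring

theorem pd_tanT_gaussWeight (α : ℝ) (z : Tan n) : pd (tanT n) (gaussWeight α) z = 0 := by
  rw [pd_gaussWeight, pd_tanT_normSq]; ring

theorem pd_tanX_coord (i j : Fin n) (z : Tan n) :
    pd (tanX i) (fun z : Tan n => z.1 j) z = if i = j then 1 else 0 := by
  have h : HasFDerivAt (fun z : Tan n => z.1 j)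
      ((EuclideanSpace.proj j : EuclideanSpace ℝ (Fin n) →L[ℝ] ℝ).comp
        (ContinuousLinearMap.fst ℝ _ _)) z :=
    (((EuclideanSpace.proj j : EuclideanSpace ℝ (Fin n) →L[ℝ] ℝ).comp
      (ContinuousLinearMap.fst ℝ _ ℝ)).hasFDerivAt)
  rw [pd, h.fderiv]
  simp [tanX, eq_comm]

/-- The zeroth order coefficient `α²|x|²/2 - αn/2`. -/
noncomputable def tanCoeff (α : ℝ) (z : Tan n) : ℝ := α ^ 2 / 2 * ‖z.1‖ ^ 2 - α * n / 2

theorem contDiff_tanCoeff (α : ℝ) : ContDiff ℝ ∞ (tanCoeff (n := n) α) :=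
  (contDiff_const.mul contDiff_normSq).sub contDiff_const

theorem pd_tanCoeff (v : Tan n) (α : ℝ) (z : Tan n) : pd v (tanCoeff α) z
    = α ^ 2 / 2 * pd v (fun z : Tan n => ‖z.1‖ ^ 2) z := by
  have h := (((hasFDerivAt_normSq z).const_mul (α ^ 2 / 2)).sub_const (α * n / 2))
  simp only [pd, (hasFDerivAt_normSq z).fderiv]
  rw [show tanCoeff (n := n) α = fun z => α ^ 2 / 2 * ‖z.1‖ ^ 2 - α * n / 2 from rfl, h.fderiv]
  simp

/-- The tangential antisymmetric part of the conjugated operator. -/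
noncomputable def tanSkew (α : ℝ) (u : Tan n → ℝ) (z : Tan n) : ℝ :=
  pd (tanT n) u z + α * ∑ i, z.1 i * pd (tanX i) u z - tanCoeff α z * u z

/-- The tangential symmetric part of the conjugated operator. -/
noncomputable def tanSymm (α : ℝ) (u : Tan n → ℝ) (z : Tan n) : ℝ :=
  ∑ i, pd (tanX i) (pd (tanX i) u) z - α * ∑ i, z.1 i * pd (tanX i) u z + tanCoeff α z * u z

theorem normSq_eq_sum (z : Tan n) : ‖z.1‖ ^ 2 = ∑ i, z.1 i ^ 2 := by
  rw [EuclideanSpace.norm_sq_eq]; simp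

/-- Up to conjugation by e^{αφ}, `tanSkew` is the antisymmetric operator ∂_t + αx·∇ + αn/2, and the
Gaussian is the tangential part of e^{2αφ}. Concretely, the integrand is the divergence of half the
weight times u² times the field (αx, 1). -/
theorem isNull_mul_tanSkew (α : ℝ) {u : Tan n → ℝ} (hu : ContDiff ℝ ∞ u)
    (hc : HasCompactSupport u) : IsNull (fun z => gaussWeight α z * (u z * tanSkew α u z)) := by
  have h1 := (isNull_divergence (tanT n) (contDiff_gaussWeight α) (pd_tanT_gaussWeight α) hu hu
    hc).const_mul (1 / 2)
  have h2 : ∀ i : Fin n, IsNull _ := fun i => isNull_divergence (tanX i)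
    ((contDiff_gaussWeight α).mul (contDiff_coord i))
    (fun z => by rw [pd_mul _ (contDiff_gaussWeight α) (contDiff_coord i), pd_tanX_gaussWeight,
      pd_tanX_coord, if_pos rfl]) hu hu hc
  have h3 := h1.add ((IsNull.sum fun i (_ : i ∈ Finset.univ) => h2 i).const_mul (α / 2))
  refine (funext fun z => ?_ : _ = fun z => gaussWeight α z * (u z * tanSkew α u z)) ▸ h3
  have e : ∀ i : Fin n, (-α * z.1 i * gaussWeight α z * z.1 i + gaussWeight α z * 1) * (u z * u z)
      + gaussWeight α z * z.1 i * (pd (tanX i) u z * u z + u z * pd (tanX i) u z)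
      = (-α * gaussWeight α z * u z ^ 2) * z.1 i ^ 2 + gaussWeight α z * u z ^ 2
        + (2 * gaussWeight α z * u z) * (z.1 i * pd (tanX i) u z) := fun i => by ring
  simp only [e, Finset.sum_add_distrib, ← Finset.mul_sum, ← normSq_eq_sum, Finset.sum_const,
    Finset.card_univ, Fintype.card_fin, nsmul_eq_mul, tanSkew, tanCoeff]
  ring

/-- Green's identity: up to conjugation, `tanSymm` is the symmetric operator Δ_x + α²|x|²/4, and the
integrand is the divergence of the weight times u∇q - q∇u. -/
theorem isNull_tanSymm_sub (α : ℝ) {u q : Tan n → ℝ} (hu : ContDiff ℝ ∞ u) (hq : ContDiff ℝ ∞ q)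
    (hcu : HasCompactSupport u) (hcq : HasCompactSupport q) :
    IsNull (fun z => gaussWeight α z * (tanSymm α q z * u z - tanSymm α u z * q z)) := by
  have h1 : ∀ i : Fin n, IsNull _ := fun i => isNull_divergence (tanX i) (contDiff_gaussWeight α)
    (pd_tanX_gaussWeight i α) (contDiff_pd (tanX i) hq) hu (hasCompactSupport_pd _ hcq)
  have h2 : ∀ i : Fin n, IsNull _ := fun i => isNull_divergence (tanX i) (contDiff_gaussWeight α)
    (pd_tanX_gaussWeight i α) (contDiff_pd (tanX i) hu) hq (hasCompactSupport_pd _ hcu)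
  have h3 := (IsNull.sum fun i (_ : i ∈ Finset.univ) => (h1 i).add ((h2 i).const_mul (-1)))
  refine (funext fun z => ?_ : _ = fun z => gaussWeight α z *
    (tanSymm α q z * u z - tanSymm α u z * q z)) ▸ h3
  have e : ∀ i : Fin n, (-α * z.1 i * gaussWeight α z * (pd (tanX i) q z * u z)
      + gaussWeight α z * (pd (tanX i) (pd (tanX i) q) z * u z + pd (tanX i) q z * pd (tanX i) u z))
      + -1 * (-α * z.1 i * gaussWeight α z * (pd (tanX i) u z * q z)
      + gaussWeight α z * (pd (tanX i) (pd (tanX i) u) z * q z + pd (tanX i) u z * pd (tanX i) q z))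
      = (gaussWeight α z * u z) * pd (tanX i) (pd (tanX i) q) z
        + (-α * gaussWeight α z * u z) * (z.1 i * pd (tanX i) q z)
        + (-(gaussWeight α z * q z)) * pd (tanX i) (pd (tanX i) u) z
        + (α * gaussWeight α z * q z) * (z.1 i * pd (tanX i) u z) := fun i => by ring
  simp only [e, Finset.sum_add_distrib, ← Finset.mul_sum, tanSymm]
  ring

set_option maxHeartbeats 1000000 in
/-- The tangential commutator identity. -/
theorem isNull_tanSymm_mul_tanSkew (α : ℝ) {u : Tan n → ℝ} (hu : ContDiff ℝ ∞ u)
    (hc : HasCompactSupport u) :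
    IsNull (fun z => gaussWeight α z * (tanSymm α u z * tanSkew α u z
      - α * (tanSymm α u z * u z) + α ^ 3 / 2 * ‖z.1‖ ^ 2 * u z ^ 2)) := by
  have hω := contDiff_gaussWeight (n := n) α
  have hcf := contDiff_tanCoeff (n := n) α
  have hX := fun i : Fin n => contDiff_pd (tanX i) hu
  have hT := contDiff_pd (tanT n) hu
  have hXc := fun i : Fin n => hasCompactSupport_pd (tanX i) hc
  -- The proof writes the integrand as an explicit sum of divergences, reflecting ½[S,K] = αS -
  -- α³|x|²/2. The pair `n1`, `n1'` treats Δu·u_t.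
  have n1 : ∀ i : Fin n, IsNull _ := fun i => isNull_divergence (tanX i) hω
    (pd_tanX_gaussWeight i α) (hX i) hT (hXc i)
  have n1' : ∀ i : Fin n, IsNull _ := fun i => isNull_divergence (tanT n) hω
    (pd_tanT_gaussWeight α) (hX i) (hX i) (hXc i)
  have hωx : ∀ i j (z : Tan n), pd (tanX i) (fun z => gaussWeight α z * z.1 j) z
      = -α * z.1 i * gaussWeight α z * z.1 j + gaussWeight α z * (if i = j then 1 else 0) :=
    fun i j z => by
      rw [pd_mul _ hω (contDiff_coord j), pd_tanX_gaussWeight, pd_tanX_coord]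
  -- The pair `n2`, `n2'` is a Rellich-Pohozaev identity for Δu against the drift x·∇u; the Gaussian
  -- produces the extra (x·∇u)² and |x|²|∇u|² terms.
  have n2 : ∀ i j : Fin n, IsNull _ := fun i j => isNull_divergence (tanX i)
    (hω.mul (contDiff_coord j)) (hωx i j) (hX i) (hX j) (hXc i)
  have n2' : ∀ i j : Fin n, IsNull _ := fun i j => isNull_divergence (tanX j)
    (hω.mul (contDiff_coord j)) (hωx j j) (hX i) (hX i) (hXc i)
  -- The remaining divergences treat the zeroth-order coefficient. The shift of it by α in `n3`
  -- accounts for the term -α(Su)u of the statement.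
  have n3 : ∀ i : Fin n, IsNull _ := fun i => isNull_divergence (tanX i)
    (hω.mul (hcf.add contDiff_const (g := fun _ => α)))
    (fun z => pd_mul _ hω (hcf.add contDiff_const) z) (hX i) hu (hXc i)
  have n4 : IsNull _ := isNull_divergence (tanT n) (hω.mul hcf)
    (fun z => pd_mul _ hω hcf z) hu hu hc
  have n5 : ∀ i : Fin n, IsNull _ := fun i => isNull_divergence (tanX i)
    ((hω.mul (contDiff_coord i)).mul hcf)
    (fun z => pd_mul _ (hω.mul (contDiff_coord i)) hcf z) hu hu hc
  have n6 : ∀ i : Fin n, IsNull _ := fun i => isNull_divergence (tanX i)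
    (hω.mul (contDiff_coord i)) (hωx i i) hu hu hc
  have pdc : ∀ (v : Tan n) z, pd v (fun z => tanCoeff α z + α) z = pd v (tanCoeff α) z :=
    fun v z => by simp [pd]
  have hall := (((IsNull.sum fun i (_ : i ∈ Finset.univ) =>
      (n1 i).add ((n1' i).const_mul (-(1 / 2)))).add
    ((IsNull.sum fun i (_ : i ∈ Finset.univ) => IsNull.sum fun j (_ : j ∈ Finset.univ) =>
      (n2 i j).add ((n2' i j).const_mul (-(1 / 2)))).const_mul α)).add
    ((IsNull.sum fun i (_ : i ∈ Finset.univ) => ((n3 i).const_mul (-1)).add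
      (((n5 i).const_mul (α / 2)).add ((n6 i).const_mul (α ^ 2 / 2)))).add
      (n4.const_mul (1 / 2))))
  refine (funext fun z => ?_ : _ = fun z => gaussWeight α z * (tanSymm α u z * tanSkew α u z
      - α * (tanSymm α u z * u z) + α ^ 3 / 2 * ‖z.1‖ ^ 2 * u z ^ 2)) ▸ hall
  simp only [pdc, pd_tanCoeff, pd_tanX_normSq, pd_tanT_normSq, pd_tanX_gaussWeight,
    pd_tanT_gaussWeight, hωx, if_true]
  set wt := gaussWeight α z
  set c := tanCoeff α z with hcdef
  set U := u z
  have e1 : ∀ i : Fin n, -α * z.1 i * wt * (pd (tanX i) u z * pd (tanT n) u z)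
      + wt * (pd (tanX i) (pd (tanX i) u) z * pd (tanT n) u z
        + pd (tanX i) u z * pd (tanX i) (pd (tanT n) u) z)
      + -(1 / 2) * (0 * (pd (tanX i) u z * pd (tanX i) u z)
        + wt * (pd (tanT n) (pd (tanX i) u) z * pd (tanX i) u z
          + pd (tanX i) u z * pd (tanT n) (pd (tanX i) u) z))
      = (-α * wt * pd (tanT n) u z) * (z.1 i * pd (tanX i) u z)
        + (wt * pd (tanT n) u z) * pd (tanX i) (pd (tanX i) u) z := fun i => by
    rw [pd_comm (tanX i) (tanT n) hu]; ring
  have e2 : ∀ i j : Fin n,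
      (-α * z.1 i * wt * z.1 j + wt * (if i = j then 1 else 0)) * (pd (tanX i) u z * pd (tanX j) u z)
      + wt * z.1 j * (pd (tanX i) (pd (tanX i) u) z * pd (tanX j) u z
        + pd (tanX i) u z * pd (tanX i) (pd (tanX j) u) z)
      + -(1 / 2) * ((-α * z.1 j * wt * z.1 j + wt * 1) * (pd (tanX i) u z * pd (tanX i) u z)
        + wt * z.1 j * (pd (tanX j) (pd (tanX i) u) z * pd (tanX i) u z
          + pd (tanX i) u z * pd (tanX j) (pd (tanX i) u) z))
      = (-α * wt * (z.1 i * pd (tanX i) u z)) * (z.1 j * pd (tanX j) u z)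
        + (wt * pd (tanX i) (pd (tanX i) u) z) * (z.1 j * pd (tanX j) u z)
        + (if i = j then wt * pd (tanX i) u z * pd (tanX j) u z else 0)
        + (α * wt / 2 * pd (tanX i) u z ^ 2) * z.1 j ^ 2 + -(wt / 2 * pd (tanX i) u z ^ 2) :=
    fun i j => by
      rw [pd_comm (tanX i) (tanX j) hu]
      split_ifs <;> ring
  have e3 : ∀ i : Fin n,
      -1 * ((-α * z.1 i * wt * (c + α) + wt * (α ^ 2 / 2 * (2 * z.1 i))) * (pd (tanX i) u z * U)
        + wt * (c + α) * (pd (tanX i) (pd (tanX i) u) z * U + pd (tanX i) u z * pd (tanX i) u z))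
      + (α / 2 * (((-α * z.1 i * wt * z.1 i + wt * 1) * c + wt * z.1 i * (α ^ 2 / 2 * (2 * z.1 i)))
          * (U * U) + wt * z.1 i * c * (pd (tanX i) u z * U + U * pd (tanX i) u z))
        + α ^ 2 / 2 * ((-α * z.1 i * wt * z.1 i + wt * 1) * (U * U)
          + wt * z.1 i * (pd (tanX i) u z * U + U * pd (tanX i) u z)))
      = (α * wt * (c + α) * U - α ^ 2 * wt * U + α * wt * c * U + α ^ 2 * wt * U)
          * (z.1 i * pd (tanX i) u z)
        + (-(wt * (c + α) * U)) * pd (tanX i) (pd (tanX i) u) z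
        + (-(wt * (c + α))) * pd (tanX i) u z ^ 2
        + (-(α ^ 2 / 2 * wt * c * U ^ 2) + α ^ 3 / 2 * wt * U ^ 2 - α ^ 3 / 2 * wt * U ^ 2) * z.1 i ^ 2
        + (α / 2 * wt * c * U ^ 2 + α ^ 2 / 2 * wt * U ^ 2) := fun i => by ring
  simp only [e1, e2, e3, Finset.sum_add_distrib, ← Finset.mul_sum, ← Finset.sum_mul,
    ← normSq_eq_sum, Finset.sum_ite_eq, Finset.mem_univ, if_true, Finset.sum_const,
    Finset.card_univ, Fintype.card_fin, nsmul_eq_mul, Finset.sum_neg_distrib]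
  have e4 : ∑ i : Fin n, wt * pd (tanX i) u z * pd (tanX i) u z
      = wt * ∑ i : Fin n, pd (tanX i) u z ^ 2 := by
    rw [Finset.mul_sum]; exact Finset.sum_congr rfl fun i _ => by ring
  have hcc : c = α ^ 2 / 2 * ‖z.1‖ ^ 2 - α * n / 2 := rfl
  rw [e4]
  simp only [tanSymm, tanSkew, ← hcdef]
  rw [hcc]
  ring

/-! ### Mollified families: bounds and the integrated Carleman inequality. -/

/-- Smooth functions supported in the closed ball of radius `1/2` of the tangential variables. -/
def IsMoll (ρ : Tan n → ℝ) : Prop :=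
  ContDiff ℝ ∞ ρ ∧ tsupport ρ ⊆ Metric.closedBall 0 (1 / 2)

theorem IsMoll.hasCompactSupport {ρ : Tan n → ℝ} (h : IsMoll ρ) : HasCompactSupport ρ :=
  (isCompact_closedBall _ _).of_isClosed_subset (isClosed_tsupport ρ) h.2

/-- No normalisation of mass is imposed on mollifiers, so their derivatives are admissible too.
Hence tangential derivatives of a mollified solution stay in the family and satisfy the same normal
ODE and bounds. -/
theorem IsMoll.pd {ρ : Tan n → ℝ} (h : IsMoll ρ) (v : Tan n) : IsMoll (pd v ρ) :=
  ⟨contDiff_pd v h.1, (tsupport_pd_subset v ρ).trans h.2⟩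

/-- A compact box containing the tangential support of the mollified functions. -/
def tanBox (n : ℕ) : Set (Tan n) := Metric.closedBall 0 1 ×ˢ Metric.closedBall 0 2

theorem isCompact_tanBox : IsCompact (tanBox n) :=
  (isCompact_closedBall _ _).prod (isCompact_closedBall _ _)

theorem measurableSet_tanBox : MeasurableSet (tanBox n) := isCompact_tanBox.measurableSet

theorem norm_le_of_mem_tanBox {z : Tan n} (h : z ∈ tanBox n) : ‖z.1‖ ≤ 1 := by
  simpa using h.1

/-- The tangential mollifications `U ρ = W ⋆ ρ` of a weak solution, together with their weighted
normal derivatives `P ρ = y^a ∂_y (U ρ)`, the mollified right-hand side `fm ρ` and the mollified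
boundary datum `gm ρ`. -/
structure IsSolFamily (a : ℝ) (U P fm : (Tan n → ℝ) → ℝ → Tan n → ℝ)
    (gm : (Tan n → ℝ) → Tan n → ℝ) : Prop where
  contDiff_U : ∀ {ρ}, IsMoll ρ → ∀ y, ContDiff ℝ ∞ (U ρ y)
  contDiff_P : ∀ {ρ}, IsMoll ρ → ∀ y, ContDiff ℝ ∞ (P ρ y)
  pd_U : ∀ {ρ}, IsMoll ρ → ∀ v y, pd v (U ρ y) = U (pd v ρ) y
  pd_P : ∀ {ρ}, IsMoll ρ → ∀ v y, pd v (P ρ y) = P (pd v ρ) y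
  zero_U : ∀ {ρ}, IsMoll ρ → ∀ {y z}, 0 < y → (y ≤ 1 / 2 → z ∉ tanBox n) → U ρ y z = 0
  zero_P : ∀ {ρ}, IsMoll ρ → ∀ {y z}, 0 < y → (y ≤ 1 / 2 → z ∉ tanBox n) → P ρ y z = 0
  hasDerivAt : ∀ {ρ}, IsMoll ρ → ∀ z y, 0 < y →
    HasDerivAt (fun y => U ρ y z) (y ^ (-a) * P ρ y z) y
  tendsto_U : ∀ {ρ}, IsMoll ρ → ∀ z, Tendsto (fun y => U ρ y z) (𝓝[>] 0) (𝓝 0)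
  integrable_F : ∀ {ρ}, IsMoll ρ → ∀ z b, 0 ≤ b → IntervalIntegrable (fun t => fm ρ t z
    - t ^ a * (U (pd (tanT n) ρ) t z + ∑ i, U (pd (tanX i) (pd (tanX i) ρ)) t z)) volume 0 b
  P_eq : ∀ {ρ}, IsMoll ρ → ∀ z y, 0 ≤ y → P ρ y z = gm ρ z + ∫ t in (0 : ℝ)..y, (fm ρ t z
    - t ^ a * (U (pd (tanT n) ρ) t z + ∑ i, U (pd (tanX i) (pd (tanX i) ρ)) t z))
  bound_P : ∀ {ρ}, IsMoll ρ → ∃ B, ∀ y ∈ Set.Ioc (0 : ℝ) 1, ∀ z, |P ρ y z| ≤ B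
  measurable_U : ∀ {ρ}, IsMoll ρ → Measurable (fun p : Tan n × ℝ => U ρ p.2 p.1)
  measurable_P : ∀ {ρ}, IsMoll ρ → Measurable (fun p : Tan n × ℝ => P ρ p.2 p.1)
  measurable_gm : ∀ {ρ}, IsMoll ρ → Measurable (gm ρ)
  sq_integrable : ∀ {ρ}, IsMoll ρ → ∀ z,
    IntegrableOn (fun y => fm ρ y z ^ 2 * y ^ (-a)) (Set.Ioc 0 1)

/-- The mean value inequality on [ε,y], where t^{-a} ≤ y^{-a} since a ≤ 0, followed by ε → 0 using
the zero trace. The rate y^{1-a} is what tames the singular powers in the tangential terms. -/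
theorem abs_le_rpow_of_hasDerivAt {a B : ℝ} (ha0 : a ≤ 0) {u P : ℝ → ℝ}
    (hu : ∀ y, 0 < y → HasDerivAt u (y ^ (-a) * P y) y) (hP : ∀ y ∈ Set.Ioc (0 : ℝ) 1, |P y| ≤ B)
    (u0 : Tendsto u (𝓝[>] 0) (𝓝 0)) {y : ℝ} (hy : y ∈ Set.Ioc (0 : ℝ) 1) :
    |u y| ≤ B * y ^ (1 - a) := by
  have hB : 0 ≤ B := (abs_nonneg _).trans (hP y hy)
  have hypos : 0 < y := hy.1
  have hlim : Tendsto (fun ε => |u y - u ε|) (𝓝[>] 0) (𝓝 |u y - 0|) :=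
    (tendsto_const_nhds.sub u0).abs
  rw [sub_zero] at hlim
  refine le_of_tendsto hlim ?_
  filter_upwards [Ioo_mem_nhdsGT hypos] with ε hε
  have hC : ∀ t ∈ Set.Icc ε y, ‖t ^ (-a) * P t‖ ≤ y ^ (-a) * B := fun t ht => by
    have ht0 : 0 < t := hε.1.trans_le ht.1
    rw [norm_mul, Real.norm_eq_abs, Real.norm_eq_abs, abs_of_nonneg (Real.rpow_nonneg ht0.le _)]
    exact mul_le_mul (Real.rpow_le_rpow ht0.le ht.2 (by linarith)) (hP t ⟨ht0, ht.2.trans hy.2⟩)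
      (abs_nonneg _) (Real.rpow_nonneg hypos.le _)
  have := (convex_Icc ε y).norm_image_sub_le_of_norm_hasDerivWithin_le
    (fun t ht => (hu t (hε.1.trans_le ht.1)).hasDerivWithinAt) hC
    (Set.left_mem_Icc.2 hε.2.le) (Set.right_mem_Icc.2 hε.2.le)
  rw [Real.norm_eq_abs, Real.norm_eq_abs, abs_of_pos (sub_pos.2 hε.2)] at this
  refine this.trans ?_
  have h1 : y ^ (1 - a) = y ^ (-a) * y := by
    rw [sub_eq_neg_add, Real.rpow_add hypos, Real.rpow_one]
  rw [h1]
  have h2 : 0 ≤ y ^ (-a) * B := mul_nonneg (Real.rpow_nonneg hypos.le _) hB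
  calc y ^ (-a) * B * (y - ε) ≤ y ^ (-a) * B * y :=
        mul_le_mul_of_nonneg_left (by linarith [hε.1]) h2
    _ = B * (y ^ (-a) * y) := by ring

/-- Stated for a general family `S` and profile `s` in order to serve both the solution, with
profile y^{1-a}, and its flux, with profile 1. -/
theorem exists_bound_tanSkew (α : ℝ) {S : (Tan n → ℝ) → ℝ → Tan n → ℝ} {s : ℝ → ℝ}
    (hpd : ∀ {ρ}, IsMoll ρ → ∀ v y, pd v (S ρ y) = S (pd v ρ) y)
    (hB : ∀ {ρ}, IsMoll ρ → ∃ B, ∀ y ∈ Set.Ioc (0 : ℝ) 1, ∀ z, |S ρ y z| ≤ B * s y)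
    {ρ : Tan n → ℝ} (hρ : IsMoll ρ) :
    ∃ B, ∀ y ∈ Set.Ioc (0 : ℝ) 1, ∀ z ∈ tanBox n, |tanSkew α (S ρ y) z| ≤ B * s y := by
  obtain ⟨B0, h0⟩ := hB hρ
  obtain ⟨BT, hT⟩ := hB (hρ.pd (tanT n))
  choose BX hX using fun i : Fin n => hB (hρ.pd (tanX i))
  obtain ⟨C, hC⟩ := isCompact_tanBox.exists_bound_of_continuousOn
    (contDiff_tanCoeff (n := n) α).continuous.continuousOn
  refine ⟨BT + |α| * ∑ i, BX i + C * B0, fun y hy z hz => ?_⟩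
  have hx : ∀ i, |z.1 i| ≤ 1 := fun i =>
    (PiLp.norm_apply_le z.1 i).trans (norm_le_of_mem_tanBox hz)
  have hc := hC z hz
  rw [Real.norm_eq_abs] at hc
  have e1 : |∑ i, z.1 i * pd (tanX i) (S ρ y) z| ≤ ∑ i, BX i * s y := by
    refine (Finset.abs_sum_le_sum_abs _ _).trans (Finset.sum_le_sum fun i _ => ?_)
    rw [abs_mul, hpd hρ]
    have h1 := hX i y hy z
    calc |z.1 i| * |S (pd (tanX i) ρ) y z| ≤ 1 * |S (pd (tanX i) ρ) y z| :=
          mul_le_mul_of_nonneg_right (hx i) (abs_nonneg _)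
      _ ≤ _ := by rwa [one_mul]
  have e2 : |tanCoeff α z * S ρ y z| ≤ C * (B0 * s y) := by
    rw [abs_mul]
    exact mul_le_mul hc (h0 y hy z) (abs_nonneg _) ((abs_nonneg _).trans hc)
  have e3 : |pd (tanT n) (S ρ y) z| ≤ BT * s y := by rw [hpd hρ]; exact hT y hy z
  rw [tanSkew]
  calc _ ≤ |pd (tanT n) (S ρ y) z| + |α * ∑ i, z.1 i * pd (tanX i) (S ρ y) z|
        + |tanCoeff α z * S ρ y z| := (abs_sub _ _).trans (add_le_add_left (abs_add_le _ _) _)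
    _ ≤ BT * s y + |α| * (∑ i, BX i * s y) + C * (B0 * s y) := by
        rw [abs_mul]
        exact add_le_add (add_le_add e3 (mul_le_mul_of_nonneg_left e1 (abs_nonneg _))) e2
    _ = _ := by rw [← Finset.sum_mul]; ring

theorem exists_bound_tanSymm (α : ℝ) {S : (Tan n → ℝ) → ℝ → Tan n → ℝ} {s : ℝ → ℝ}
    (hpd : ∀ {ρ}, IsMoll ρ → ∀ v y, pd v (S ρ y) = S (pd v ρ) y)
    (hB : ∀ {ρ}, IsMoll ρ → ∃ B, ∀ y ∈ Set.Ioc (0 : ℝ) 1, ∀ z, |S ρ y z| ≤ B * s y)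
    {ρ : Tan n → ℝ} (hρ : IsMoll ρ) :
    ∃ B, ∀ y ∈ Set.Ioc (0 : ℝ) 1, ∀ z ∈ tanBox n, |tanSymm α (S ρ y) z| ≤ B * s y := by
  obtain ⟨B1, h1⟩ := exists_bound_tanSkew α hpd hB hρ
  obtain ⟨BT, hT⟩ := hB (hρ.pd (tanT n))
  choose BX hX using fun i : Fin n => hB ((hρ.pd (tanX i)).pd (tanX i))
  refine ⟨∑ i, BX i + BT + B1, fun y hy z hz => ?_⟩
  have e0 : tanSymm α (S ρ y) z = ∑ i, pd (tanX i) (pd (tanX i) (S ρ y)) z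
      + pd (tanT n) (S ρ y) z - tanSkew α (S ρ y) z := by
    simp only [tanSymm, tanSkew]; ring
  have e1 : |∑ i, pd (tanX i) (pd (tanX i) (S ρ y)) z| ≤ ∑ i, BX i * s y := by
    refine (Finset.abs_sum_le_sum_abs _ _).trans (Finset.sum_le_sum fun i _ => ?_)
    rw [hpd hρ, hpd (hρ.pd _)]
    exact hX i y hy z
  have e3 : |pd (tanT n) (S ρ y) z| ≤ BT * s y := by rw [hpd hρ]; exact hT y hy z
  rw [e0]
  calc _ ≤ |∑ i, pd (tanX i) (pd (tanX i) (S ρ y)) z| + |pd (tanT n) (S ρ y) z|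
        + |tanSkew α (S ρ y) z| := (abs_sub _ _).trans (add_le_add_left (abs_add_le _ _) _)
    _ ≤ (∑ i, BX i * s y) + BT * s y + B1 * s y := add_le_add (add_le_add e1 e3) (h1 y hy z hz)
    _ = _ := by rw [← Finset.sum_mul]; ring

theorem measurable_tanSkew (α : ℝ) {S : (Tan n → ℝ) → ℝ → Tan n → ℝ}
    (hpd : ∀ {ρ}, IsMoll ρ → ∀ v y, pd v (S ρ y) = S (pd v ρ) y)
    (hm : ∀ {ρ}, IsMoll ρ → Measurable (fun p : Tan n × ℝ => S ρ p.2 p.1))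
    {ρ : Tan n → ℝ} (hρ : IsMoll ρ) :
    Measurable (fun p : Tan n × ℝ => tanSkew α (S ρ p.2) p.1) := by
  simp only [tanSkew, hpd hρ]
  have h1 : Measurable (fun p : Tan n × ℝ => tanCoeff α p.1) :=
    (contDiff_tanCoeff α).continuous.measurable.comp measurable_fst
  refine ((hm (hρ.pd _)).add (measurable_const.mul (Finset.measurable_sum _ fun i _ => ?_))).sub
    (h1.mul (hm hρ))
  exact ((contDiff_coord i).continuous.measurable.comp measurable_fst).mul (hm (hρ.pd _))

theorem measurable_tanSymm (α : ℝ) {S : (Tan n → ℝ) → ℝ → Tan n → ℝ}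
    (hpd : ∀ {ρ}, IsMoll ρ → ∀ v y, pd v (S ρ y) = S (pd v ρ) y)
    (hm : ∀ {ρ}, IsMoll ρ → Measurable (fun p : Tan n × ℝ => S ρ p.2 p.1))
    {ρ : Tan n → ℝ} (hρ : IsMoll ρ) :
    Measurable (fun p : Tan n × ℝ => tanSymm α (S ρ p.2) p.1) := by
  have e0 : ∀ p : Tan n × ℝ, tanSymm α (S ρ p.2) p.1
      = ∑ i, S (pd (tanX i) (pd (tanX i) ρ)) p.2 p.1
      + S (pd (tanT n) ρ) p.2 p.1 - tanSkew α (S ρ p.2) p.1 := fun p => by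
    simp only [tanSymm, tanSkew, hpd hρ, hpd (hρ.pd _)]; ring
  simp only [e0]
  exact ((Finset.measurable_sum _ fun i _ => hm ((hρ.pd _).pd _)).add (hm (hρ.pd _))).sub
    (measurable_tanSkew α hpd hm hρ)

theorem tanSkew_add_smul (α β : ℝ) {p u : Tan n → ℝ} (hp : ContDiff ℝ ∞ p) (hu : ContDiff ℝ ∞ u)
    (z : Tan n) :
    tanSkew α (fun z => p z + β * u z) z = tanSkew α p z + β * tanSkew α u z := by
  have h1 : ∀ v : Tan n, pd v (fun z => p z + β * u z) z = pd v p z + β * pd v u z := fun v => by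
    have := (((hp.differentiable (by simp)) z).hasFDerivAt.add
      (((hu.differentiable (by simp)) z).hasFDerivAt.const_mul β)).fderiv
    simp only [pd]
    rw [show (fun z => p z + β * u z) = (p + fun z => β * u z) from rfl, this]
    simp
  have h2 : ∀ i : Fin n, z.1 i * (pd (tanX i) p z + β * pd (tanX i) u z)
      = z.1 i * pd (tanX i) p z + β * (z.1 i * pd (tanX i) u z) := fun i => by ring
  simp only [tanSkew, h1, h2, Finset.sum_add_distrib, ← Finset.mul_sum]
  ring

theorem tanSymm_add_smul (α β : ℝ) {p u : Tan n → ℝ} (hp : ContDiff ℝ ∞ p) (hu : ContDiff ℝ ∞ u)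
    (z : Tan n) :
    tanSymm α (fun z => p z + β * u z) z = tanSymm α p z + β * tanSymm α u z := by
  have h1 : ∀ (v : Tan n) {p u : Tan n → ℝ}, ContDiff ℝ ∞ p → ContDiff ℝ ∞ u →
      pd v (fun z => p z + β * u z) = fun z => pd v p z + β * pd v u z := by
    intro v p u hp hu
    ext z
    have := (((hp.differentiable (by simp)) z).hasFDerivAt.add
      (((hu.differentiable (by simp)) z).hasFDerivAt.const_mul β)).fderiv
    simp only [pd]
    rw [show (fun z => p z + β * u z) = (p + fun z => β * u z) from rfl, this]
    simp
  have h2 : ∀ i : Fin n, z.1 i * (pd (tanX i) p z + β * pd (tanX i) u z)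
      = z.1 i * pd (tanX i) p z + β * (z.1 i * pd (tanX i) u z) := fun i => by ring
  simp only [tanSymm, h1 _ hp hu, h1 _ (contDiff_pd _ hp) (contDiff_pd _ hu), h2,
    Finset.sum_add_distrib, ← Finset.mul_sum]
  ring

theorem expWeight_sq (a α y : ℝ) (z : Tan n) : expWeight a α (‖z.1‖ ^ 2) y ^ 2
    = Real.exp (4 * α * (-(y ^ (a + 1) / (a + 1)) + y ^ 2 / 2)) * gaussWeight α z := by
  rw [expWeight, gaussWeight, ← Real.exp_nat_mul, ← Real.exp_add]
  congr 1
  push_cast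
  ring

/-- The tangential terms of the commutator integrate to zero for every `y`. -/
theorem isNull_tangentialTerm (a α y : ℝ) {u p : Tan n → ℝ} (hu : ContDiff ℝ ∞ u)
    (hp : ContDiff ℝ ∞ p) (hcu : HasCompactSupport u) (hcp : HasCompactSupport p) :
    IsNull (fun z : Tan n => tangentialTerm a α (‖z.1‖ ^ 2) y
      (expWeight a α (‖z.1‖ ^ 2) y * u z)
      (expWeight a α (‖z.1‖ ^ 2) y * (p z + α * (y ^ a * dWeight a y) * u z))
      (expWeight a α (‖z.1‖ ^ 2) y * tanSkew α u z)
      (expWeight a α (‖z.1‖ ^ 2) y * (tanSkew α p z + α * (y ^ a * dWeight a y) * tanSkew α u z))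
      (expWeight a α (‖z.1‖ ^ 2) y * tanSymm α u z)
      (expWeight a α (‖z.1‖ ^ 2) y
        * (tanSymm α p z + α * (y ^ a * dWeight a y) * tanSymm α u z))) := by
  set β := α * (y ^ a * dWeight a y)
  -- Q is e^{αφ} times this `q`, because y^a ∂_y falls on the weight as well. Each of the four
  -- summands of the tangential term then matches one of the null identities for `u` and `q`.
  set q : Tan n → ℝ := fun z => p z + β * u z with hqdef
  have hq : ContDiff ℝ ∞ q := hp.add (contDiff_const.mul hu)
  have hcq : HasCompactSupport q := hcp.add hcu.mul_left
  have h1 := (isNull_mul_tanSkew α hq hcq).const_mul (-(1 / y ^ a))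
  have h2 := (isNull_tanSymm_mul_tanSkew α hu hcu).const_mul (y ^ a)
  have h3 := (isNull_tanSymm_sub α hu hq hcu hcq).const_mul (α * dWeight a y)
  have h4 := (isNull_mul_tanSkew α hu hcu).const_mul ((α ^ 2 * dWeight a y ^ 2 + α) * y ^ a)
  have h5 := (((h1.add h2).add h3).add h4).const_mul
    (Real.exp (4 * α * (-(y ^ (a + 1) / (a + 1)) + y ^ 2 / 2)))
  convert h5 using 1
  ext z
  simp only [hqdef, tanSkew_add_smul α β hp hu, tanSymm_add_smul α β hp hu]
  have hE := expWeight_sq a α y z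
  set E := Real.exp (4 * α * (-(y ^ (a + 1) / (a + 1)) + y ^ 2 / 2))
  set e := expWeight a α (‖z.1‖ ^ 2) y
  simp only [tangentialTerm]
  trans e ^ 2 * (-(1 / y ^ a) * ((p z + β * u z) * (tanSkew α p z + β * tanSkew α u z))
    + y ^ a * (tanSymm α u z * tanSkew α u z - α * (tanSymm α u z * u z)
      + α ^ 3 / 2 * ‖z.1‖ ^ 2 * u z ^ 2)
    + α * dWeight a y * ((tanSymm α p z + β * tanSymm α u z) * u z
      - tanSymm α u z * (p z + β * u z))
    + (α ^ 2 * dWeight a y ^ 2 + α) * y ^ a * (u z * tanSkew α u z))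
  · ring
  · rw [hE]; ring

/-- The critical summand is α²h'² y^a v p. As |h'| ≤ 2y^a, it is of size y^{3a} y^{2-2a} = y^{a+2},
so the decay of v and p is essential. The resulting bound y^a is integrable near 0 when a > -1. -/
theorem abs_tangentialTerm_le {a α X y v Q p pQ r rQ V : ℝ} (ha0 : a ≤ 0) (hα : 0 < α)
    (hX : 0 ≤ X) (hX1 : X ≤ 1) (hy : y ∈ Set.Ioc (0 : ℝ) 1) (hV : 0 ≤ V)
    (hv : |v| ≤ V * y ^ (1 - a)) (hp : |p| ≤ V * y ^ (1 - a)) (hr : |r| ≤ V * y ^ (1 - a))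
    (hQ : |Q| ≤ V) (hpQ : |pQ| ≤ V) (hrQ : |rQ| ≤ V) :
    |tangentialTerm a α X y v Q p pQ r rQ|
      ≤ (V ^ 2 * (2 + 6 * α + α ^ 3 / 2 + 4 * α ^ 2)) * y ^ a := by
  have hy0 : 0 < y := hy.1
  have hY1 : 1 ≤ y ^ a := Real.one_le_rpow_of_pos_of_le_one_of_nonpos hy0 hy.2 ha0
  have hw0 : 0 ≤ y ^ (1 - a) := Real.rpow_nonneg hy0.le _
  have hw1 : y ^ (1 - a) ≤ 1 := Real.rpow_le_one hy0.le hy.2 (by linarith)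
  have hYw : y ^ a * y ^ (1 - a) = y := by
    rw [← Real.rpow_add hy0]; simp
  have hdw : |dWeight a y| ≤ 2 * y ^ a := by
    rw [dWeight, abs_mul, abs_two]
    refine mul_le_mul_of_nonneg_left ?_ zero_le_two
    rw [abs_le]; constructor <;> linarith [hy.2]
  set Y := y ^ a
  set w := y ^ (1 - a)
  have hY0 : 0 < Y := by linarith
  have hVw : V * w ≤ V := mul_le_of_le_one_right hV hw1
  have hv' := hv.trans hVw
  have hp' := hp.trans hVw
  have hr' := hr.trans hVw
  have mulV : ∀ {s t : ℝ}, |s| ≤ V → |t| ≤ V → |s * t| ≤ V ^ 2 := fun {s t} hs ht => by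
    rw [abs_mul, pow_two]; exact mul_le_mul hs ht (abs_nonneg _) hV
  have t1 : |-(Q * pQ) / Y| ≤ V ^ 2 * Y := by
    rw [abs_div, abs_neg, abs_of_pos hY0, div_le_iff₀ hY0]
    refine (mulV hQ hpQ).trans ?_
    nlinarith [sq_nonneg V, mul_nonneg (sq_nonneg V) (by nlinarith : 0 ≤ Y * Y - 1)]
  have t2 : |Y * (r * p - α * (r * v) + α ^ 3 / 2 * X * v ^ 2)|
      ≤ V ^ 2 * (1 + α + α ^ 3 / 2) * Y := by
    rw [abs_mul, abs_of_pos hY0, mul_comm]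
    refine mul_le_mul_of_nonneg_right ?_ hY0.le
    have b1 := mulV hr' hp'
    have b2 := mulV hr' hv'
    have b3 : |v ^ 2| ≤ V ^ 2 := by rw [pow_two]; exact mulV hv' hv'
    calc _ ≤ |r * p| + |α * (r * v)| + |α ^ 3 / 2 * X * v ^ 2| :=
          (abs_add_le _ _).trans (add_le_add_left (abs_sub _ _) _)
      _ ≤ V ^ 2 + α * V ^ 2 + α ^ 3 / 2 * 1 * V ^ 2 := by
          rw [abs_mul α, abs_mul (α ^ 3 / 2 * X), abs_of_pos hα,
            abs_of_nonneg (by positivity : 0 ≤ α ^ 3 / 2 * X)]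
          gcongr
      _ = _ := by ring
  have t3 : |α * dWeight a y * (rQ * v - r * Q)| ≤ V ^ 2 * (4 * α) * Y := by
    have b1 := mulV hrQ hv'
    have b2 := mulV hr' hQ
    rw [abs_mul, abs_mul, abs_of_pos hα]
    calc α * |dWeight a y| * |rQ * v - r * Q| ≤ α * (2 * Y) * (V ^ 2 + V ^ 2) := by
          gcongr
          exact (abs_sub _ _).trans (add_le_add b1 b2)
      _ = _ := by ring
  have t4 : |(α ^ 2 * dWeight a y ^ 2 + α) * (Y * (v * p))| ≤ V ^ 2 * (4 * α ^ 2 + α) * Y := by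
    have b1 : |v * p| ≤ V ^ 2 * w ^ 2 := by
      rw [abs_mul]
      calc |v| * |p| ≤ (V * w) * (V * w) := mul_le_mul hv hp (abs_nonneg _) (by positivity)
        _ = _ := by ring
    have b2 : dWeight a y ^ 2 ≤ 4 * Y ^ 2 := by
      rw [← sq_abs]
      calc |dWeight a y| ^ 2 ≤ (2 * Y) ^ 2 := pow_le_pow_left₀ (abs_nonneg _) hdw 2
        _ = _ := by ring
    rw [abs_mul, abs_mul, abs_of_pos hY0,
      abs_of_nonneg (by positivity : 0 ≤ α ^ 2 * dWeight a y ^ 2 + α)]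
    have b3 : (Y * w) ^ 2 ≤ 1 := by rw [hYw]; exact pow_le_one₀ hy0.le hy.2
    have b4 : w ^ 2 ≤ 1 := pow_le_one₀ hw0 hw1
    calc (α ^ 2 * dWeight a y ^ 2 + α) * (Y * |v * p|)
        ≤ (α ^ 2 * (4 * Y ^ 2) + α) * (Y * (V ^ 2 * w ^ 2)) := by gcongr
      _ = V ^ 2 * (4 * α ^ 2 * (Y * w) ^ 2 + α * w ^ 2) * Y := by ring
      _ ≤ V ^ 2 * (4 * α ^ 2 * 1 + α * 1) * Y := by gcongr
      _ = _ := by ring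
  rw [tangentialTerm]
  calc _ ≤ |-(Q * pQ) / Y| + |Y * (r * p - α * (r * v) + α ^ 3 / 2 * X * v ^ 2)|
        + |α * dWeight a y * (rQ * v - r * Q)|
        + |(α ^ 2 * dWeight a y ^ 2 + α) * (Y * (v * p))| :=
        (abs_add_le _ _).trans (add_le_add_left ((abs_add_le _ _).trans
          (add_le_add_left (abs_add_le _ _) _)) _)
    _ ≤ _ := add_le_add (add_le_add (add_le_add t1 t2) t3) t4
    _ = _ := by ring

theorem expWeight_le {a α X y : ℝ} (ha : -1 < a) (hα : 0 < α) (hX : 0 ≤ X)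
    (hy : y ∈ Set.Ioc (0 : ℝ) 1) : expWeight a α X y ≤ Real.exp α := by
  rw [expWeight, Real.exp_le_exp]
  have h1 : 0 ≤ y ^ (a + 1) / (a + 1) := div_nonneg (Real.rpow_nonneg hy.1.le _) (by linarith)
  have h2 : y ^ 2 ≤ 1 := pow_le_one₀ hy.1.le hy.2
  calc _ ≤ α * 1 := mul_le_mul_of_nonneg_left (by linarith) hα.le
    _ = α := mul_one α

theorem measurable_expWeight (a α : ℝ) :
    Measurable (fun p : Tan n × ℝ => expWeight a α (‖p.1.1‖ ^ 2) p.2) := by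
  unfold expWeight
  fun_prop

theorem integrableOn_rpow_Ioc {a : ℝ} (ha : -1 < a) :
    IntegrableOn (fun y : ℝ => y ^ a) (Set.Ioc 0 1) :=
  (intervalIntegrable_iff_integrableOn_Ioc_of_le zero_le_one).1
    (intervalIntegral.intervalIntegrable_rpow' ha)

theorem measurable_tangentialTerm (a α : ℝ) {e g₁ g₂ g₃ g₄ g₅ g₆ : Tan n × ℝ → ℝ}
    (he : Measurable e) (h₁ : Measurable g₁) (h₂ : Measurable g₂) (h₃ : Measurable g₃)
    (h₄ : Measurable g₄) (h₅ : Measurable g₅) (h₆ : Measurable g₆) :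
    Measurable (fun p : Tan n × ℝ => tangentialTerm a α (‖p.1.1‖ ^ 2) p.2 (e p * g₁ p)
      (e p * (g₄ p + α * (p.2 ^ a * dWeight a p.2) * g₁ p)) (e p * g₂ p)
      (e p * (g₅ p + α * (p.2 ^ a * dWeight a p.2) * g₂ p)) (e p * g₃ p)
      (e p * (g₆ p + α * (p.2 ^ a * dWeight a p.2) * g₃ p))) := by
  have md : Measurable (fun p : Tan n × ℝ => dWeight a p.2) := by unfold dWeight; fun_prop
  unfold tangentialTerm
  fun_prop

variable {a : ℝ} {U P fm : (Tan n → ℝ) → ℝ → Tan n → ℝ} {gm : (Tan n → ℝ) → Tan n → ℝ}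

/-- The tangential terms of the commutator for a mollified solution. -/
noncomputable def famTangential (a α : ℝ) (U P : ℝ → Tan n → ℝ) (z : Tan n) (y : ℝ) : ℝ :=
  tangentialTerm a α (‖z.1‖ ^ 2) y (expWeight a α (‖z.1‖ ^ 2) y * U y z)
    (conjFlux a α (‖z.1‖ ^ 2) (fun y => U y z) (fun y => P y z) y)
    (expWeight a α (‖z.1‖ ^ 2) y * tanSkew α (U y) z)
    (conjFlux a α (‖z.1‖ ^ 2) (fun y => tanSkew α (U y) z) (fun y => tanSkew α (P y) z) y)
    (expWeight a α (‖z.1‖ ^ 2) y * tanSymm α (U y) z)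
    (conjFlux a α (‖z.1‖ ^ 2) (fun y => tanSymm α (U y) z) (fun y => tanSymm α (P y) z) y)

namespace IsSolFamily

theorem bound_U (h : IsSolFamily a U P fm gm) (ha0 : a ≤ 0) {ρ : Tan n → ℝ} (hρ : IsMoll ρ) :
    ∃ B, ∀ y ∈ Set.Ioc (0 : ℝ) 1, ∀ z, |U ρ y z| ≤ B * y ^ (1 - a) := by
  obtain ⟨B, hB⟩ := h.bound_P hρ
  exact ⟨B, fun y hy z => abs_le_rpow_of_hasDerivAt ha0 (h.hasDerivAt hρ z)
    (fun y hy => hB y hy z) (h.tendsto_U hρ z) hy⟩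

theorem bound_P' (h : IsSolFamily a U P fm gm) {ρ : Tan n → ℝ} (hρ : IsMoll ρ) :
    ∃ B, ∀ y ∈ Set.Ioc (0 : ℝ) 1, ∀ z, |P ρ y z| ≤ B * (fun _ => (1 : ℝ)) y := by
  simpa using h.bound_P hρ

theorem exists_bound_tangential (h : IsSolFamily a U P fm gm) (ha : -1 < a) (ha0 : a ≤ 0) {α : ℝ}
    (hα : 0 < α) {ρ : Tan n → ℝ} (hρ : IsMoll ρ) :
    ∃ C, ∀ y ∈ Set.Ioc (0 : ℝ) 1, ∀ z ∈ tanBox n,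
      |famTangential a α (U ρ) (P ρ) z y| ≤ C * y ^ a := by
  obtain ⟨B1, h1⟩ := h.bound_U ha0 hρ
  obtain ⟨B2, h2⟩ := exists_bound_tanSkew α h.pd_U (h.bound_U ha0) hρ
  obtain ⟨B3, h3⟩ := exists_bound_tanSymm α h.pd_U (h.bound_U ha0) hρ
  obtain ⟨B4, h4⟩ := h.bound_P' hρ
  obtain ⟨B5, h5⟩ := exists_bound_tanSkew α h.pd_P h.bound_P' hρ
  obtain ⟨B6, h6⟩ := exists_bound_tanSymm α h.pd_P h.bound_P' hρ
  set B := |B1| + |B2| + |B3| + |B4| + |B5| + |B6| with hBdef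
  have n1 := abs_nonneg B1
  have n2 := abs_nonneg B2
  have n3 := abs_nonneg B3
  have n4 := abs_nonneg B4
  have n5 := abs_nonneg B5
  have n6 := abs_nonneg B6
  have hB0 : 0 ≤ B := by positivity
  set V := Real.exp α * (B + 2 * α * B) with hVdef
  have hV : 0 ≤ V := by positivity
  refine ⟨V ^ 2 * (2 + 6 * α + α ^ 3 / 2 + 4 * α ^ 2), fun y hy z hz => ?_⟩
  have hz1 := norm_le_of_mem_tanBox hz
  have hX : (0 : ℝ) ≤ ‖z.1‖ ^ 2 := by positivity
  have he := expWeight_le ha hα hX hy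
  have he0 := (expWeight_pos a α (‖z.1‖ ^ 2) y).le
  have hy0 : 0 < y := hy.1
  have hw0 : 0 ≤ y ^ (1 - a) := Real.rpow_nonneg hy0.le _
  have hB' : B ≤ B + 2 * α * B := le_add_of_nonneg_right (by positivity)
  have k1 : ∀ {s Bi : ℝ}, |s| ≤ Bi * y ^ (1 - a) → |Bi| ≤ B →
      |expWeight a α (‖z.1‖ ^ 2) y * s| ≤ V * y ^ (1 - a) := fun {s Bi} hs hBi => by
    rw [abs_mul, abs_of_nonneg he0, hVdef, mul_assoc]
    have : |s| ≤ (B + 2 * α * B) * y ^ (1 - a) :=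
      hs.trans (mul_le_mul_of_nonneg_right (((le_abs_self _).trans hBi).trans hB') hw0)
    exact mul_le_mul he this (abs_nonneg _) (Real.exp_pos _).le
  -- Differentiating the weight in the conjugated flux costs y^a|h'| ≤ 2y^{2a}; against the decay
  -- y^{1-a} this leaves y^{1+a} ≤ 1.
  have hYYw : y ^ a * y ^ a * y ^ (1 - a) ≤ 1 := by
    rw [← Real.rpow_add hy0, ← Real.rpow_add hy0]
    exact Real.rpow_le_one hy0.le hy.2 (by linarith)
  have hY1 : 1 ≤ y ^ a := Real.one_le_rpow_of_pos_of_le_one_of_nonpos hy0 hy.2 ha0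
  have hdw : |dWeight a y| ≤ 2 * y ^ a := by
    rw [dWeight, abs_mul, abs_two]
    refine mul_le_mul_of_nonneg_left ?_ zero_le_two
    rw [abs_le]; constructor <;> linarith [hy.2]
  have k2 : ∀ {s t Bi Bj : ℝ}, |s| ≤ Bi * y ^ (1 - a) → |t| ≤ Bj * 1 → |Bi| ≤ B → |Bj| ≤ B →
      |expWeight a α (‖z.1‖ ^ 2) y * (t + α * (y ^ a * dWeight a y) * s)| ≤ V :=
    fun {s t Bi Bj} hs ht hBi hBj => by
    rw [abs_mul, abs_of_nonneg he0, hVdef]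
    refine mul_le_mul he ?_ (abs_nonneg _) (Real.exp_pos _).le
    have hs' : |s| ≤ B * y ^ (1 - a) :=
      hs.trans (mul_le_mul_of_nonneg_right ((le_abs_self _).trans hBi) hw0)
    have ht' : |t| ≤ B := ht.trans (by rw [mul_one]; exact (le_abs_self _).trans hBj)
    refine (abs_add_le _ _).trans (add_le_add ht' ?_)
    rw [abs_mul, abs_mul, abs_mul, abs_of_pos hα, abs_of_nonneg (by linarith : 0 ≤ y ^ a)]
    calc α * (y ^ a * |dWeight a y|) * |s| ≤ α * (y ^ a * (2 * y ^ a)) * (B * y ^ (1 - a)) := by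
          gcongr
      _ = 2 * α * B * (y ^ a * y ^ a * y ^ (1 - a)) := by ring
      _ ≤ 2 * α * B * 1 := mul_le_mul_of_nonneg_left hYYw (by positivity)
      _ = _ := mul_one _
  refine abs_tangentialTerm_le ha0 hα hX (pow_le_one₀ (norm_nonneg _) hz1) hy hV ?_ ?_ ?_ ?_ ?_ ?_
  · exact k1 (h1 y hy z) (by linarith)
  · exact k1 (h2 y hy z hz) (by linarith)
  · exact k1 (h3 y hy z hz) (by linarith)
  · exact k2 (h1 y hy z) (h4 y hy z) (by linarith) (by linarith)
  · exact k2 (h2 y hy z hz) (h5 y hy z hz) (by linarith) (by linarith)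
  · exact k2 (h3 y hy z hz) (h6 y hy z hz) (by linarith) (by linarith)

theorem measurable_tangential (h : IsSolFamily a U P fm gm) (α : ℝ) {ρ : Tan n → ℝ}
    (hρ : IsMoll ρ) :
    Measurable (fun p : Tan n × ℝ => famTangential a α (U ρ) (P ρ) p.1 p.2) := by
  exact measurable_tangentialTerm a α (measurable_expWeight a α) (h.measurable_U hρ)
    (measurable_tanSkew α h.pd_U h.measurable_U hρ) (measurable_tanSymm α h.pd_U h.measurable_U hρ)
    (h.measurable_P hρ) (measurable_tanSkew α h.pd_P h.measurable_P hρ)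
    (measurable_tanSymm α h.pd_P h.measurable_P hρ)

/-- The Carleman inequality for mollified solutions. -/
theorem carleman (h : IsSolFamily a U P fm gm) (ha : -1 < a) (ha0 : a ≤ 0) {α : ℝ} (hα : 2 < α)
    {ρ : Tan n → ℝ} (hρ : IsMoll ρ) :
    ENNReal.ofReal (2 * α ^ 3) * (∫⁻ z in tanBox n, ∫⁻ y in Set.Ioc (0 : ℝ) 1,
        ENNReal.ofReal (y ^ a * (expWeight a α (‖z.1‖ ^ 2) y * U ρ y z) ^ 2))
      ≤ ENNReal.ofReal (1 / 4) * (∫⁻ z in tanBox n, ∫⁻ y in Set.Ioc (0 : ℝ) 1,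
        ENNReal.ofReal ((expWeight a α (‖z.1‖ ^ 2) y * fm ρ y z) ^ 2 * y ^ (-a)))
        + ENNReal.ofReal (2 * α) * ∫⁻ z in tanBox n, ENNReal.ofReal (gm ρ z ^ 2) := by
  have hα0 : 0 < α := by linarith
  set μ := (volume : Measure (Tan n)).restrict (tanBox n) with hμ
  set ν := (volume : Measure ℝ).restrict (Set.Ioc 0 1) with hν
  have : IsFiniteMeasure μ := ⟨by
    rw [hμ, Measure.restrict_apply_univ]; exact isCompact_tanBox.measure_lt_top⟩
  have hYint : Integrable (fun p : Tan n × ℝ => p.2 ^ a) (μ.prod ν) :=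
    (integrableOn_rpow_Ioc ha).comp_snd μ
  have hmem : ∀ᵐ p ∂(μ.prod ν), p.1 ∈ tanBox n ∧ p.2 ∈ Set.Ioc (0 : ℝ) 1 := by
    rw [hμ, hν, Measure.prod_restrict]
    exact ae_restrict_mem (measurableSet_tanBox.prod measurableSet_Ioc)
  set N := famTangential a α (U ρ) (P ρ) with hN
  obtain ⟨C, hC⟩ := h.exists_bound_tangential ha ha0 hα0 hρ
  -- Joint integrability allows the tangential terms to be integrated first in z, where they vanish
  -- for each y, although the inequality itself is proved by integrating first in y.
  have hNint : Integrable (fun p : Tan n × ℝ => N p.1 p.2) (μ.prod ν) := by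
    refine (hYint.const_mul C).mono' (h.measurable_tangential α hρ).aestronglyMeasurable ?_
    filter_upwards [hmem] with p hp
    exact hC p.2 hp.2 p.1 hp.1
  have hNz : ∀ z ∈ tanBox n, IntegrableOn (N z) (Set.Ioc 0 1) := fun z hz => by
    refine ((integrableOn_rpow_Ioc ha).const_mul C).mono'
      ((h.measurable_tangential α hρ).comp (measurable_prodMk_left (x := z))).aestronglyMeasurable ?_
    filter_upwards [ae_restrict_mem measurableSet_Ioc] with y hy
    exact hC y hy z hz
  set I : Tan n → ℝ → ℝ := fun z y => y ^ a * (expWeight a α (‖z.1‖ ^ 2) y * U ρ y z) ^ 2 with hI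
  have hImeas : Measurable (fun p : Tan n × ℝ => I p.1 p.2) := by
    have m1 := h.measurable_U hρ
    have me := measurable_expWeight (n := n) a α
    have mY : Measurable (fun p : Tan n × ℝ => p.2 ^ a) := by fun_prop
    exact mY.mul ((me.mul m1).pow_const 2)
  have hI0 : ∀ z, ∀ y ∈ Set.Ioc (0 : ℝ) 1, 0 ≤ I z y := fun z y hy =>
    mul_nonneg (Real.rpow_nonneg hy.1.le _) (sq_nonneg _)
  obtain ⟨B, hB⟩ := h.bound_U ha0 hρ
  have hIb : ∀ z, ∀ y ∈ Set.Ioc (0 : ℝ) 1, |I z y| ≤ (Real.exp α * |B|) ^ 2 * y ^ a := by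
    intro z y hy
    rw [abs_of_nonneg (hI0 z y hy)]
    simp only [hI]
    rw [mul_comm]
    refine mul_le_mul_of_nonneg_right ?_ (Real.rpow_nonneg hy.1.le _)
    rw [← sq_abs, abs_mul, abs_of_pos (expWeight_pos _ _ _ _)]
    have h1 : |U ρ y z| ≤ |B| := (hB y hy z).trans ((mul_le_mul_of_nonneg_right (le_abs_self B)
      (Real.rpow_nonneg hy.1.le _)).trans (mul_le_of_le_one_right (abs_nonneg _)
        (Real.rpow_le_one hy.1.le hy.2 (by linarith))))
    have h2 := expWeight_le ha hα0 (by positivity : (0 : ℝ) ≤ ‖z.1‖ ^ 2) hy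
    exact pow_le_pow_left₀ (mul_nonneg (expWeight_pos _ _ _ _).le (abs_nonneg _))
      (mul_le_mul h2 h1 (abs_nonneg _) (Real.exp_pos _).le) 2
  have hIint : Integrable (fun p : Tan n × ℝ => I p.1 p.2) (μ.prod ν) := by
    refine (hYint.const_mul ((Real.exp α * |B|) ^ 2)).mono' hImeas.aestronglyMeasurable ?_
    filter_upwards [hmem] with p hp
    exact hIb p.1 p.2 hp.2
  have hIz : ∀ z, IntegrableOn (I z) (Set.Ioc 0 1) := fun z => by
    refine ((integrableOn_rpow_Ioc ha).const_mul ((Real.exp α * |B|) ^ 2)).mono'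
      (hImeas.comp (measurable_prodMk_left (x := z))).aestronglyMeasurable ?_
    filter_upwards [ae_restrict_mem measurableSet_Ioc] with y hy
    exact hIb z y hy
  set G : Tan n → ℝ → ℝ := fun z y => (expWeight a α (‖z.1‖ ^ 2) y * fm ρ y z) ^ 2 * y ^ (-a)
    with hG
  have hG0 : ∀ z, ∀ y ∈ Set.Ioc (0 : ℝ) 1, 0 ≤ G z y := fun z y hy =>
    mul_nonneg (sq_nonneg _) (Real.rpow_nonneg hy.1.le _)
  have hGz : ∀ z, IntegrableOn (G z) (Set.Ioc 0 1) := fun z => by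
    have h1 : G z = fun y => expWeight a α (‖z.1‖ ^ 2) y ^ 2 * (fm ρ y z ^ 2 * y ^ (-a)) :=
      funext fun y => by simp only [hG]; ring
    rw [h1]
    refine Integrable.bdd_mul (c := Real.exp α ^ 2) (h.sq_integrable hρ z)
      ((continuous_expWeight ha α _).pow 2).aestronglyMeasurable ?_
    filter_upwards [ae_restrict_mem measurableSet_Ioc] with y hy
    rw [Real.norm_eq_abs, abs_of_nonneg (sq_nonneg _)]
    exact pow_le_pow_left₀ (expWeight_pos _ _ _ _).le (expWeight_le ha hα0 (by positivity) hy) 2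
  have key : ∀ z ∈ tanBox n, 2 * α ^ 3 * (∫ y, I z y ∂ν) + ∫ y, N z y ∂ν
      ≤ 1 / 4 * (∫ y, G z y ∂ν) + 2 * α * gm ρ z ^ 2 := by
    intro z hz
    have hx : ∀ i, IsMoll (pd (tanX i) ρ) := fun i => hρ.pd _
    have hxx : ∀ i, IsMoll (pd (tanX i) (pd (tanX i) ρ)) := fun i => (hx i).pd _
    have hT := hρ.pd (tanT n)
    have dlin : ∀ {y}, 0 < y → HasDerivAt (fun y => ∑ i, z.1 i * U (pd (tanX i) ρ) y z)
        (∑ i, z.1 i * (y ^ (-a) * P (pd (tanX i) ρ) y z)) y := fun hy =>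
      HasDerivAt.fun_sum fun i _ => (h.hasDerivAt (hx i) z _ hy).const_mul _
    have tlin : Tendsto (fun y => ∑ i, z.1 i * U (pd (tanX i) ρ) y z) (𝓝[>] 0) (𝓝 0) := by
      have := tendsto_finsetSum (f := fun (i : Fin n) y => z.1 i * U (pd (tanX i) ρ) y z)
        (a := fun i => z.1 i * 0) Finset.univ
        (fun (i : Fin n) _ => (h.tendsto_U (hx i) z).const_mul (z.1 i))
      simpa using this
    have Pcont : ∀ {σ}, IsMoll σ → ContinuousOn (fun y => P σ y z) (Set.Ioi 0) := fun hσ =>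
      ((continuousOn_const.add (continuousOn_primitive_Ici
        (h.integrable_F hσ z))).congr fun y hy => h.P_eq hσ z y hy).mono Set.Ioi_subset_Ici_self
    have hτ : ∀ y, 0 < y → HasDerivAt (fun y => tanSkew α (U ρ y) z)
        (y ^ (-a) * tanSkew α (P ρ y) z) y := fun y hy => by
      simp only [tanSkew, h.pd_U hρ, h.pd_P hρ]
      refine (((h.hasDerivAt hT z y hy).add ((dlin hy).const_mul α)).sub
        ((h.hasDerivAt hρ z y hy).const_mul (tanCoeff α z))).congr_deriv ?_
      have : ∀ i, z.1 i * (y ^ (-a) * P (pd (tanX i) ρ) y z)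
          = y ^ (-a) * (z.1 i * P (pd (tanX i) ρ) y z) := fun i => by ring
      simp only [this, ← Finset.mul_sum]
      ring
    have hd : ∀ y, 0 < y → HasDerivAt (fun y => tanSymm α (U ρ y) z)
        (y ^ (-a) * tanSymm α (P ρ y) z) y := fun y hy => by
      simp only [tanSymm, h.pd_U hρ, h.pd_P hρ, h.pd_U (hx _), h.pd_P (hx _)]
      refine (((HasDerivAt.fun_sum fun i (_ : i ∈ Finset.univ) => h.hasDerivAt (hxx i) z y hy).sub
        ((dlin hy).const_mul α)).add
        ((h.hasDerivAt hρ z y hy).const_mul (tanCoeff α z))).congr_deriv ?_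
      have : ∀ i, z.1 i * (y ^ (-a) * P (pd (tanX i) ρ) y z)
          = y ^ (-a) * (z.1 i * P (pd (tanX i) ρ) y z) := fun i => by ring
      simp only [this, ← Finset.mul_sum]
      ring
    have hPτ : ContinuousOn (fun y => tanSkew α (P ρ y) z) (Set.Ioi 0) := by
      simp only [tanSkew, h.pd_P hρ]
      exact ((Pcont hT).add (continuousOn_const.mul (continuousOn_finsetSum _ fun i _ =>
        continuousOn_const.mul (Pcont (hx i))))).sub (continuousOn_const.mul (Pcont hρ))
    have hPd : ContinuousOn (fun y => tanSymm α (P ρ y) z) (Set.Ioi 0) := by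
      simp only [tanSymm, h.pd_P hρ, h.pd_P (hx _)]
      exact ((continuousOn_finsetSum _ fun i _ => Pcont (hxx i)).sub
        (continuousOn_const.mul (continuousOn_finsetSum _ fun i _ =>
        continuousOn_const.mul (Pcont (hx i))))).add (continuousOn_const.mul (Pcont hρ))
    have τ0 : Tendsto (fun y => tanSkew α (U ρ y) z) (𝓝[>] 0) (𝓝 0) := by
      simp only [tanSkew, h.pd_U hρ]
      simpa using ((h.tendsto_U hT z).add (tlin.const_mul α)).sub
        ((h.tendsto_U hρ z).const_mul (tanCoeff α z))
    have d0 : Tendsto (fun y => tanSymm α (U ρ y) z) (𝓝[>] 0) (𝓝 0) := by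
      simp only [tanSymm, h.pd_U hρ, h.pd_U (hx _)]
      have := tendsto_finsetSum (f := fun (i : Fin n) y => U (pd (tanX i) (pd (tanX i) ρ)) y z)
        (a := fun _ => 0) Finset.univ (fun (i : Fin n) _ => h.tendsto_U (hxx i) z)
      simpa using (this.sub (tlin.const_mul α)).add
        ((h.tendsto_U hρ z).const_mul (tanCoeff α z))
    have main := carleman_inequality_normal (g₀ := gm ρ z) (X := ‖z.1‖ ^ 2) ha ha0 hα
      (h.hasDerivAt hρ z) hτ hd (h.integrable_F hρ z) (h.P_eq hρ z) hPτ hPd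
      (f := fun y => fm ρ y z) (fun y _ => by
        simp only [tanSkew, tanSymm, h.pd_U hρ, h.pd_U (hx _)]; ring)
      (h.tendsto_U hρ z) τ0 d0 (h.zero_U hρ one_pos fun h1 => by norm_num at h1)
      (h.zero_P hρ one_pos fun h1 => by norm_num at h1)
      (fun y hy hne => ⟨by
        by_contra hcon
        exact hne (h.zero_U hρ hy fun h1 => absurd h1 hcon),
        pow_le_one₀ (norm_nonneg _) (norm_le_of_mem_tanBox hz)⟩)
      (hIz z) (hGz z) (hNz z hz)
    refine main.trans (add_le_add le_rfl (mul_le_mul_of_nonneg_left ?_ (by positivity)))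
    refine mul_le_of_le_one_left (sq_nonneg _) ?_
    rw [Real.exp_le_one_iff]
    have : 0 ≤ α * ‖z.1‖ ^ 2 / 2 := by positivity
    linarith
  have hNzero : ∫ z, ∫ y, N z y ∂ν ∂μ = 0 := by
    rw [integral_integral_swap hNint]
    have : ∀ᵐ y ∂ν, ∫ z, N z y ∂μ = 0 := by
      filter_upwards [ae_restrict_mem measurableSet_Ioc] with y hy
      have hy0 : 0 < y := hy.1
      have hout : ∀ z ∉ tanBox n, U ρ y z = 0 := fun z hz => h.zero_U hρ hy0 fun _ => hz
      have hout' : ∀ z ∉ tanBox n, P ρ y z = 0 := fun z hz => h.zero_P hρ hy0 fun _ => hz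
      have h1 := isNull_tangentialTerm a α y (h.contDiff_U hρ y) (h.contDiff_P hρ y)
        (HasCompactSupport.intro isCompact_tanBox hout)
        (HasCompactSupport.intro isCompact_tanBox hout')
      rw [hμ, setIntegral_eq_integral_of_forall_compl_eq_zero]
      · exact h1.2
      · intro z hz
        have o1 := hout z hz
        have o2 := hout' z hz
        simp [hN, famTangential, tangentialTerm, conjFlux, o1, o2, tanSkew, tanSymm,
          h.pd_U hρ, h.pd_P hρ, h.pd_U (hρ.pd _), h.pd_P (hρ.pd _),
          h.zero_U (hρ.pd _) hy0 fun _ => hz, h.zero_P (hρ.pd _) hy0 fun _ => hz,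
          h.zero_U ((hρ.pd _).pd _) hy0 fun _ => hz]
    rw [integral_congr_ae this, integral_zero]
  have hIzz : Integrable (fun z => ∫ y, I z y ∂ν) μ := hIint.integral_prod_left
  have hNzz : Integrable (fun z => ∫ y, N z y ∂ν) μ := hNint.integral_prod_left
  have eI : ∫⁻ z, ∫⁻ y, ENNReal.ofReal (I z y) ∂ν ∂μ
      = ENNReal.ofReal (∫ z, ∫ y, I z y ∂ν ∂μ) := by
    rw [ofReal_integral_eq_lintegral_ofReal hIzz]
    · refine lintegral_congr fun z => ?_
      rw [ofReal_integral_eq_lintegral_ofReal (hIz z)]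
      filter_upwards [ae_restrict_mem measurableSet_Ioc] with y hy using hI0 z y hy
    · refine Eventually.of_forall fun z => integral_nonneg_of_ae ?_
      filter_upwards [ae_restrict_mem measurableSet_Ioc] with y hy using hI0 z y hy
  have hα3 : 0 ≤ 2 * α ^ 3 := by positivity
  rw [eI, ← ENNReal.ofReal_mul hα3]
  have e2 : 2 * α ^ 3 * (∫ z, ∫ y, I z y ∂ν ∂μ)
      = ∫ z, (2 * α ^ 3 * (∫ y, I z y ∂ν) + ∫ y, N z y ∂ν) ∂μ := by
    rw [integral_add (hIzz.const_mul _) hNzz, hNzero, add_zero, integral_const_mul]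
  rw [e2]
  have hHint : Integrable (fun z => 2 * α ^ 3 * (∫ y, I z y ∂ν) + ∫ y, N z y ∂ν) μ := (hIzz.const_mul (2 * α ^ 3)).add hNzz
  -- The passage to lower integrals avoids any joint integrability of the right-hand side: only
  -- integrability in y for each z, and measurability of the boundary datum, are required.
  calc ENNReal.ofReal (∫ z, (2 * α ^ 3 * (∫ y, I z y ∂ν) + ∫ y, N z y ∂ν) ∂μ)
      ≤ ∫⁻ z, ENNReal.ofReal (2 * α ^ 3 * (∫ y, I z y ∂ν) + ∫ y, N z y ∂ν) ∂μ := by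
        rw [integral_eq_lintegral_pos_part_sub_lintegral_neg_part hHint]
        refine (ENNReal.ofReal_le_ofReal (sub_le_self _ ENNReal.toReal_nonneg)).trans ?_
        exact ENNReal.ofReal_toReal_le
    _ ≤ ∫⁻ z, (ENNReal.ofReal (1 / 4) * (∫⁻ y, ENNReal.ofReal (G z y) ∂ν)
          + ENNReal.ofReal (2 * α) * ENNReal.ofReal (gm ρ z ^ 2)) ∂μ := by
        refine setLIntegral_mono' measurableSet_tanBox fun z hz => ?_
        refine (ENNReal.ofReal_le_ofReal (key z hz)).trans ?_
        refine ENNReal.ofReal_add_le.trans (add_le_add ?_ ?_)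
        · rw [ENNReal.ofReal_mul (by norm_num), ofReal_integral_eq_lintegral_ofReal (hGz z)]
          filter_upwards [ae_restrict_mem measurableSet_Ioc] with y hy using hG0 z y hy
        · rw [ENNReal.ofReal_mul (by positivity)]
    _ = _ := by
        rw [lintegral_add_right _ (((h.measurable_gm hρ).pow_const 2).ennreal_ofReal.const_mul _),
          lintegral_const_mul' _ _ ENNReal.ofReal_ne_top,
          lintegral_const_mul' _ _ ENNReal.ofReal_ne_top]

end IsSolFamily

/-! ### Convolution in the tangential variables and primitives in the normal variable. -/

open scoped Convolution

/-- Convolution in the tangential variables. -/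
noncomputable def conv (h ρ : Tan n → ℝ) (z : Tan n) : ℝ := ∫ z', h z' * ρ (z - z')

theorem conv_eq (h ρ : Tan n → ℝ) :
    conv h ρ = h ⋆[ContinuousLinearMap.mul ℝ ℝ, volume] ρ := rfl

theorem contDiff_conv {h ρ : Tan n → ℝ} (hh : LocallyIntegrable h) (hρ : ContDiff ℝ ∞ ρ)
    (hc : HasCompactSupport ρ) : ContDiff ℝ ∞ (conv h ρ) := by
  rw [conv_eq]
  exact hc.contDiff_convolution_right _ hh hρ

theorem pd_conv {h ρ : Tan n → ℝ} (hh : LocallyIntegrable h) (hρ : ContDiff ℝ ∞ ρ)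
    (hc : HasCompactSupport ρ) (v : Tan n) : pd v (conv h ρ) = conv h (pd v ρ) := by
  ext z
  have h1 := hc.hasFDerivAt_convolution_right (ContinuousLinearMap.mul ℝ ℝ) hh
    (hρ.of_le (by simp)) z
  rw [pd, conv_eq, h1.fderiv, convolution_precompR_apply _ hh (hc.fderiv (𝕜 := ℝ))
    (hρ.continuous_fderiv (by simp))]
  rfl

theorem integrable_mul_sub {h ρ : Tan n → ℝ} (hh : LocallyIntegrable h) (hρ : Continuous ρ)
    (hc : HasCompactSupport ρ) (z : Tan n) : Integrable (fun z' => h z' * ρ (z - z')) := by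
  have h1 : Continuous fun z' => ρ (z - z') := by fun_prop
  have h2 : HasCompactSupport fun z' => ρ (z - z') :=
    hc.comp_homeomorph (Homeomorph.subLeft z)
  simpa only [smul_eq_mul, mul_comm] using hh.integrable_smul_left_of_hasCompactSupport h1 h2

theorem conv_add_left {h k ρ : Tan n → ℝ} (hh : LocallyIntegrable h) (hk : LocallyIntegrable k)
    (hρ : Continuous ρ) (hc : HasCompactSupport ρ) (z : Tan n) :
    conv (fun z => h z + k z) ρ z = conv h ρ z + conv k ρ z := by
  simp only [conv, add_mul]
  exact integral_add (integrable_mul_sub hh hρ hc z) (integrable_mul_sub hk hρ hc z)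

/-- The Laplacian plus the time derivative of a mollifier. -/
noncomputable def heatOp (ρ : Tan n → ℝ) (z : Tan n) : ℝ :=
  pd (tanT n) ρ z + ∑ i, pd (tanX i) (pd (tanX i) ρ) z

theorem IsMoll.sum {ι : Type*} (s : Finset ι) {ρ : ι → Tan n → ℝ} (h : ∀ i, IsMoll (ρ i)) :
    IsMoll (fun z => ∑ i ∈ s, ρ i z) := by
  refine ⟨ContDiff.sum fun i _ => (h i).1, closure_minimal (fun z hz => ?_)
    Metric.isClosed_closedBall⟩
  obtain ⟨i, -, hi⟩ := Finset.exists_ne_zero_of_sum_ne_zero hz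
  exact (h i).2 (subset_tsupport _ hi)

theorem IsMoll.add {ρ σ : Tan n → ℝ} (h : IsMoll ρ) (h' : IsMoll σ) :
    IsMoll (fun z => ρ z + σ z) := by
  refine ⟨h.1.add h'.1, closure_minimal (fun z hz => ?_) Metric.isClosed_closedBall⟩
  by_contra hcon
  refine hz ?_
  simp [image_eq_zero_of_notMem_tsupport fun h1 => hcon (h.2 h1),
    image_eq_zero_of_notMem_tsupport fun h1 => hcon (h'.2 h1)]

theorem IsMoll.heatOp {ρ : Tan n → ℝ} (h : IsMoll ρ) : IsMoll (heatOp ρ) :=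
  (h.pd _).add (IsMoll.sum _ fun i => (h.pd (tanX i)).pd (tanX i))

theorem conv_heatOp {h ρ : Tan n → ℝ} (hh : LocallyIntegrable h) (hρ : IsMoll ρ) (z : Tan n) :
    conv h (heatOp ρ) z
      = conv h (pd (tanT n) ρ) z + ∑ i, conv h (pd (tanX i) (pd (tanX i) ρ)) z := by
  have hi : ∀ {σ : Tan n → ℝ}, IsMoll σ → Integrable (fun z' => h z' * σ (z - z')) := fun hσ =>
    integrable_mul_sub hh hσ.1.continuous hσ.hasCompactSupport z
  simp only [conv, heatOp, mul_add, Finset.mul_sum]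
  rw [integral_add (hi (hρ.pd _)) (integrable_finsetSum _ fun i _ =>
      hi ((hρ.pd (tanX i)).pd (tanX i))),
    integral_finsetSum _ fun i _ => hi ((hρ.pd (tanX i)).pd (tanX i))]

theorem pd_pd_comm_heatOp {ρ : Tan n → ℝ} (hρ : ContDiff ℝ ∞ ρ) (v : Tan n) :
    pd v (heatOp ρ) = heatOp (pd v ρ) := by
  ext z
  have hd : ∀ {σ : Tan n → ℝ}, ContDiff ℝ ∞ σ → HasFDerivAt σ (fderiv ℝ σ z) z := fun hσ =>
    (hσ.differentiable (by simp) z).hasFDerivAt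
  have h1 := ((hd (contDiff_pd (tanT n) hρ)).add (HasFDerivAt.fun_sum
    fun i (_ : i ∈ Finset.univ) => hd (contDiff_pd (tanX i) (contDiff_pd (tanX i) hρ)))).fderiv
  have h2 : pd v (heatOp ρ) z = pd v (pd (tanT n) ρ) z
      + ∑ i, pd v (pd (tanX i) (pd (tanX i) ρ)) z := by
    simp only [pd]
    rw [show heatOp ρ = pd (tanT n) ρ + fun z => ∑ i, pd (tanX i) (pd (tanX i) ρ) z from rfl]
    refine (congrArg (fun L => L v) h1).trans ?_
    simp
  have h3 : ∀ i, pd v (pd (tanX i) (pd (tanX i) ρ)) z = pd (tanX i) (pd (tanX i) (pd v ρ)) z :=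
    fun i => by
      rw [pd_comm v (tanX i) (contDiff_pd _ hρ)]
      congr 1
      ext z
      exact pd_comm v (tanX i) hρ z
  rw [h2, pd_comm v (tanT n) hρ]
  simp only [heatOp, h3]

/-- Functions on the slab which are integrable on bounded sets up to `y = 0`. -/
def SlabIntegrable (F : ℝ → Tan n → ℝ) : Prop :=
  ∀ b R : ℝ, IntegrableOn (fun p : ℝ × Tan n => F p.1 p.2)
    (Set.Ioc 0 b ×ˢ Metric.closedBall 0 R)

/-- The primitive in the normal variable. -/
noncomputable def primY (F : ℝ → Tan n → ℝ) (y : ℝ) (z : Tan n) : ℝ := ∫ t in Set.Ioc 0 y, F t z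

namespace SlabIntegrable

variable {F : ℝ → Tan n → ℝ}

theorem locallyIntegrable (hF : SlabIntegrable F) (y : ℝ) : LocallyIntegrable (primY F y) := by
  intro z
  refine ⟨Metric.closedBall 0 (‖z‖ + 1), ?_, ?_⟩
  · refine mem_of_superset (Metric.closedBall_mem_nhds z one_pos) fun x hx => ?_
    rw [mem_closedBall_zero_iff]
    rw [mem_closedBall_iff_norm] at hx
    linarith [norm_sub_norm_le x z]
  · have h := hF y (‖z‖ + 1)
    rw [IntegrableOn, Measure.volume_eq_prod, ← Measure.prod_restrict] at h
    exact h.integral_prod_right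

theorem integrable_mul (hF : SlabIntegrable F) {ρ : Tan n → ℝ} (hρ : Continuous ρ)
    (hc : HasCompactSupport ρ) (z : Tan n) (b : ℝ) :
    Integrable (fun p : ℝ × Tan n => F p.1 p.2 * ρ (z - p.2))
      ((volume.restrict (Set.Ioc 0 b)).prod volume) := by
  obtain ⟨R, hR⟩ := (hc.comp_homeomorph (Homeomorph.subLeft z)).isBounded.subset_closedBall 0
  obtain ⟨M, hM⟩ := hρ.bounded_above_of_compact_support hc
  have h := hF b R
  rw [IntegrableOn, Measure.volume_eq_prod, ← Measure.prod_restrict] at h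
  have hk : Continuous fun p : ℝ × Tan n => ρ (z - p.2) := by fun_prop
  have h1 : Integrable (fun p : ℝ × Tan n => F p.1 p.2 * ρ (z - p.2))
      ((volume.restrict (Set.Ioc 0 b)).prod (volume.restrict (Metric.closedBall 0 R))) :=
    h.mul_bdd hk.aestronglyMeasurable (Eventually.of_forall fun p => hM _)
  have e : (volume.restrict (Set.Ioc 0 b)).prod
      ((volume : Measure (Tan n)).restrict (Metric.closedBall 0 R))
      = ((volume.restrict (Set.Ioc 0 b)).prod volume).restrict
        (Set.univ ×ˢ Metric.closedBall 0 R) := by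
    rw [← Measure.prod_restrict, Measure.restrict_univ]
  rw [e] at h1
  refine IntegrableOn.integrable_of_forall_notMem_eq_zero h1 fun p hp => ?_
  have : p.2 ∉ tsupport (ρ ∘ Homeomorph.subLeft z) := fun h2 => hp ⟨trivial, hR h2⟩
  have := image_eq_zero_of_notMem_tsupport this
  simp only [Function.comp, Homeomorph.coe_subLeft] at this
  rw [this, mul_zero]

theorem integrableOn_conv (hF : SlabIntegrable F) {ρ : Tan n → ℝ} (hρ : Continuous ρ)
    (hc : HasCompactSupport ρ) (z : Tan n) (b : ℝ) :
    IntegrableOn (fun t => conv (F t) ρ z) (Set.Ioc 0 b) :=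
  (hF.integrable_mul hρ hc z b).integral_prod_left

theorem conv_primY (hF : SlabIntegrable F) {ρ : Tan n → ℝ} (hρ : Continuous ρ)
    (hc : HasCompactSupport ρ) (z : Tan n) (y : ℝ) :
    conv (primY F y) ρ z = ∫ t in Set.Ioc 0 y, conv (F t) ρ z := by
  simp only [conv, primY]
  rw [integral_integral_swap (hF.integrable_mul hρ hc z y)]
  exact integral_congr_ae (Eventually.of_forall fun z' => (integral_mul_const _ _).symm)

/-- The supremum of |ρ| times the integral of |F| over one fixed set bounds all these convolutions.
On the box ‖z‖ ≤ 2, and ρ reaches distance at most 1/2, so the ball of radius 3 contains every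
relevant z'. -/
theorem exists_bound_conv (hF : SlabIntegrable F) {ρ : Tan n → ℝ} (hρ : IsMoll ρ) :
    ∃ C, ∀ y ∈ Set.Ioc (0 : ℝ) 1, ∀ z ∈ tanBox n, |conv (primY F y) ρ z| ≤ C := by
  obtain ⟨M, hM⟩ := hρ.1.continuous.bounded_above_of_compact_support hρ.hasCompactSupport
  have hM0 : 0 ≤ M := (norm_nonneg _).trans (hM 0)
  have h := hF 1 3
  refine ⟨∫ p in Set.Ioc (0 : ℝ) 1 ×ˢ Metric.closedBall (0 : Tan n) 3, M * ‖F p.1 p.2‖,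
    fun y hy z hz => ?_⟩
  have hi := hF.integrable_mul hρ.1.continuous hρ.hasCompactSupport z y
  rw [hF.conv_primY hρ.1.continuous hρ.hasCompactSupport z y]
  have e1 : ∫ t in Set.Ioc 0 y, conv (F t) ρ z
      = ∫ p, F p.1 p.2 * ρ (z - p.2) ∂((volume.restrict (Set.Ioc 0 y)).prod volume) :=
    (integral_prod _ hi).symm
  have e2 : (volume.restrict (Set.Ioc 0 y)).prod (volume : Measure (Tan n))
      = (volume : Measure (ℝ × Tan n)).restrict (Set.Ioc 0 y ×ˢ Set.univ) := by
    have := Measure.prod_restrict (μ := (volume : Measure ℝ)) (ν := (volume : Measure (Tan n)))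
      (Set.Ioc 0 y) Set.univ
    rwa [Measure.restrict_univ] at this
  have hz2 : ‖z‖ ≤ 2 := by
    rw [Prod.norm_def]
    have h1 := norm_le_of_mem_tanBox hz
    have h2 : ‖z.2‖ ≤ 2 := by simpa using hz.2
    exact max_le (by linarith) h2
  have hsupp : ∀ z', ρ (z - z') ≠ 0 → z' ∈ Metric.closedBall (0 : Tan n) 3 := fun z' hne => by
    have h1 := hρ.2 (subset_tsupport _ hne)
    rw [mem_closedBall_zero_iff] at h1 ⊢
    have h2 : ‖z'‖ ≤ ‖z‖ + ‖z - z'‖ := by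
      have := norm_sub_le z (z - z'); rwa [sub_sub_cancel] at this
    linarith
  rw [e1, e2, ← Real.norm_eq_abs]
  rw [e2] at hi
  refine (norm_integral_le_integral_norm _).trans ?_
  have e3 : ∫ p in Set.Ioc 0 y ×ˢ (Set.univ : Set (Tan n)), ‖F p.1 p.2 * ρ (z - p.2)‖
      = ∫ p in Set.Ioc 0 y ×ˢ Metric.closedBall (0 : Tan n) 3, ‖F p.1 p.2 * ρ (z - p.2)‖ := by
    refine (setIntegral_eq_of_subset_of_forall_sdiff_eq_zero
      (measurableSet_Ioc.prod MeasurableSet.univ)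
      (Set.prod_mono le_rfl (Set.subset_univ _)) fun p hp => ?_)
    have : ρ (z - p.2) = 0 := by
      by_contra hne
      exact hp.2 ⟨hp.1.1, hsupp _ hne⟩
    rw [this, mul_zero, norm_zero]
  rw [e3]
  have hsub : Set.Ioc 0 y ×ˢ Metric.closedBall (0 : Tan n) 3
      ⊆ Set.Ioc (0 : ℝ) 1 ×ˢ Metric.closedBall (0 : Tan n) 3 :=
    Set.prod_mono (Set.Ioc_subset_Ioc_right hy.2) le_rfl
  have hMi : IntegrableOn (fun p : ℝ × Tan n => M * ‖F p.1 p.2‖)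
      (Set.Ioc (0 : ℝ) 1 ×ˢ Metric.closedBall (0 : Tan n) 3) := h.norm.const_mul M
  refine (setIntegral_mono_on ((IntegrableOn.mono_set hi (Set.prod_mono le_rfl (Set.subset_univ _))).norm)
    (hMi.mono_set hsub) (measurableSet_Ioc.prod Metric.isClosed_closedBall.measurableSet)
    fun p _ => ?_).trans
    (setIntegral_mono_set hMi (Eventually.of_forall fun p => by positivity) hsub.eventuallyLE)
  rw [norm_mul, mul_comm]
  exact mul_le_mul_of_nonneg_right (hM _) (norm_nonneg _)

theorem continuous_conv_primY (hF : SlabIntegrable F) {ρ : Tan n → ℝ} (hρ : Continuous ρ)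
    (hc : HasCompactSupport ρ) (z : Tan n) : Continuous fun y => conv (primY F y) ρ z := by
  -- The primitive is zero for y ≤ 0, so truncating the upper limit at 0 extends continuity from the
  -- closed half-line to all y.
  have h1 : (fun y => conv (primY F y) ρ z)
      = fun y => ∫ t in (0 : ℝ)..(max 0 y), conv (F t) ρ z := by
    ext y
    rw [hF.conv_primY hρ hc z y, intervalIntegral.integral_of_le (le_max_left _ _)]
    rcases le_total y 0 with h | h
    · rw [max_eq_left h, Set.Ioc_eq_empty (not_lt.2 h), Set.Ioc_self]
    · rw [max_eq_right h]
  rw [h1]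
  exact (continuousOn_primitive_Ici fun b hb =>
    (intervalIntegrable_iff_integrableOn_Ioc_of_le hb).2
      (hF.integrableOn_conv hρ hc z b)).comp_continuous (by fun_prop) fun y =>
        Set.mem_Ici.2 (le_max_left _ _)

end SlabIntegrable

/-- The Cauchy-Schwarz inequality for a convolution. -/
theorem enorm_conv_sq_le {h ρ : Tan n → ℝ} (hh : Measurable h) (hρ : Measurable ρ) (z : Tan n) :
    ‖conv h ρ z‖ₑ ^ 2 ≤ (∫⁻ z', ‖h z'‖ₑ ^ 2 * ‖ρ (z - z')‖ₑ) * ∫⁻ z', ‖ρ (z - z')‖ₑ := by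
  have hm : Measurable fun z' => ρ (z - z') := hρ.comp (measurable_const.sub measurable_id)
  -- One factor |ρ| is split into two square roots, so that Hölder with p = q = 2 leaves a full
  -- power of |ρ| in each integral.
  have h1 : ‖conv h ρ z‖ₑ ≤ ∫⁻ z', (‖h z'‖ₑ * ‖ρ (z - z')‖ₑ ^ (1 / 2 : ℝ))
      * ‖ρ (z - z')‖ₑ ^ (1 / 2 : ℝ) := by
    refine (enorm_integral_le_lintegral_enorm _).trans (lintegral_mono fun z' => ?_)
    rw [enorm_mul, mul_assoc, ← ENNReal.rpow_add_of_nonneg _ _ (by norm_num) (by norm_num)]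
    norm_num
  have h2 := ENNReal.lintegral_mul_le_Lp_mul_Lq (volume : Measure (Tan n))
    (p := 2) (q := 2) (by rw [Real.holderConjugate_iff]; norm_num)
    (f := fun z' => ‖h z'‖ₑ * ‖ρ (z - z')‖ₑ ^ (1 / 2 : ℝ))
    (g := fun z' => ‖ρ (z - z')‖ₑ ^ (1 / 2 : ℝ))
    ((hh.enorm.mul (hm.enorm.pow_const _)).aemeasurable) (hm.enorm.pow_const _).aemeasurable
  have h3 := pow_le_pow_left₀ zero_le (h1.trans h2) 2
  refine h3.trans_eq ?_
  have e : ∀ x : ℝ≥0∞, (x ^ (1 / 2 : ℝ)) ^ 2 = x := fun x => by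
    rw [← ENNReal.rpow_natCast, ← ENNReal.rpow_mul]; norm_num
  have e' : ∀ x : ℝ≥0∞, (x ^ (1 / 2 : ℝ)) ^ (2 : ℝ) = x := fun x => by
    rw [← ENNReal.rpow_mul]; norm_num
  rw [mul_pow, e, e]
  congr 1
  · refine lintegral_congr fun z' => ?_
    rw [ENNReal.mul_rpow_of_nonneg _ _ (by norm_num), e']
    congr 1
    exact_mod_cast ENNReal.rpow_natCast ‖h z'‖ₑ 2
  · exact lintegral_congr fun z' => e' _

/-! ### Separation of the normal variable and tensor product test functions. -/

/-- The point with normal coordinate `y` and tangential coordinates `z`. -/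
def mkPt (y : ℝ) (z : Tan n) : Pt n := (z.1, y, z.2)

/-- The tangential coordinates of a point. -/
def tanPart (p : Pt n) : Tan n := (p.1, p.2.2)

/-- Separation of the normal variable. -/
def ptEquiv (n : ℕ) : ℝ × Tan n ≃ᵐ Pt n where
  toFun q := mkPt q.1 q.2
  invFun p := (p.2.1, tanPart p)
  left_inv _ := rfl
  right_inv _ := rfl
  measurable_toFun := by
    simp only [mkPt, Equiv.coe_fn_mk]
    fun_prop
  measurable_invFun := by
    simp only [tanPart, Equiv.coe_fn_symm_mk]
    fun_prop

theorem continuous_mkPt : Continuous fun q : ℝ × Tan n => mkPt q.1 q.2 := by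
  unfold mkPt; fun_prop

theorem measurePreserving_ptEquiv : MeasurePreserving (ptEquiv n) := by
  have h1 : MeasurePreserving (MeasurableEquiv.prodAssoc.symm :
      ℝ × EuclideanSpace ℝ (Fin n) × ℝ ≃ᵐ (ℝ × EuclideanSpace ℝ (Fin n)) × ℝ) :=
    (volume_preserving_prodAssoc).symm
  have h2 : MeasurePreserving (Prod.map Prod.swap id :
      (ℝ × EuclideanSpace ℝ (Fin n)) × ℝ → (EuclideanSpace ℝ (Fin n) × ℝ) × ℝ) :=
    (Measure.measurePreserving_swap (μ := (volume : Measure ℝ))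
      (ν := (volume : Measure (EuclideanSpace ℝ (Fin n))))).prod (MeasurePreserving.id volume)
  have h3 : MeasurePreserving (MeasurableEquiv.prodAssoc :
      (EuclideanSpace ℝ (Fin n) × ℝ) × ℝ ≃ᵐ EuclideanSpace ℝ (Fin n) × ℝ × ℝ) :=
    volume_preserving_prodAssoc
  exact h3.comp (h2.comp h1)

theorem measurableSet_openHalf : MeasurableSet (openHalf n) :=
  measurableSet_lt measurable_const (measurable_fst.comp measurable_snd)

theorem isOpen_openHalf : IsOpen (openHalf n) :=
  isOpen_lt continuous_const (continuous_fst.comp continuous_snd)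

theorem preimage_openHalf : ptEquiv n ⁻¹' openHalf n = Set.Ioi 0 ×ˢ Set.univ := by
  ext q; simp [ptEquiv, openHalf, mkPt]

theorem setLIntegral_openHalf {G : Pt n → ℝ≥0∞} (hG : Measurable G) :
    ∫⁻ p in openHalf n, G p = ∫⁻ y in Set.Ioi (0 : ℝ), ∫⁻ z, G (mkPt y z) := by
  rw [← measurePreserving_ptEquiv.setLIntegral_comp_preimage measurableSet_openHalf hG,
    preimage_openHalf, Measure.volume_eq_prod, ← Measure.prod_restrict, Measure.restrict_univ]
  exact lintegral_prod _ (hG.comp (ptEquiv n).measurable).aemeasurable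

theorem integrableOn_comp_ptEquiv {G : Pt n → ℝ} (hG : LocallyIntegrableOn G (openHalf n))
    {l : ℝ} (hl : 0 < l) (L R : ℝ) :
    IntegrableOn (fun q : ℝ × Tan n => G (mkPt q.1 q.2))
      (Set.Icc l L ×ˢ Metric.closedBall 0 R) := by
  have hK : IsCompact (ptEquiv n '' (Set.Icc l L ×ˢ Metric.closedBall 0 R)) :=
    (isCompact_Icc.prod (isCompact_closedBall _ _)).image continuous_mkPt
  have hsub : ptEquiv n '' (Set.Icc l L ×ˢ Metric.closedBall 0 R) ⊆ openHalf n := by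
    rintro _ ⟨q, hq, rfl⟩
    exact hl.trans_le hq.1.1
  exact (measurePreserving_ptEquiv.integrableOn_image (ptEquiv n).measurableEmbedding).1
    (hG.integrableOn_compact_subset hsub hK)

section TensorTest

variable {G : Pt n → ℝ} {χ : ℝ → ℝ} {σ : Tan n → ℝ}

theorem integrable_mul_tensor (hG : LocallyIntegrableOn G (openHalf n)) (hχ : Continuous χ)
    {l L : ℝ} (hl : 0 < l) (hs : Function.support χ ⊆ Set.Icc l L) (hσ : Continuous σ)
    (hc : HasCompactSupport σ) :
    Integrable (fun q : ℝ × Tan n => G (mkPt q.1 q.2) * σ q.2 * χ q.1) := by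
  obtain ⟨R, hR⟩ := hc.isBounded.subset_closedBall 0
  have h1 := integrableOn_comp_ptEquiv hG hl L R
  have hK : IsCompact (Set.Icc l L ×ˢ Metric.closedBall (0 : Tan n) R) :=
    isCompact_Icc.prod (isCompact_closedBall _ _)
  have h2 : IntegrableOn (fun q : ℝ × Tan n => G (mkPt q.1 q.2) * σ q.2 * χ q.1)
      (Set.Icc l L ×ˢ Metric.closedBall 0 R) := by
    have hc1 : Continuous fun q : ℝ × Tan n => σ q.2 := by fun_prop
    have hc2 : Continuous fun q : ℝ × Tan n => χ q.1 := by fun_prop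
    exact (h1.mul_continuousOn hc1.continuousOn hK).mul_continuousOn hc2.continuousOn hK
  refine h2.integrable_of_forall_notMem_eq_zero fun q hq => ?_
  by_contra hne
  refine hq ⟨hs (right_ne_zero_of_mul hne), hR (subset_tsupport _ ?_)⟩
  exact right_ne_zero_of_mul (left_ne_zero_of_mul hne)

theorem integrableOn_mul_tensor (hG : LocallyIntegrableOn G (openHalf n)) (hχ : IsTestIoi χ)
    (hσ : Continuous σ) (hc : HasCompactSupport σ) :
    IntegrableOn (fun p => G p * σ (tanPart p) * χ p.2.1) (openHalf n) := by
  obtain ⟨l, L, hl, -, hs⟩ := hχ.exists_Ioo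
  have := integrable_mul_tensor hG hχ.1.continuous hl
    ((subset_tsupport χ).trans (hs.trans Set.Ioo_subset_Icc_self)) hσ hc
  exact ((measurePreserving_ptEquiv.integrable_comp_emb
    (ptEquiv n).measurableEmbedding (g := fun p => G p * σ (tanPart p) * χ p.2.1)).1
    this).integrableOn

/-- Fubini for product test functions: an identity tested on the half-space becomes one on the
half-line for a tangential average. The support of `χ` stays away from y = 0, so local integrability
in the open half-space suffices. -/
theorem setIntegral_mul_tensor (hG : LocallyIntegrableOn G (openHalf n)) (hχ : IsTestIoi χ)
    (hσ : Continuous σ) (hc : HasCompactSupport σ) :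
    ∫ p in openHalf n, G p * σ (tanPart p) * χ p.2.1
      = ∫ y, (∫ z, G (mkPt y z) * σ z) * χ y := by
  obtain ⟨l, L, hl, -, hs⟩ := hχ.exists_Ioo
  have hi := integrable_mul_tensor hG hχ.1.continuous hl
    ((subset_tsupport χ).trans (hs.trans Set.Ioo_subset_Icc_self)) hσ hc
  rw [setIntegral_eq_integral_of_forall_compl_eq_zero]
  · rw [← measurePreserving_ptEquiv.integral_comp (ptEquiv n).measurableEmbedding]
    refine (integral_prod _ hi).trans (integral_congr_ae (Eventually.of_forall fun y => ?_))
    exact integral_mul_const (χ y) fun z => G (mkPt y z) * σ z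
  · intro p hp
    have : χ p.2.1 = 0 := image_eq_zero_of_notMem_tsupport fun h => hp (hχ.2.2 h)
    rw [this, mul_zero]

theorem locallyIntegrableOn_slice (hG : LocallyIntegrableOn G (openHalf n))
    (hσ : Continuous σ) (hc : HasCompactSupport σ) :
    LocallyIntegrableOn (fun y => ∫ z, G (mkPt y z) * σ z) (Set.Ioi 0) := by
  obtain ⟨R, hR⟩ := hc.isBounded.subset_closedBall 0
  intro y hy
  have hy0 : (0 : ℝ) < y := hy
  refine ⟨Set.Icc (y / 2) (y + 1), mem_nhdsWithin_of_mem_nhds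
    (Icc_mem_nhds (by linarith) (by linarith)), ?_⟩
  have h1 := integrableOn_comp_ptEquiv hG (half_pos hy0) (y + 1) R
  have hK : IsCompact (Set.Icc (y / 2) (y + 1) ×ˢ Metric.closedBall (0 : Tan n) R) :=
    isCompact_Icc.prod (isCompact_closedBall _ _)
  have hc1 : Continuous fun q : ℝ × Tan n => σ q.2 := by fun_prop
  have h2 := h1.mul_continuousOn hc1.continuousOn hK
  rw [IntegrableOn, Measure.volume_eq_prod, ← Measure.prod_restrict] at h2
  refine h2.integral_prod_left.congr (Eventually.of_forall fun t => ?_)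
  refine setIntegral_eq_integral_of_forall_compl_eq_zero fun z hz => ?_
  have : σ z = 0 := image_eq_zero_of_notMem_tsupport fun h => hz (hR h)
  simp [this]

/-- The tensor product test function `χ(y) σ(x, t)`. -/
def tensor (χ : ℝ → ℝ) (σ : Tan n → ℝ) (p : Pt n) : ℝ := χ p.2.1 * σ (tanPart p)

/-- The projection to the tangential variables as a continuous linear map. -/
noncomputable def tanPartL (n : ℕ) : Pt n →L[ℝ] Tan n :=
  (ContinuousLinearMap.fst ℝ _ _).prod
    ((ContinuousLinearMap.snd ℝ _ _).comp (ContinuousLinearMap.snd ℝ _ _))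

theorem fderiv_tensor (hχ : ContDiff ℝ ∞ χ) (hσ : ContDiff ℝ ∞ σ) (p v : Pt n) :
    fderiv ℝ (tensor χ σ) p v
      = deriv χ p.2.1 * v.2.1 * σ (tanPart p) + χ p.2.1 * pd (tanPart v) σ (tanPart p) := by
  have h1 : HasFDerivAt (fun p : Pt n => χ p.2.1) _ p :=
    ((hχ.differentiable (by simp)) p.2.1).hasDerivAt.hasFDerivAt.comp p
      ((ContinuousLinearMap.fst ℝ ℝ ℝ).comp
        (ContinuousLinearMap.snd ℝ (EuclideanSpace ℝ (Fin n)) (ℝ × ℝ))).hasFDerivAt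
  have h2 : HasFDerivAt (fun p : Pt n => σ (tanPart p)) _ p :=
    ((hσ.differentiable (by simp)) (tanPart p)).hasFDerivAt.comp p (tanPartL n).hasFDerivAt
  have h3 : HasFDerivAt (tensor χ σ) _ p := h1.mul h2
  rw [h3.fderiv]
  simp [pd, tanPartL, tanPart]
  ring

theorem isTest_tensor (hχ : IsTestIoi χ) (hσ : ContDiff ℝ ∞ σ) (hc : HasCompactSupport σ) :
    IsTest (tensor χ σ) := by
  have hsub : tsupport (tensor χ σ) ⊆ ptEquiv n '' (tsupport χ ×ˢ tsupport σ) := by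
    refine closure_minimal (fun p hp => ⟨(p.2.1, tanPart p), ⟨?_, ?_⟩, rfl⟩) ?_
    · exact subset_tsupport _ (left_ne_zero_of_mul hp)
    · exact subset_tsupport _ (right_ne_zero_of_mul hp)
    · exact ((hχ.2.1.isCompact.prod hc.isCompact).image continuous_mkPt).isClosed
  refine ⟨?_, ?_, ?_⟩
  · exact (hχ.1.comp (contDiff_fst.comp contDiff_snd)).mul (hσ.comp (tanPartL n).contDiff)
  · exact ((hχ.2.1.isCompact.prod hc.isCompact).image continuous_mkPt).of_isClosed_subset
      (isClosed_tsupport _) hsub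
  · refine hsub.trans ?_
    rintro _ ⟨q, hq, rfl⟩
    exact hχ.2.2 hq.1

end TensorTest

/-- Integration by parts on a slice `{y = const}`. -/
theorem integral_slice_mul {w D σ : Tan n → ℝ} {v : Tan n} (hw : Continuous w) (hD : Continuous D)
    (hwD : ∀ z, HasLineDerivAt ℝ w (D z) z v) (hσ : ContDiff ℝ ∞ σ) (hc : HasCompactSupport σ) :
    ∫ z, D z * σ z = - ∫ z, w z * pd v σ z := by
  have h1 : Integrable (fun z => D z * σ z) :=
    (hD.mul hσ.continuous).integrable_of_hasCompactSupport hc.mul_left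
  have h2 : Integrable (fun z => w z * pd v σ z) :=
    (hw.mul (contDiff_pd v hσ).continuous).integrable_of_hasCompactSupport
      (hasCompactSupport_pd v hc).mul_left
  have h3 : Integrable (fun z => w z * σ z) :=
    (hw.mul hσ.continuous).integrable_of_hasCompactSupport hc.mul_left
  have := integral_bilinear_hasLineDerivAt_right_eq_neg_left_of_integrable
    (μ := (volume : Measure (Tan n))) (f := w) (f' := D) (g := σ) (g' := pd v σ) (v := v)
    (B := ContinuousLinearMap.mul ℝ ℝ) h1 h2 h3 (fun z _ => hwD z)
    (fun z _ => ((hσ.differentiable (by simp)) z).hasFDerivAt.hasLineDerivAt v)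
  simp only [ContinuousLinearMap.mul_apply'] at this
  linarith

/-- The reflected translate of a mollifier. -/
def reflect (ρ : Tan n → ℝ) (z : Tan n) (z' : Tan n) : ℝ := ρ (z - z')

theorem contDiff_reflect {ρ : Tan n → ℝ} (hρ : ContDiff ℝ ∞ ρ) (z : Tan n) :
    ContDiff ℝ ∞ (reflect ρ z) := hρ.comp (contDiff_const.sub contDiff_id)

theorem hasCompactSupport_reflect {ρ : Tan n → ℝ} (hρ : HasCompactSupport ρ) (z : Tan n) :
    HasCompactSupport (reflect ρ z) := hρ.comp_homeomorph (Homeomorph.subLeft z)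

theorem pd_reflect {ρ : Tan n → ℝ} (hρ : ContDiff ℝ ∞ ρ) (v z z' : Tan n) :
    pd v (reflect ρ z) z' = - reflect (pd v ρ) z z' := by
  have h : HasFDerivAt (reflect ρ z) _ z' :=
    ((hρ.differentiable (by simp)) (z - z')).hasFDerivAt.comp z'
      ((hasFDerivAt_id z').const_sub z)
  rw [pd, h.fderiv]
  simp [reflect, pd]

/-! ### From a weak solution to its mollified family. -/

/-- The data of a compactly supported weak solution with measurable right-hand side. -/
structure WeakData (n : ℕ) (a : ℝ) (W Wy Wt f : Pt n → ℝ) (Wx : Fin n → Pt n → ℝ)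
    (g : Tan n → ℝ) : Prop where
  continuousOn : ContinuousOn W (closedHalf n)
  trace : ∀ p : Pt n, p.2.1 = 0 → W p = 0
  supp : closure (Function.support W ∩ closedHalf n) ⊆ halfBallCylinder n
  derivX : ∀ i, IsDerivContUpTo W (dirX i) (Wx i)
  derivT : IsDerivContUpTo W (dirT n) Wt
  derivY : IsWeakDerivY W Wy
  measurable_f : Measurable f
  f_lt_top : ∫⁻ p in openHalf n, ENNReal.ofReal (f p ^ 2 * p.2.1 ^ (-a)) < (⊤ : ℝ≥0∞)
  weakSol : IsWeakSol a Wx Wy Wt f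
  normalDeriv : IsWeightedNormalDeriv a Wy g

/-- The slices of `W`, extended by zero to `y ≤ 0`. -/
def slice (W : Pt n → ℝ) (y : ℝ) (z : Tan n) : ℝ := W (mkPt (max y 0) z)

/-- The weighted normal derivative of the mollified solution. -/
noncomputable def molFlux (a : ℝ) (W f : Pt n → ℝ) (g : Tan n → ℝ) (ρ : Tan n → ℝ) (y : ℝ)
    (z : Tan n) : ℝ :=
  conv (fun z => g z + primY (fun t z => f (mkPt t z)) y z) ρ z
    - conv (primY (fun t z => t ^ a * slice W t z) y) (heatOp ρ) z

theorem integrableOn_rpow_Ioc_zero {a : ℝ} (ha : -1 < a) (b : ℝ) :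
    IntegrableOn (fun y : ℝ => y ^ a) (Set.Ioc 0 b) := by
  rcases le_total 0 b with hb | hb
  · exact (intervalIntegrable_iff_integrableOn_Ioc_of_le hb).1
      (intervalIntegral.intervalIntegrable_rpow' ha)
  · rw [Set.Ioc_eq_empty (not_lt.2 hb)]; exact integrableOn_empty

theorem slabIntegrable_of_le_rpow {a M : ℝ} (ha : -1 < a) {F : ℝ → Tan n → ℝ}
    (hm : Measurable fun q : ℝ × Tan n => F q.1 q.2)
    (h : ∀ y z, 0 < y → |F y z| ≤ M * y ^ a) : SlabIntegrable F := by
  intro b R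
  have hfin : IsFiniteMeasure ((volume : Measure (Tan n)).restrict (Metric.closedBall 0 R)) := ⟨by
    rw [Measure.restrict_apply_univ]; exact (isCompact_closedBall _ _).measure_lt_top⟩
  have h1 : Integrable (fun q : ℝ × Tan n => M * q.1 ^ a) ((volume.restrict (Set.Ioc 0 b)).prod
      (volume.restrict (Metric.closedBall 0 R))) :=
    ((integrableOn_rpow_Ioc_zero ha b).const_mul M).comp_fst _
  rw [Measure.prod_restrict] at h1
  refine Integrable.mono' h1 hm.aestronglyMeasurable ?_
  filter_upwards [ae_restrict_mem (measurableSet_Ioc.prod Metric.isClosed_closedBall.measurableSet)]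
    with q hq using h q.1 q.2 hq.1.1

namespace WeakData

variable {a : ℝ} {W Wy Wt f : Pt n → ℝ} {Wx : Fin n → Pt n → ℝ} {g : Tan n → ℝ}

theorem slice_of_pos {y : ℝ} (hy : 0 < y) (z : Tan n) : slice W y z = W (mkPt y z) := by
  rw [slice, max_eq_left hy.le]

theorem continuous_slice (h : WeakData n a W Wy Wt f Wx g) :
    Continuous fun q : ℝ × Tan n => slice W q.1 q.2 := by
  refine h.continuousOn.comp_continuous (f := fun q : ℝ × Tan n => mkPt (max q.1 0) q.2) ?_
    fun q => ?_
  · unfold mkPt; fun_prop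
  · exact (le_max_right q.1 0 : (0 : ℝ) ≤ max q.1 0)

theorem slice_of_nonpos (h : WeakData n a W Wy Wt f Wx g) {y : ℝ} (hy : y ≤ 0) (z : Tan n) :
    slice W y z = 0 := by
  rw [slice, max_eq_right hy]; exact h.trace _ rfl

theorem slice_ne_zero (h : WeakData n a W Wy Wt f Wx g) {y : ℝ} {z : Tan n}
    (hne : slice W y z ≠ 0) : 0 < y ∧ y ≤ 1 / 2 ∧ ‖z.1‖ ≤ 1 / 2 ∧ |z.2| ≤ 1 := by
  have hy : 0 < y := by
    by_contra hcon
    exact hne (h.slice_of_nonpos (not_lt.1 hcon) z)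
  rw [slice_of_pos hy] at hne
  have hmem : mkPt y z ∈ halfBallCylinder n := h.supp (subset_closure ⟨hne, hy.le⟩)
  obtain ⟨h1, -, h3, h4⟩ := hmem
  simp only [mkPt] at h1 h3 h4
  refine ⟨hy, ?_, ?_, ?_⟩
  · nlinarith [sq_nonneg ‖z.1‖]
  · nlinarith [sq_nonneg y]
  · rw [abs_of_pos h3]; exact h4.le

theorem continuous_slice_right (h : WeakData n a W Wy Wt f Wx g) (y : ℝ) :
    Continuous (slice W y) := h.continuous_slice.comp (by fun_prop : Continuous fun z => (y, z))

theorem locallyIntegrable_slice (h : WeakData n a W Wy Wt f Wx g) (y : ℝ) :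
    LocallyIntegrable (slice W y) := (h.continuous_slice_right y).locallyIntegrable

theorem exists_bound_slice (h : WeakData n a W Wy Wt f Wx g) : ∃ M, ∀ y z, |slice W y z| ≤ M := by
  have hK : IsCompact (Set.Icc (0 : ℝ) (1 / 2) ×ˢ Metric.closedBall (0 : Tan n) 1) :=
    isCompact_Icc.prod (isCompact_closedBall _ _)
  have hs : HasCompactSupport fun q : ℝ × Tan n => slice W q.1 q.2 := by
    refine HasCompactSupport.intro hK fun q hq => ?_
    by_contra hne
    obtain ⟨h1, h2, h3, h4⟩ := h.slice_ne_zero hne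
    refine hq ⟨⟨h1.le, h2⟩, ?_⟩
    rw [mem_closedBall_zero_iff, Prod.norm_def]
    exact max_le (by linarith) h4
  obtain ⟨M, hM⟩ := h.continuous_slice.bounded_above_of_compact_support hs
  exact ⟨M, fun y z => hM (y, z)⟩

theorem slab_slice (h : WeakData n a W Wy Wt f Wx g) (ha : -1 < a) :
    SlabIntegrable fun t z => t ^ a * slice W t z := by
  obtain ⟨M, hM⟩ := h.exists_bound_slice
  refine slabIntegrable_of_le_rpow (M := M) ha ?_ fun y z hy => ?_
  · have := h.continuous_slice.measurable
    exact (measurable_fst.pow_const a).mul this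
  · rw [abs_mul, abs_of_nonneg (Real.rpow_nonneg hy.le _), mul_comm]
    exact mul_le_mul_of_nonneg_right (hM y z) (Real.rpow_nonneg hy.le _)

theorem measurable_f_comp_mkPt (h : WeakData n a W Wy Wt f Wx g) :
    Measurable fun q : ℝ × Tan n => f (mkPt q.1 q.2) :=
  h.measurable_f.comp continuous_mkPt.measurable

theorem integrableOn_sq (h : WeakData n a W Wy Wt f Wx g) :
    IntegrableOn (fun p : Pt n => f p ^ 2 * p.2.1 ^ (-a)) (openHalf n) := by
  refine ⟨?_, ?_⟩
  · have := h.measurable_f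
    exact (by fun_prop : Measurable fun p : Pt n => f p ^ 2 * p.2.1 ^ (-a)).aestronglyMeasurable
  · refine lt_of_le_of_lt (setLIntegral_mono' measurableSet_openHalf fun p hp => ?_) h.f_lt_top
    have : 0 ≤ f p ^ 2 * p.2.1 ^ (-a) := mul_nonneg (sq_nonneg _) (Real.rpow_nonneg (le_of_lt hp) _)
    rw [← ofReal_norm, Real.norm_eq_abs, abs_of_nonneg this]

/-- Since |f| ≤ f² y^{-a} + y^a, the finite weighted norm together with a > -1 makes f integrable up
to y = 0 on bounded slabs. -/
theorem slab_f (h : WeakData n a W Wy Wt f Wx g) (ha : -1 < a) :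
    SlabIntegrable fun t z => f (mkPt t z) := by
  intro b R
  have hfin : IsFiniteMeasure ((volume : Measure (Tan n)).restrict (Metric.closedBall 0 R)) := ⟨by
    rw [Measure.restrict_apply_univ]; exact (isCompact_closedBall _ _).measure_lt_top⟩
  have h1 : Integrable (fun q : ℝ × Tan n => q.1 ^ a) ((volume.restrict (Set.Ioc 0 b)).prod
      (volume.restrict (Metric.closedBall 0 R))) := Integrable.comp_fst (integrableOn_rpow_Ioc_zero ha b) _
  rw [Measure.prod_restrict] at h1
  have h2 : IntegrableOn (fun q : ℝ × Tan n => f (mkPt q.1 q.2) ^ 2 * q.1 ^ (-a))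
      (ptEquiv n ⁻¹' openHalf n) :=
    (measurePreserving_ptEquiv.integrableOn_comp_preimage
      (ptEquiv n).measurableEmbedding).2 h.integrableOn_sq
  rw [preimage_openHalf] at h2
  have h3 := h2.mono_set (Set.prod_mono (fun x hx => hx.1 : Set.Ioc 0 b ⊆ Set.Ioi 0)
    (Set.subset_univ (Metric.closedBall (0 : Tan n) R)))
  refine Integrable.mono' (Integrable.add h3 h1) h.measurable_f_comp_mkPt.aestronglyMeasurable ?_
  filter_upwards [ae_restrict_mem (measurableSet_Ioc.prod Metric.isClosed_closedBall.measurableSet)]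
    with q hq
  have hq0 : 0 < q.1 := hq.1.1
  have hY : 0 < q.1 ^ a := Real.rpow_pos_of_pos hq0 a
  rw [Real.norm_eq_abs, Pi.add_apply, Real.rpow_neg hq0.le, ← div_eq_mul_inv]
  set x := f (mkPt q.1 q.2)
  set Y := q.1 ^ a
  have h5 : |x| * Y ≤ x ^ 2 + Y ^ 2 := by nlinarith [sq_nonneg (|x| - Y), sq_abs x, abs_nonneg x]
  calc |x| = |x| * Y / Y := by field_simp
    _ ≤ (x ^ 2 + Y ^ 2) / Y := div_le_div_of_nonneg_right h5 hY.le
    _ = x ^ 2 / Y + Y := by field_simp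

theorem locallyIntegrableOn_f (h : WeakData n a W Wy Wt f Wx g) (ha : -1 < a) :
    LocallyIntegrableOn f (openHalf n) := by
  have h0 : ∀ b R : ℝ, IntegrableOn f (ptEquiv n '' (Set.Ioc 0 b ×ˢ Metric.closedBall 0 R)) :=
    fun b R => (measurePreserving_ptEquiv.integrableOn_image
      (ptEquiv n).measurableEmbedding).2 (h.slab_f ha b R)
  intro p hp
  have hp0 : 0 < p.2.1 := hp
  refine ⟨_, ?_, h0 (p.2.1 + 1) (‖tanPart p‖ + 1)⟩
  refine mem_nhdsWithin_of_mem_nhds ?_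
  have hc : Continuous fun p : Pt n => (p.2.1, tanPart p) := by unfold tanPart; fun_prop
  have hmem : Set.Ioo 0 (p.2.1 + 1) ×ˢ Metric.ball (tanPart p) 1 ∈ 𝓝 (p.2.1, tanPart p) :=
    prod_mem_nhds (Ioo_mem_nhds hp0 (by linarith)) (Metric.ball_mem_nhds _ one_pos)
  refine mem_of_superset (hc.continuousAt.preimage_mem_nhds hmem) fun x hx => ?_
  refine ⟨(x.2.1, tanPart x), ⟨⟨hx.1.1, hx.1.2.le⟩, ?_⟩, rfl⟩
  have h1 : ‖tanPart x - tanPart p‖ < 1 := by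
    have := hx.2; rwa [mem_ball_iff_norm] at this
  rw [mem_closedBall_zero_iff]
  linarith [norm_sub_norm_le (tanPart x) (tanPart p)]

theorem heatOp_slice (h : WeakData n a W Wy Wt f Wx g) {ρ : Tan n → ℝ} (hρ : IsMoll ρ) (t : ℝ)
    (z : Tan n) : conv (fun z => t ^ a * slice W t z) (heatOp ρ) z
      = t ^ a * (conv (slice W t) (pd (tanT n) ρ) z
        + ∑ i, conv (slice W t) (pd (tanX i) (pd (tanX i) ρ)) z) := by
  rw [← conv_heatOp (h.locallyIntegrable_slice t) hρ]
  simp only [conv, mul_assoc]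
  exact integral_const_mul _ _

theorem integrable_rhs (h : WeakData n a W Wy Wt f Wx g) (ha : -1 < a) {ρ : Tan n → ℝ}
    (hρ : IsMoll ρ) (z : Tan n) {b : ℝ} (hb : 0 ≤ b) :
    IntervalIntegrable (fun t => conv (fun z => f (mkPt t z)) ρ z
      - t ^ a * (conv (slice W t) (pd (tanT n) ρ) z
        + ∑ i, conv (slice W t) (pd (tanX i) (pd (tanX i) ρ)) z)) volume 0 b := by
  rw [intervalIntegrable_iff_integrableOn_Ioc_of_le hb]
  simp only [← h.heatOp_slice hρ]
  exact ((h.slab_f ha).integrableOn_conv hρ.1.continuous hρ.hasCompactSupport z b).sub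
    ((h.slab_slice ha).integrableOn_conv hρ.heatOp.1.continuous hρ.heatOp.hasCompactSupport z b)

theorem molFlux_eq (h : WeakData n a W Wy Wt f Wx g) (ha : -1 < a) {ρ : Tan n → ℝ}
    (hρ : IsMoll ρ) (z : Tan n) {y : ℝ} (hy : 0 ≤ y) :
    molFlux a W f g ρ y z = conv g ρ z + ∫ t in (0 : ℝ)..y, (conv (fun z => f (mkPt t z)) ρ z
      - t ^ a * (conv (slice W t) (pd (tanT n) ρ) z
        + ∑ i, conv (slice W t) (pd (tanX i) (pd (tanX i) ρ)) z)) := by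
  rw [molFlux, conv_add_left h.normalDeriv.1 ((h.slab_f ha).locallyIntegrable y) hρ.1.continuous
    hρ.hasCompactSupport, (h.slab_f ha).conv_primY hρ.1.continuous hρ.hasCompactSupport,
    (h.slab_slice ha).conv_primY hρ.heatOp.1.continuous hρ.heatOp.hasCompactSupport,
    intervalIntegral.integral_of_le hy, add_sub_assoc,
    ← integral_sub ((h.slab_f ha).integrableOn_conv hρ.1.continuous hρ.hasCompactSupport z y)
      ((h.slab_slice ha).integrableOn_conv hρ.heatOp.1.continuous hρ.heatOp.hasCompactSupport z y)]
  simp only [h.heatOp_slice hρ]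

theorem continuous_conv_slice (h : WeakData n a W Wy Wt f Wx g) {ρ : Tan n → ℝ} (hρ : IsMoll ρ)
    (z : Tan n) : Continuous fun y => conv (slice W y) ρ z := by
  have hc : Continuous (Function.uncurry fun (y : ℝ) (z' : Tan n) => slice W y z' * ρ (z - z')) :=
    h.continuous_slice.mul (hρ.1.continuous.comp (by fun_prop))
  have h1 := continuous_parametric_integral_of_continuous (μ := (volume : Measure (Tan n))) hc
    (isCompact_closedBall (0 : Tan n) 1)
  refine h1.congr fun y => ?_
  refine setIntegral_eq_integral_of_forall_compl_eq_zero fun z' hz' => ?_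
  have : slice W y z' = 0 := by
    by_contra hne
    obtain ⟨-, -, h3, h4⟩ := h.slice_ne_zero hne
    refine hz' ?_
    rw [mem_closedBall_zero_iff, Prod.norm_def]
    exact max_le (by linarith) h4
  rw [this, zero_mul]

theorem conv_slice_eq_zero (h : WeakData n a W Wy Wt f Wx g) {ρ : Tan n → ℝ} (hρ : IsMoll ρ)
    {y : ℝ} {z : Tan n} (hz : y ≤ 1 / 2 → z ∉ tanBox n) : conv (slice W y) ρ z = 0 := by
  refine integral_eq_zero_of_ae (Eventually.of_forall fun z' => ?_)
  by_contra hne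
  obtain ⟨h1, h2, h3, h4⟩ := h.slice_ne_zero (left_ne_zero_of_mul hne)
  have h5 := hρ.2 (subset_tsupport _ (right_ne_zero_of_mul hne))
  rw [mem_closedBall_zero_iff, Prod.norm_def, max_le_iff] at h5
  refine hz h2 ⟨?_, ?_⟩
  · rw [mem_closedBall_zero_iff]
    have := norm_add_le (z.1 - z'.1) z'.1
    rw [sub_add_cancel] at this
    have h6 : ‖z.1 - z'.1‖ ≤ 1 / 2 := h5.1
    linarith
  · rw [mem_closedBall_zero_iff]
    have := norm_add_le (z.2 - z'.2) z'.2
    rw [sub_add_cancel] at this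
    have h6 : ‖z.2 - z'.2‖ ≤ 1 / 2 := h5.2
    rw [Real.norm_eq_abs z'.2] at this
    linarith

theorem openHalf_subset : openHalf n ⊆ closedHalf n := fun p hp => (le_of_lt hp : (0 : ℝ) ≤ p.2.1)

theorem integral_deriv_slice (h : WeakData n a W Wy Wt f Wx g) {v : Pt n} (hv : v.2.1 = 0)
    {D : Pt n → ℝ} (hD : IsDerivContUpTo W v D) {σ : Tan n → ℝ} (hσ : ContDiff ℝ ∞ σ)
    (hc : HasCompactSupport σ) {y : ℝ} (hy : 0 < y) :
    ∫ z, D (mkPt y z) * σ z = - ∫ z, slice W y z * pd (tanPart v) σ z := by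
  refine integral_slice_mul (h.continuous_slice_right y) ?_ (fun z => ?_) hσ hc
  · refine hD.2.comp_continuous (f := fun z : Tan n => mkPt y z) ?_ fun z => ?_
    · unfold mkPt; fun_prop
    · exact (hy.le : (0 : ℝ) ≤ y)
  · have h1 := hD.1 (mkPt y z) hy
    rw [hasLineDerivAt_iff_isLittleO_nhds_zero] at h1 ⊢
    have e : ∀ t : ℝ, mkPt y z + t • v = mkPt y (z + t • tanPart v) := fun t => by
      simp [mkPt, tanPart, Prod.ext_iff, hv]
    simpa only [e, slice_of_pos hy] using h1

/-- The test function is χ(y)ρ(z - z') in the variables (y, z'); integrating out z' turns the weak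
y-derivative into a one-dimensional one. -/
theorem weak_ode_fst (h : WeakData n a W Wy Wt f Wx g) {ρ : Tan n → ℝ} (hρ : IsMoll ρ)
    (z : Tan n) {χ : ℝ → ℝ} (hχ : IsTestIoi χ) :
    ∫ y, conv (slice W y) ρ z * deriv χ y
      = - ∫ y, (∫ z', Wy (mkPt y z') * reflect ρ z z') * χ y := by
  have hσ := contDiff_reflect hρ.1 z
  have hc := hasCompactSupport_reflect hρ.hasCompactSupport z
  have hW : LocallyIntegrableOn W (openHalf n) :=
    (h.continuousOn.mono openHalf_subset).locallyIntegrableOn measurableSet_openHalf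
  have h1 := h.derivY.2 _ (isTest_tensor hχ hσ hc)
  have e1 : ∀ p, W p * fderiv ℝ (tensor χ (reflect ρ z)) p (dirY n)
      = W p * reflect ρ z (tanPart p) * deriv χ p.2.1 := fun p => by
    have : tanPart (dirY n) = 0 := rfl
    rw [fderiv_tensor hχ.1 hσ, this]
    simp [pd, dirY]
    ring
  have e2 : ∀ p, Wy p * tensor χ (reflect ρ z) p
      = Wy p * reflect ρ z (tanPart p) * χ p.2.1 := fun p => by
    rw [tensor]; ring
  simp only [e1, e2] at h1
  rw [setIntegral_mul_tensor hW hχ.deriv hσ.continuous hc,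
    setIntegral_mul_tensor h.derivY.1 hχ hσ.continuous hc] at h1
  rw [← h1]
  refine integral_congr_ae (Eventually.of_forall fun y => ?_)
  rcases le_or_gt y 0 with hy | hy
  · have : deriv χ y = 0 :=
      image_eq_zero_of_notMem_tsupport fun h' => not_lt.2 hy (hχ.deriv.2.2 h')
    simp [this]
  · simp only [conv, slice_of_pos hy, reflect]

theorem locallyIntegrableOn_rpow_mul {G : Pt n → ℝ} (hG : LocallyIntegrableOn G (openHalf n)) :
    LocallyIntegrableOn (fun p => p.2.1 ^ a * G p) (openHalf n) := by
  refine hG.continuousOn_mul (fun p hp => ?_) isOpen_openHalf.isLocallyClosed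
  have hp0 : 0 < p.2.1 := hp
  exact ((continuous_fst.comp continuous_snd).continuousAt.rpow_const
    (Or.inl hp0.ne')).continuousWithinAt

/-- The same product test function is inserted in the weak equation. Tangential derivatives are
moved onto the mollifier, so only an ODE in y for the averaged flux remains. -/
theorem weak_ode_snd (h : WeakData n a W Wy Wt f Wx g) (ha : -1 < a) {ρ : Tan n → ℝ}
    (hρ : IsMoll ρ) (z : Tan n) {χ : ℝ → ℝ} (hχ : IsTestIoi χ) :
    ∫ y, (y ^ a * ∫ z', Wy (mkPt y z') * reflect ρ z z') * deriv χ y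
      = - ∫ y, (conv (fun z => f (mkPt y z)) ρ z
        - y ^ a * (conv (slice W y) (pd (tanT n) ρ) z
          + ∑ i, conv (slice W y) (pd (tanX i) (pd (tanX i) ρ)) z)) * χ y := by
  have hσ := contDiff_reflect hρ.1 z
  have hc := hasCompactSupport_reflect hρ.hasCompactSupport z
  have hcont : ∀ {D : Pt n → ℝ}, ContinuousOn D (closedHalf n) →
      LocallyIntegrableOn D (openHalf n) := fun hD =>
    (hD.mono openHalf_subset).locallyIntegrableOn measurableSet_openHalf
  have hGx := fun i => locallyIntegrableOn_rpow_mul (a := a) (hcont (h.derivX i).2)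
  have hGt := locallyIntegrableOn_rpow_mul (a := a) (hcont h.derivT.2)
  have hGy := locallyIntegrableOn_rpow_mul (a := a) h.derivY.1
  have hf := h.locallyIntegrableOn_f ha
  have h1 := h.weakSol _ (isTest_tensor hχ hσ hc)
  have hσx := fun i => contDiff_pd (tanX i) hσ
  have hcx := fun i => hasCompactSupport_pd (tanX i) hc
  have e1 : ∀ p : Pt n, p.2.1 ^ a *
        ((∑ i, Wx i p * fderiv ℝ (tensor χ (reflect ρ z)) p (dirX i))
          + Wy p * fderiv ℝ (tensor χ (reflect ρ z)) p (dirY n)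
          - Wt p * tensor χ (reflect ρ z) p)
      = (∑ i, p.2.1 ^ a * Wx i p * pd (tanX i) (reflect ρ z) (tanPart p) * χ p.2.1)
        + p.2.1 ^ a * Wy p * reflect ρ z (tanPart p) * deriv χ p.2.1
        - p.2.1 ^ a * Wt p * reflect ρ z (tanPart p) * χ p.2.1 := fun p => by
    have hX : ∀ i, fderiv ℝ (tensor χ (reflect ρ z)) p (dirX i)
        = χ p.2.1 * pd (tanX i) (reflect ρ z) (tanPart p) := fun i => by
      have : tanPart (dirX i) = tanX i := rfl
      rw [fderiv_tensor hχ.1 hσ, this]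
      simp [dirX]
    have hY : fderiv ℝ (tensor χ (reflect ρ z)) p (dirY n)
        = deriv χ p.2.1 * reflect ρ z (tanPart p) := by
      have : tanPart (dirY n) = 0 := rfl
      rw [fderiv_tensor hχ.1 hσ, this]
      simp [pd, dirY]
    simp only [hX, hY, mul_add, mul_sub, Finset.mul_sum, tensor]
    congr 1
    · congr 1
      · exact Finset.sum_congr rfl fun i _ => by ring
      · ring
    · ring
  have e2 : ∀ p, f p * tensor χ (reflect ρ z) p
      = f p * reflect ρ z (tanPart p) * χ p.2.1 := fun p => by
    rw [tensor]; ring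
  simp only [e1, e2] at h1
  have iX : IntegrableOn (fun p : Pt n =>
      ∑ i, p.2.1 ^ a * Wx i p * pd (tanX i) (reflect ρ z) (tanPart p) * χ p.2.1) (openHalf n) :=
    integrable_finsetSum _ fun i _ =>
      integrableOn_mul_tensor (hGx i) hχ (hσx i).continuous (hcx i)
  have iY := integrableOn_mul_tensor hGy hχ.deriv hσ.continuous hc
  have iXY : IntegrableOn (fun p : Pt n =>
      (∑ i, p.2.1 ^ a * Wx i p * pd (tanX i) (reflect ρ z) (tanPart p) * χ p.2.1)
        + p.2.1 ^ a * Wy p * reflect ρ z (tanPart p) * deriv χ p.2.1) (openHalf n) := iX.add iY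
  rw [integral_sub iXY (integrableOn_mul_tensor hGt hχ hσ.continuous hc), integral_add iX iY,
    integral_finsetSum _ fun i _ =>
      integrableOn_mul_tensor (hGx i) hχ (hσx i).continuous (hcx i),
    setIntegral_mul_tensor hGy hχ.deriv hσ.continuous hc,
    setIntegral_mul_tensor hGt hχ hσ.continuous hc,
    setIntegral_mul_tensor hf hχ hσ.continuous hc] at h1
  simp only [fun i => setIntegral_mul_tensor (hGx i) hχ (hσx i).continuous (hcx i)] at h1
  have hχ0 : ∀ y, y ≤ 0 → χ y = 0 := fun y hy =>
    image_eq_zero_of_notMem_tsupport fun h' => not_lt.2 hy (hχ.2.2 h')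
  -- The test function already carries one x-derivative, so one integration by parts on the slice
  -- gives the second. The two signs from reflection cancel, and the sign of the integration by
  -- parts stays.
  have ex : ∀ i, ∫ y, (∫ z', (mkPt y z').2.1 ^ a * Wx i (mkPt y z')
        * pd (tanX i) (reflect ρ z) z') * χ y
      = - ∫ y, (y ^ a * conv (slice W y) (pd (tanX i) (pd (tanX i) ρ)) z) * χ y := fun i => by
    rw [← integral_neg]
    refine integral_congr_ae (Eventually.of_forall fun y => ?_)
    rcases le_or_gt y 0 with hy | hy
    · simp [hχ0 y hy]
    · have h2 := h.integral_deriv_slice (v := dirX i) rfl (h.derivX i) (hσx i) (hcx i) hy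
      have h3 : ∀ z', pd (tanX i) (pd (tanX i) (reflect ρ z)) z'
          = reflect (pd (tanX i) (pd (tanX i) ρ)) z z' := fun z' => by
        have e : pd (tanX i) (reflect ρ z) = fun z' => - reflect (pd (tanX i) ρ) z z' :=
          funext fun z' => pd_reflect hρ.1 _ _ _
        have e3 : pd (tanX i) (fun z' => - reflect (pd (tanX i) ρ) z z') z'
            = - pd (tanX i) (reflect (pd (tanX i) ρ) z) z' := by
          simp only [pd]
          rw [fderiv_fun_neg]
          rfl
        rw [e, e3, pd_reflect (contDiff_pd _ hρ.1), neg_neg]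
      have h4 : tanPart (dirX i) = tanX i := rfl
      rw [h4] at h2
      simp only [h3, reflect] at h2
      simp only [mkPt, mul_assoc, integral_const_mul]
      simp only [mkPt] at h2
      rw [h2, conv]
      ring
  -- Here the single reflection sign cancels the sign of the integration by parts.
  have et : ∫ y, (∫ z', (mkPt y z').2.1 ^ a * Wt (mkPt y z') * reflect ρ z z') * χ y
      = ∫ y, (y ^ a * conv (slice W y) (pd (tanT n) ρ) z) * χ y := by
    refine integral_congr_ae (Eventually.of_forall fun y => ?_)
    rcases le_or_gt y 0 with hy | hy
    · simp [hχ0 y hy]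
    · have h2 := h.integral_deriv_slice (v := dirT n) rfl h.derivT hσ hc hy
      have h4 : tanPart (dirT n) = tanT n := rfl
      rw [h4] at h2
      simp only [pd_reflect hρ.1, mul_neg, integral_neg, neg_neg] at h2
      simp only [mkPt, mul_assoc, integral_const_mul]
      simp only [mkPt] at h2
      rw [h2, conv]
      simp only [reflect]
  have ey : ∫ y, (∫ z', (mkPt y z').2.1 ^ a * Wy (mkPt y z') * reflect ρ z z') * deriv χ y
      = ∫ y, (y ^ a * ∫ z', Wy (mkPt y z') * reflect ρ z z') * deriv χ y := by
    refine integral_congr_ae (Eventually.of_forall fun y => ?_)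
    simp only [mkPt, mul_assoc, integral_const_mul]
  have hconv : ∀ {τ : Tan n → ℝ}, IsMoll τ →
      Integrable fun y => (y ^ a * conv (slice W y) τ z) * χ y := fun {τ} hτ => by
    refine hχ.integrable_mul (ContinuousOn.locallyIntegrableOn (fun y hy => ?_) measurableSet_Ioi)
    exact ((Real.continuousAt_rpow_const y a (Or.inl (ne_of_gt hy))).mul
      (h.continuous_conv_slice hτ z).continuousAt).continuousWithinAt
  have hfi : Integrable fun y => conv (fun z => f (mkPt y z)) ρ z * χ y :=
    hχ.integrable_mul (locallyIntegrableOn_slice hf hσ.continuous hc)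
  rw [et, ey] at h1
  simp only [ex] at h1
  have e5 : ∀ y, (conv (fun z => f (mkPt y z)) ρ z
        - y ^ a * (conv (slice W y) (pd (tanT n) ρ) z
          + ∑ i, conv (slice W y) (pd (tanX i) (pd (tanX i) ρ)) z)) * χ y
      = conv (fun z => f (mkPt y z)) ρ z * χ y
        - ((y ^ a * conv (slice W y) (pd (tanT n) ρ) z) * χ y
          + ∑ i, (y ^ a * conv (slice W y) (pd (tanX i) (pd (tanX i) ρ)) z) * χ y) := fun y => by
    rw [← Finset.sum_mul, ← Finset.mul_sum]; ring
  have hs : Integrable fun y =>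
      ∑ i, (y ^ a * conv (slice W y) (pd (tanX i) (pd (tanX i) ρ)) z) * χ y :=
    integrable_finsetSum _ fun i _ => hconv ((hρ.pd (tanX i)).pd (tanX i))
  simp only [e5]
  have hts : Integrable fun y => (y ^ a * conv (slice W y) (pd (tanT n) ρ) z) * χ y
      + ∑ i, (y ^ a * conv (slice W y) (pd (tanX i) (pd (tanX i) ρ)) z) * χ y :=
    (hconv (hρ.pd (tanT n))).add hs
  rw [integral_sub hfi hts, integral_add (hconv (hρ.pd _)) hs,
    integral_finsetSum _ fun i _ => hconv ((hρ.pd (tanX i)).pd (tanX i))]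
  rw [Finset.sum_neg_distrib] at h1
  have e6 : ∫ y, (∫ z', f (mkPt y z') * reflect ρ z z') * χ y
      = ∫ y, conv (fun z => f (mkPt y z)) ρ z * χ y := rfl
  rw [e6] at h1
  linarith

/-- The reflected mollifier is a legitimate test function in the definition of the weighted normal
derivative, which therefore provides the initial value (g⋆ρ)(z) of the ODE. -/
theorem hasDerivAt_conv_slice (h : WeakData n a W Wy Wt f Wx g) (ha : -1 < a) (ha0 : a ≤ 0)
    {ρ : Tan n → ℝ} (hρ : IsMoll ρ) (z : Tan n) {y : ℝ} (hy : 0 < y) :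
    HasDerivAt (fun y => conv (slice W y) ρ z) (y ^ (-a) * molFlux a W f g ρ y z) y := by
  have hσ := contDiff_reflect hρ.1 z
  have hc := hasCompactSupport_reflect hρ.hasCompactSupport z
  rw [h.molFlux_eq ha hρ z hy.le]
  refine hasDerivAt_of_weak_ode ha0 (h.continuous_conv_slice hρ z).continuousOn
    (locallyIntegrableOn_slice h.derivY.1 hσ.continuous hc)
    (fun b hb => h.integrable_rhs ha hρ z hb) (fun χ hχ => h.weak_ode_fst hρ z hχ)
    (fun χ hχ => h.weak_ode_snd ha hρ z hχ) ?_ hy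
  have h1 := h.normalDeriv.2 _ hσ hc
  simp only [mul_assoc, integral_const_mul] at h1
  exact h1

theorem locallyIntegrable_flux (h : WeakData n a W Wy Wt f Wx g) (ha : -1 < a) (y : ℝ) :
    LocallyIntegrable fun z => g z + primY (fun t z => f (mkPt t z)) y z :=
  h.normalDeriv.1.add ((h.slab_f ha).locallyIntegrable y)

theorem contDiff_molFlux (h : WeakData n a W Wy Wt f Wx g) (ha : -1 < a) {ρ : Tan n → ℝ}
    (hρ : IsMoll ρ) (y : ℝ) : ContDiff ℝ ∞ (molFlux a W f g ρ y) :=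
  (contDiff_conv (h.locallyIntegrable_flux ha y) hρ.1 hρ.hasCompactSupport).sub
    (contDiff_conv ((h.slab_slice ha).locallyIntegrable y) hρ.heatOp.1 hρ.heatOp.hasCompactSupport)

theorem pd_molFlux (h : WeakData n a W Wy Wt f Wx g) (ha : -1 < a) {ρ : Tan n → ℝ}
    (hρ : IsMoll ρ) (v : Tan n) (y : ℝ) :
    pd v (molFlux a W f g ρ y) = molFlux a W f g (pd v ρ) y := by
  have h1 := contDiff_conv (h.locallyIntegrable_flux ha y) hρ.1 hρ.hasCompactSupport
  have h2 := contDiff_conv ((h.slab_slice ha).locallyIntegrable y) hρ.heatOp.1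
    hρ.heatOp.hasCompactSupport
  have e1 := pd_conv (h.locallyIntegrable_flux ha y) hρ.1 hρ.hasCompactSupport v
  have e2 := pd_conv ((h.slab_slice ha).locallyIntegrable y) hρ.heatOp.1
    hρ.heatOp.hasCompactSupport v
  rw [pd_pd_comm_heatOp hρ.1] at e2
  ext z
  have h3 := ((h1.differentiable (by simp) z).hasFDerivAt.sub
    (h2.differentiable (by simp) z).hasFDerivAt).fderiv
  have h4 : pd v (molFlux a W f g ρ y) z
      = pd v (conv (fun z => g z + primY (fun t z => f (mkPt t z)) y z) ρ) z
        - pd v (conv (primY (fun t z => t ^ a * slice W t z) y) (Carleman.heatOp ρ)) z :=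
    (congrArg (fun L => L v) h3).trans rfl
  rw [h4, e1, e2, molFlux]

/-- The explicit formula does not display the vanishing, since g and f are not assumed compactly
supported. It follows because y^{-a} times the flux is the derivative of a function that is zero
near y. -/
theorem molFlux_eq_zero (h : WeakData n a W Wy Wt f Wx g) (ha : -1 < a) (ha0 : a ≤ 0)
    {ρ : Tan n → ℝ} (hρ : IsMoll ρ) {y : ℝ} {z : Tan n} (hy : 0 < y)
    (hz : y ≤ 1 / 2 → z ∉ tanBox n) : molFlux a W f g ρ y z = 0 := by
  have h1 := h.hasDerivAt_conv_slice ha ha0 hρ z hy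
  have h2 : (fun y => conv (slice W y) ρ z) =ᶠ[𝓝 y] fun _ => 0 := by
    by_cases hzb : z ∈ tanBox n
    · have hy2 : 1 / 2 < y := by
        by_contra hcon
        exact hz (not_lt.1 hcon) hzb
      filter_upwards [Ioi_mem_nhds hy2] with t ht
      exact h.conv_slice_eq_zero hρ fun ht' => absurd ht (not_lt.2 ht')
    · exact Eventually.of_forall fun t => h.conv_slice_eq_zero hρ fun _ => hzb
  have h3 := h1.unique ((hasDerivAt_const y (0 : ℝ)).congr_of_eventuallyEq h2)
  exact (mul_eq_zero.1 h3).resolve_left (Real.rpow_pos_of_pos hy _).ne'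

theorem molFlux_eq_conv (h : WeakData n a W Wy Wt f Wx g) (ha : -1 < a) {ρ : Tan n → ℝ}
    (hρ : IsMoll ρ) (y : ℝ) (z : Tan n) : molFlux a W f g ρ y z
      = conv g ρ z + conv (primY (fun t z => f (mkPt t z)) y) ρ z
        - conv (primY (fun t z => t ^ a * slice W t z) y) (Carleman.heatOp ρ) z := by
  rw [molFlux, conv_add_left h.normalDeriv.1 ((h.slab_f ha).locallyIntegrable y) hρ.1.continuous
    hρ.hasCompactSupport]

theorem exists_bound_molFlux (h : WeakData n a W Wy Wt f Wx g) (ha : -1 < a) (ha0 : a ≤ 0)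
    {ρ : Tan n → ℝ} (hρ : IsMoll ρ) :
    ∃ B, ∀ y ∈ Set.Ioc (0 : ℝ) 1, ∀ z, |molFlux a W f g ρ y z| ≤ B := by
  obtain ⟨B₁, h₁⟩ := isCompact_tanBox.exists_bound_of_continuousOn
    (contDiff_conv h.normalDeriv.1 hρ.1 hρ.hasCompactSupport).continuous.continuousOn
  obtain ⟨B₂, h₂⟩ := (h.slab_f ha).exists_bound_conv hρ
  obtain ⟨B₃, h₃⟩ := (h.slab_slice ha).exists_bound_conv hρ.heatOp
  refine ⟨|B₁| + |B₂| + |B₃|, fun y hy z => ?_⟩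
  by_cases hz : z ∈ tanBox n
  · have k₁ := (h₁ z hz).trans (le_abs_self _)
    have k₂ := (h₂ y hy z hz).trans (le_abs_self _)
    have k₃ := (h₃ y hy z hz).trans (le_abs_self _)
    rw [Real.norm_eq_abs] at k₁
    rw [h.molFlux_eq_conv ha hρ]
    exact (abs_sub _ _).trans (add_le_add ((abs_add_le _ _).trans (add_le_add k₁ k₂)) k₃)
  · rw [h.molFlux_eq_zero ha ha0 hρ hy.1 fun _ => hz, abs_zero]
    positivity

theorem continuous_molFlux (h : WeakData n a W Wy Wt f Wx g) (ha : -1 < a) {ρ : Tan n → ℝ}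
    (hρ : IsMoll ρ) (z : Tan n) : Continuous fun y => molFlux a W f g ρ y z := by
  simp only [h.molFlux_eq_conv ha hρ]
  exact (continuous_const.add ((h.slab_f ha).continuous_conv_primY hρ.1.continuous
    hρ.hasCompactSupport z)).sub ((h.slab_slice ha).continuous_conv_primY
      hρ.heatOp.1.continuous hρ.heatOp.hasCompactSupport z)

/-- Cauchy-Schwarz bounds |(f⋆ρ)(z)|² y^{-a} by the supremum of |ρ|, times its L¹ norm, times the
weighted square integral of the slice of f. The last factor is integrable in y by hypothesis. -/
theorem integrableOn_conv_sq (h : WeakData n a W Wy Wt f Wx g) (ha : -1 < a) {ρ : Tan n → ℝ}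
    (hρ : IsMoll ρ) (z : Tan n) :
    IntegrableOn (fun y => conv (fun z => f (mkPt y z)) ρ z ^ 2 * y ^ (-a)) (Set.Ioc 0 1) := by
  obtain ⟨M, hM⟩ := hρ.1.continuous.bounded_above_of_compact_support hρ.hasCompactSupport
  have hM' : ∀ x, ‖ρ x‖ₑ ≤ ENNReal.ofReal M := fun x => by
    rw [← ofReal_norm]; exact ENNReal.ofReal_le_ofReal (hM x)
  have hint : ∫⁻ z', ‖ρ (z - z')‖ₑ < ⊤ :=
    ((hρ.1.continuous.comp (by fun_prop : Continuous fun z' => z - z')).integrable_of_hasCompactSupport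
      (hasCompactSupport_reflect hρ.hasCompactSupport z)).2
  have hmf : Measurable fun q : ℝ × Tan n => f (mkPt q.1 q.2) := h.measurable_f_comp_mkPt
  have hm2 : Measurable fun p : Pt n => f p ^ 2 * p.2.1 ^ (-a) := by
    have := h.measurable_f
    fun_prop
  refine ⟨?_, ?_⟩
  · exact ((((h.slab_f ha).integrableOn_conv hρ.1.continuous hρ.hasCompactSupport z 1).1.aemeasurable.pow_const
      2).mul (measurable_id.pow_const (-a)).aemeasurable).aestronglyMeasurable
  · have hfin := h.f_lt_top
    rw [setLIntegral_openHalf hm2.ennreal_ofReal] at hfin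
    have hpt : ∀ y, 0 < y → ‖conv (fun z => f (mkPt y z)) ρ z ^ 2 * y ^ (-a)‖ₑ
        ≤ (ENNReal.ofReal M * ∫⁻ z', ‖ρ (z - z')‖ₑ)
          * ∫⁻ z', ENNReal.ofReal (f (mkPt y z') ^ 2 * (mkPt y z').2.1 ^ (-a)) := fun y hy => by
      have hmy : Measurable fun z => f (mkPt y z) := hmf.comp (measurable_const.prodMk measurable_id)
      have hY : 0 ≤ y ^ (-a) := Real.rpow_nonneg hy.le _
      have e : ∫⁻ z', ENNReal.ofReal (f (mkPt y z') ^ 2 * (mkPt y z').2.1 ^ (-a))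
          = (∫⁻ z', ‖f (mkPt y z')‖ₑ ^ 2) * ENNReal.ofReal (y ^ (-a)) := by
        rw [← lintegral_mul_const _ (hmy.enorm.pow_const 2)]
        refine lintegral_congr fun z' => ?_
        rw [ENNReal.ofReal_mul (sq_nonneg _), ← ofReal_norm, Real.norm_eq_abs,
          ← ENNReal.ofReal_pow (abs_nonneg _), sq_abs]
        rfl
      have h1 := enorm_conv_sq_le hmy hρ.1.continuous.measurable z
      have h2 : ∫⁻ z', ‖f (mkPt y z')‖ₑ ^ 2 * ‖ρ (z - z')‖ₑ
          ≤ (∫⁻ z', ‖f (mkPt y z')‖ₑ ^ 2) * ENNReal.ofReal M := by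
        rw [← lintegral_mul_const _ (hmy.enorm.pow_const 2)]
        exact lintegral_mono fun z' => mul_le_mul_right (hM' _) _
      rw [enorm_mul, enorm_pow, e, ← ofReal_norm (y ^ (-a)), Real.norm_eq_abs, abs_of_nonneg hY]
      calc _ ≤ ((∫⁻ z', ‖f (mkPt y z')‖ₑ ^ 2) * ENNReal.ofReal M * ∫⁻ z', ‖ρ (z - z')‖ₑ)
            * ENNReal.ofReal (y ^ (-a)) := by gcongr; exact h1.trans (by gcongr)
        _ = _ := by ring
    refine lt_of_le_of_lt (setLIntegral_mono' measurableSet_Ioc fun y hy => hpt y hy.1) ?_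
    rw [lintegral_const_mul']
    · refine ENNReal.mul_lt_top (ENNReal.mul_lt_top ENNReal.ofReal_lt_top hint) ?_
      exact lt_of_le_of_lt (lintegral_mono_set fun y hy => hy.1) hfin
    · exact (ENNReal.mul_lt_top ENNReal.ofReal_lt_top hint).ne

/-- The tangential mollifications of a weak solution. -/
theorem isSolFamily (h : WeakData n a W Wy Wt f Wx g) (ha : -1 < a) (ha0 : a ≤ 0) :
    IsSolFamily a (fun ρ y => conv (slice W y) ρ) (molFlux a W f g)
      (fun ρ y => conv (fun z => f (mkPt y z)) ρ) (fun ρ => conv g ρ) where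
  contDiff_U hρ y := contDiff_conv (h.locallyIntegrable_slice y) hρ.1 hρ.hasCompactSupport
  contDiff_P hρ y := h.contDiff_molFlux ha hρ y
  pd_U hρ v y := pd_conv (h.locallyIntegrable_slice y) hρ.1 hρ.hasCompactSupport v
  pd_P hρ v y := h.pd_molFlux ha hρ v y
  zero_U hρ _ _ _ hz := h.conv_slice_eq_zero hρ hz
  zero_P hρ _ _ hy hz := h.molFlux_eq_zero ha ha0 hρ hy hz
  hasDerivAt hρ z _ hy := h.hasDerivAt_conv_slice ha ha0 hρ z hy
  tendsto_U := fun {ρ} hρ z => by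
    have h1 := (h.continuous_conv_slice hρ z).tendsto 0
    have h2 : conv (slice W 0) ρ z = 0 := integral_eq_zero_of_ae (Eventually.of_forall fun z' => by
      simp [h.slice_of_nonpos le_rfl z'])
    rw [h2] at h1
    exact h1.mono_left nhdsWithin_le_nhds
  integrable_F hρ z _ hb := h.integrable_rhs ha hρ z hb
  P_eq hρ z _ hy := h.molFlux_eq ha hρ z hy
  bound_P hρ := h.exists_bound_molFlux ha ha0 hρ
  measurable_U hρ := (measurable_uncurry_of_continuous_of_measurable
    (u := fun (y : ℝ) (z : Tan n) => conv (slice W y) _ z) (fun z => h.continuous_conv_slice hρ z)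
    fun y => (contDiff_conv (h.locallyIntegrable_slice y) hρ.1
      hρ.hasCompactSupport).continuous.measurable).comp measurable_swap
  measurable_P hρ := (measurable_uncurry_of_continuous_of_measurable
    (u := fun (y : ℝ) (z : Tan n) => molFlux a W f g _ y z) (fun z => h.continuous_molFlux ha hρ z)
    fun y => (h.contDiff_molFlux ha hρ y).continuous.measurable).comp measurable_swap
  measurable_gm hρ :=
    (contDiff_conv h.normalDeriv.1 hρ.1 hρ.hasCompactSupport).continuous.measurable
  sq_integrable hρ z := h.integrableOn_conv_sq ha hρ z

end WeakData

/-! ### Removal of the mollification. -/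

/-- A weighted Young inequality for mollifications. -/
theorem lintegral_mul_enorm_conv_sq_le {h ρ : Tan n → ℝ} {k K : Tan n → ℝ≥0∞} {s : Set (Tan n)}
    (hs : MeasurableSet s) (hh : Measurable h) (hρ : Measurable ρ) (hρ1 : ∫⁻ z, ‖ρ z‖ₑ = 1)
    (hK : Measurable K) (hkK : ∀ z ∈ s, ∀ z', ρ (z - z') ≠ 0 → k z ≤ K z') :
    ∫⁻ z in s, k z * ‖conv h ρ z‖ₑ ^ 2 ≤ ∫⁻ z, K z * ‖h z‖ₑ ^ 2 := by
  have hm : Measurable fun z => K z * ‖h z‖ₑ ^ 2 := hK.mul (hh.enorm.pow_const 2)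
  have h1 : ∀ z ∈ s, k z * ‖conv h ρ z‖ₑ ^ 2
      ≤ ∫⁻ z', K z' * ‖h z'‖ₑ ^ 2 * ‖ρ (z - z')‖ₑ := fun z hz => by
    have h2 := enorm_conv_sq_le hh hρ z
    rw [lintegral_sub_left_eq_self (fun x => ‖ρ x‖ₑ) z, hρ1, mul_one] at h2
    have hm2 : Measurable fun z' => ‖h z'‖ₑ ^ 2 * ‖ρ (z - z')‖ₑ :=
      (hh.enorm.pow_const 2).mul (hρ.comp (measurable_const.sub measurable_id)).enorm
    refine (mul_le_mul_right h2 (k z)).trans ?_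
    rw [← lintegral_const_mul _ hm2]
    refine lintegral_mono fun z' => ?_
    by_cases h0 : ρ (z - z') = 0
    · simp [h0]
    · rw [← mul_assoc]
      gcongr
      exact hkK z hz z' h0
  calc ∫⁻ z in s, k z * ‖conv h ρ z‖ₑ ^ 2
      ≤ ∫⁻ z in s, ∫⁻ z', K z' * ‖h z'‖ₑ ^ 2 * ‖ρ (z - z')‖ₑ := setLIntegral_mono' hs h1
    _ ≤ ∫⁻ z, ∫⁻ z', K z' * ‖h z'‖ₑ ^ 2 * ‖ρ (z - z')‖ₑ := setLIntegral_le_lintegral _ _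
    _ = ∫⁻ z', ∫⁻ z, K z' * ‖h z'‖ₑ ^ 2 * ‖ρ (z - z')‖ₑ := by
      refine lintegral_lintegral_swap (Measurable.aemeasurable ?_)
      exact (hm.comp measurable_snd).mul
        (hρ.comp (measurable_fst.sub measurable_snd)).enorm
    _ = ∫⁻ z', K z' * ‖h z'‖ₑ ^ 2 := by
      refine lintegral_congr fun z' => ?_
      have hmz : Measurable fun z => ‖ρ (z - z')‖ₑ :=
        (hρ.comp (measurable_id.sub measurable_const)).enorm
      rw [lintegral_const_mul _ hmz]
      have := lintegral_sub_right_eq_self (μ := (volume : Measure (Tan n))) (fun x => ‖ρ x‖ₑ) z'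
      rw [this, hρ1, mul_one]

theorem conv_congr_ae {h k : Tan n → ℝ} (hk : h =ᵐ[volume] k) (ρ : Tan n → ℝ) :
    conv h ρ = conv k ρ := by
  ext z
  exact integral_congr_ae (hk.mono fun z' hz' => by simp only [hz'])

theorem ofReal_sq_eq_enorm (x : ℝ) : ENNReal.ofReal (x ^ 2) = ‖x‖ₑ ^ 2 := by
  rw [← ofReal_norm, Real.norm_eq_abs, ← ENNReal.ofReal_pow (abs_nonneg _), sq_abs]

/-- Young's inequality with both weights equal to 1, applied to a measurable representative: the
boundary datum is measurable only up to null sets, and convolution does not see the change. -/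
theorem lintegral_conv_sq_le {h ρ : Tan n → ℝ} (hh : AEMeasurable h) (hρ : Measurable ρ)
    (hρ1 : ∫⁻ z, ‖ρ z‖ₑ = 1) {s : Set (Tan n)} (hs : MeasurableSet s) :
    ∫⁻ z in s, ENNReal.ofReal (conv h ρ z ^ 2) ≤ ∫⁻ z, ENNReal.ofReal (h z ^ 2) := by
  have h1 := lintegral_mul_enorm_conv_sq_le (k := 1) (K := 1) hs hh.measurable_mk hρ hρ1
    measurable_const fun _ _ _ _ => le_rfl
  simp only [Pi.one_apply, one_mul] at h1
  rw [← conv_congr_ae hh.ae_eq_mk] at h1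
  simp only [ofReal_sq_eq_enorm]
  refine h1.trans_eq (lintegral_congr_ae ?_)
  exact hh.ae_eq_mk.mono fun z hz => by simp only [hz]

theorem expWeight_sq_eq_exp_phi (a α : ℝ) (y : ℝ) (z : Tan n) :
    expWeight a α (‖z.1‖ ^ 2) y ^ 2 = Real.exp (2 * α * phi a (mkPt y z)) := by
  rw [expWeight, ← Real.exp_nat_mul, phi, mkPt]
  congr 1
  push_cast
  ring

/-- The Carleman weight varies by at most a factor `2` on small balls. -/
theorem expWeight_sq_le {a α ε y : ℝ} {z z' : Tan n} (hz : z ∈ tanBox n) (hα : 0 < α)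
    (hε : ε ≤ 1 / 2) (hαε : 4 * α * ε ≤ 1) (h : ‖z - z'‖ ≤ ε) :
    expWeight a α (‖z.1‖ ^ 2) y ^ 2 ≤ 2 * expWeight a α (‖z'.1‖ ^ 2) y ^ 2 := by
  have h1 : ‖z.1‖ ≤ 1 := norm_le_of_mem_tanBox hz
  have h2 : ‖z'.1‖ - ‖z.1‖ ≤ ε := by
    have h3 := (norm_fst_le (z - z')).trans h
    have h4 := norm_sub_norm_le z'.1 z.1
    rw [norm_sub_rev] at h4
    exact h4.trans h3
  have hε0 : 0 ≤ ε := (norm_nonneg _).trans h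
  -- Difference of squares: the sum of the norms is at most 2 + ε ≤ 5/2. With 4αε ≤ 1 the exponent
  -- below is at most 5/16 < 1/2, and e^{1/2} ≤ 2.
  have h3 : ‖z'.1‖ ^ 2 - ‖z.1‖ ^ 2 ≤ 5 / 2 * ε := by
    nlinarith [norm_nonneg z'.1, norm_nonneg z.1]
  have h4 : Real.exp (1 / 2) ≤ 2 := by
    have e : Real.exp (1 / 2) ^ 2 = Real.exp 1 := by
      rw [← Real.exp_nat_mul]; norm_num
    nlinarith [Real.exp_one_lt_d9, Real.exp_pos (1 / 2)]
  have h5 : expWeight a α (‖z.1‖ ^ 2) y ^ 2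
      = Real.exp (α * (‖z'.1‖ ^ 2 - ‖z.1‖ ^ 2) / 2) * expWeight a α (‖z'.1‖ ^ 2) y ^ 2 := by
    simp only [expWeight, ← Real.exp_nat_mul, ← Real.exp_add]
    congr 1
    push_cast
    ring
  rw [h5]
  refine mul_le_mul_of_nonneg_right ((Real.exp_le_exp.2 ?_).trans h4) (sq_nonneg _)
  nlinarith [mul_le_mul_of_nonneg_left h3 hα.le]

/-- Mollifiers at scale `ε`. -/
structure IsMollAt (ε : ℝ) (ρ : Tan n → ℝ) : Prop where
  contDiff : ContDiff ℝ ∞ ρ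
  norm_le : ∀ z, ρ z ≠ 0 → ‖z‖ ≤ ε
  lintegral : ∫⁻ z, ‖ρ z‖ₑ = 1

theorem IsMollAt.isMoll {ε : ℝ} {ρ : Tan n → ℝ} (h : IsMollAt ε ρ) (hε : ε ≤ 1 / 2) : IsMoll ρ :=
  ⟨h.contDiff, closure_minimal (fun z hz => by
    rw [mem_closedBall_zero_iff]; exact (h.norm_le z hz).trans hε) Metric.isClosed_closedBall⟩

/-- There are mollifiers at scales tending to zero which approximate the identity. -/
theorem exists_isMollAt {ε : ℝ} (hε : 0 < ε) : ∃ ρ : ℕ → Tan n → ℝ, (∀ k, IsMollAt ε (ρ k)) ∧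
    ∀ w : Tan n → ℝ, Continuous w → ∀ z, Tendsto (fun k => conv w (ρ k) z) atTop (𝓝 (w z)) := by
  have hpos : ∀ k : ℕ, 0 < ε / (k + 1) := fun k => by positivity
  let b : ℕ → ContDiffBump (0 : Tan n) := fun k =>
    ⟨ε / (k + 1) / 2, ε / (k + 1), half_pos (hpos k), half_lt_self (hpos k)⟩
  have hb : Tendsto (fun k => (b k).rOut) atTop (𝓝 0) := by
    have := tendsto_one_div_add_atTop_nhds_zero_nat (𝕜 := ℝ)
    simpa [b, div_eq_mul_inv] using this.const_mul ε
  refine ⟨fun k => (b k).normed volume, fun k => ⟨(b k).contDiff_normed, fun z hz => ?_, ?_⟩,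
    fun w hw z => ?_⟩
  · have h1 : z ∈ tsupport ((b k).normed volume) := subset_tsupport _ hz
    rw [(b k).tsupport_normed_eq, mem_closedBall_zero_iff] at h1
    refine h1.trans (div_le_self hε.le ?_)
    linarith [(Nat.cast_nonneg k : (0 : ℝ) ≤ k)]
  · have h1 := ofReal_integral_eq_lintegral_ofReal (b k).integrable_normed
      (Eventually.of_forall fun x => (b k).nonneg_normed (μ := (volume : Measure (Tan n))) x)
    rw [(b k).integral_normed, ENNReal.ofReal_one] at h1
    rw [h1]
    refine lintegral_congr fun z => ?_
    rw [← ofReal_norm, Real.norm_of_nonneg ((b k).nonneg_normed z)]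
  · have h1 := ContDiffBump.convolution_tendsto_right_of_continuous
      (μ := (volume : Measure (Tan n))) hb hw z
    refine h1.congr fun k => ?_
    rw [convolution_eq_swap]
    refine integral_congr_ae (Eventually.of_forall fun z' => ?_)
    simp [mul_comm]

namespace WeakData

variable {a : ℝ} {W Wy Wt f : Pt n → ℝ} {Wx : Fin n → Pt n → ℝ} {g : Tan n → ℝ}

theorem measurable_conv_f (h : WeakData n a W Wy Wt f Wx g) {ρ : Tan n → ℝ} (hρ : Continuous ρ) :
    Measurable fun q : Tan n × ℝ => conv (fun z => f (mkPt q.2 z)) ρ q.1 := by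
  have hm : Measurable fun q : (Tan n × ℝ) × Tan n => f (mkPt q.1.2 q.2) * ρ (q.1.1 - q.2) :=
    (h.measurable_f_comp_mkPt.comp ((measurable_snd.comp measurable_fst).prodMk measurable_snd)).mul
      (hρ.measurable.comp ((measurable_fst.comp measurable_fst).sub measurable_snd))
  exact (StronglyMeasurable.integral_prod_right (ν := (volume : Measure (Tan n)))
    (f := fun (q : Tan n × ℝ) z' => f (mkPt q.2 z') * ρ (q.1 - z'))
    hm.stronglyMeasurable).measurable

theorem measurable_expWeight (α : ℝ) :
    Measurable fun q : Tan n × ℝ => expWeight a α (‖q.1.1‖ ^ 2) q.2 := by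
  unfold expWeight
  fun_prop

/-- On a slice y^{-a} is constant and only the Gaussian part of the weight varies. Comparability
within the support of ρ permits moving the weight inside the convolution at the cost of a factor 2.
-/
theorem lintegral_conv_f_slice_le (h : WeakData n a W Wy Wt f Wx g) {α ε : ℝ} (hα : 0 < α)
    (hε : ε ≤ 1 / 2) (hαε : 4 * α * ε ≤ 1) {ρ : Tan n → ℝ} (hρ : IsMollAt ε ρ) {y : ℝ}
    (hy : 0 < y) : ∫⁻ z in tanBox n, ENNReal.ofReal
        ((expWeight a α (‖z.1‖ ^ 2) y * conv (fun z => f (mkPt y z)) ρ z) ^ 2 * y ^ (-a))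
      ≤ 2 * ∫⁻ z, ENNReal.ofReal (Real.exp (2 * α * phi a (mkPt y z)) * f (mkPt y z) ^ 2
        * (mkPt y z).2.1 ^ (-a)) := by
  have hY : 0 ≤ y ^ (-a) := Real.rpow_nonneg hy.le _
  have hmy : Measurable fun z : Tan n => f (mkPt y z) :=
    (h.measurable_f_comp_mkPt.comp measurable_prodMk_left :)
  have hmw : Measurable fun z : Tan n => expWeight a α (‖z.1‖ ^ 2) y :=
    ((measurable_expWeight (a := a) α).comp measurable_prodMk_right :)
  have h1 := lintegral_mul_enorm_conv_sq_le
    (k := fun z : Tan n => ENNReal.ofReal (expWeight a α (‖z.1‖ ^ 2) y ^ 2 * y ^ (-a)))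
    (K := fun z : Tan n => ENNReal.ofReal (2 * expWeight a α (‖z.1‖ ^ 2) y ^ 2 * y ^ (-a)))
    measurableSet_tanBox hmy hρ.contDiff.continuous.measurable hρ.lintegral
    ((((hmw.pow_const 2).const_mul 2).mul_const _).ennreal_ofReal) fun z hz z' hne =>
      ENNReal.ofReal_le_ofReal (mul_le_mul_of_nonneg_right
        (expWeight_sq_le hz hα hε hαε (hρ.norm_le _ hne)) hY)
  rw [← lintegral_const_mul' _ _ ENNReal.ofNat_ne_top]
  refine (le_of_eq (lintegral_congr fun z => ?_)).trans
    (h1.trans (le_of_eq (lintegral_congr fun z => ?_)))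
  · rw [← ofReal_sq_eq_enorm, ← ENNReal.ofReal_mul (mul_nonneg (sq_nonneg _) hY)]
    congr 1
    ring
  · have e : ∀ x, 2 * ENNReal.ofReal x = ENNReal.ofReal (2 * x) := fun x => by
      rw [ENNReal.ofReal_mul two_pos.le, ENNReal.ofReal_ofNat]
    rw [← ofReal_sq_eq_enorm, ← ENNReal.ofReal_mul (by positivity), e, expWeight_sq_eq_exp_phi]
    congr 1
    simp only [mkPt]
    ring

theorem lintegral_conv_f_le (h : WeakData n a W Wy Wt f Wx g) {α ε : ℝ} (hα : 0 < α)
    (hε : ε ≤ 1 / 2) (hαε : 4 * α * ε ≤ 1) {ρ : Tan n → ℝ} (hρ : IsMollAt ε ρ) :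
    ∫⁻ z in tanBox n, ∫⁻ y in Set.Ioc (0 : ℝ) 1, ENNReal.ofReal
        ((expWeight a α (‖z.1‖ ^ 2) y * conv (fun z => f (mkPt y z)) ρ z) ^ 2 * y ^ (-a))
      ≤ 2 * ∫⁻ p in openHalf n,
        ENNReal.ofReal (Real.exp (2 * α * phi a p) * f p ^ 2 * p.2.1 ^ (-a)) := by
  have hm : Measurable fun q : Tan n × ℝ => ENNReal.ofReal
      ((expWeight a α (‖q.1.1‖ ^ 2) q.2 * conv (fun z => f (mkPt q.2 z)) ρ q.1) ^ 2
        * q.2 ^ (-a)) :=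
    ((((measurable_expWeight α).mul (h.measurable_conv_f hρ.contDiff.continuous)).pow_const
      2).mul (measurable_snd.pow_const (-a))).ennreal_ofReal
  have hswap := lintegral_lintegral_swap (μ := volume.restrict (tanBox n))
    (ν := volume.restrict (Set.Ioc (0 : ℝ) 1)) (f := fun z y => ENNReal.ofReal
      ((expWeight a α (‖z.1‖ ^ 2) y * conv (fun z => f (mkPt y z)) ρ z) ^ 2 * y ^ (-a)))
    hm.aemeasurable
  have hmf := h.measurable_f
  have hG : Measurable fun p : Pt n =>
      ENNReal.ofReal (Real.exp (2 * α * phi a p) * f p ^ 2 * p.2.1 ^ (-a)) := by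
    unfold phi; fun_prop
  rw [hswap, setLIntegral_openHalf hG]
  calc _ ≤ ∫⁻ y in Set.Ioc (0 : ℝ) 1, 2 * ∫⁻ z, ENNReal.ofReal (Real.exp (2 * α
          * phi a (mkPt y z)) * f (mkPt y z) ^ 2 * (mkPt y z).2.1 ^ (-a)) :=
        setLIntegral_mono' measurableSet_Ioc fun y hy =>
          h.lintegral_conv_f_slice_le hα hε hαε hρ hy.1
    _ = 2 * ∫⁻ y in Set.Ioc (0 : ℝ) 1, ∫⁻ z, ENNReal.ofReal (Real.exp (2 * α
          * phi a (mkPt y z)) * f (mkPt y z) ^ 2 * (mkPt y z).2.1 ^ (-a)) :=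
        lintegral_const_mul' _ _ ENNReal.ofNat_ne_top
    _ ≤ _ := mul_le_mul_right
        (lintegral_mono_set fun y (hy : y ∈ Set.Ioc (0 : ℝ) 1) => hy.1) 2

/-- The support condition confines W to the box and to y ≤ 1/2. The continuous `slice` replaces W,
about which nothing is known for y < 0, so that the Tonelli theorem applies. -/
theorem lintegral_eq_tanBox (h : WeakData n a W Wy Wt f Wx g) (α : ℝ) :
    ∫⁻ p in openHalf n, ENNReal.ofReal (Real.exp (2 * α * phi a p) * W p ^ 2 * p.2.1 ^ a)
      = ∫⁻ z in tanBox n, ∫⁻ y in Set.Ioc (0 : ℝ) 1,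
        ENNReal.ofReal (y ^ a * (expWeight a α (‖z.1‖ ^ 2) y * slice W y z) ^ 2) := by
  have hms : Measurable fun p : Pt n => slice W p.2.1 (tanPart p) := by
    have hc : Measurable fun p : Pt n => (p.2.1, tanPart p) := by unfold tanPart; fun_prop
    exact h.continuous_slice.measurable.comp hc
  have hG : Measurable fun p : Pt n => ENNReal.ofReal
      (Real.exp (2 * α * phi a p) * slice W p.2.1 (tanPart p) ^ 2 * p.2.1 ^ a) := by
    unfold phi; fun_prop
  have e1 : ∫⁻ p in openHalf n, ENNReal.ofReal (Real.exp (2 * α * phi a p) * W p ^ 2 * p.2.1 ^ a)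
      = ∫⁻ p in openHalf n, ENNReal.ofReal
        (Real.exp (2 * α * phi a p) * slice W p.2.1 (tanPart p) ^ 2 * p.2.1 ^ a) :=
    setLIntegral_congr_fun measurableSet_openHalf fun p hp => by
      have : slice W p.2.1 (tanPart p) = W p := slice_of_pos hp _
      simp only [this]
  have hm : Measurable fun q : Tan n × ℝ =>
      ENNReal.ofReal (q.2 ^ a * (expWeight a α (‖q.1.1‖ ^ 2) q.2 * slice W q.2 q.1) ^ 2) :=
    ((measurable_snd.pow_const a).mul (((measurable_expWeight α).mul
      (h.continuous_slice.measurable.comp measurable_swap)).pow_const 2)).ennreal_ofReal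
  have hswap := lintegral_lintegral_swap (μ := volume.restrict (tanBox n))
    (ν := volume.restrict (Set.Ioc (0 : ℝ) 1)) (f := fun z y => ENNReal.ofReal
      (y ^ a * (expWeight a α (‖z.1‖ ^ 2) y * slice W y z) ^ 2)) hm.aemeasurable
  rw [e1, setLIntegral_openHalf hG, hswap]
  have e2 : ∀ (y : ℝ) (z : Tan n), ENNReal.ofReal (Real.exp (2 * α * phi a (mkPt y z))
      * slice W (mkPt y z).2.1 (tanPart (mkPt y z)) ^ 2 * (mkPt y z).2.1 ^ a)
      = ENNReal.ofReal (y ^ a * (expWeight a α (‖z.1‖ ^ 2) y * slice W y z) ^ 2) := fun y z => by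
    rw [mul_pow, expWeight_sq_eq_exp_phi]
    congr 1
    simp only [mkPt, tanPart]
    ring
  simp only [e2]
  have hz : ∀ (y : ℝ) (z : Tan n), (z ∉ tanBox n ∨ y ∉ Set.Ioc (0 : ℝ) 1) →
      ENNReal.ofReal (y ^ a * (expWeight a α (‖z.1‖ ^ 2) y * slice W y z) ^ 2) = 0 :=
    fun y z hyz => by
      have : slice W y z = 0 := by
        by_contra hne
        obtain ⟨h1, h2, h3, h4⟩ := h.slice_ne_zero hne
        refine hyz.elim (fun hc => hc ⟨?_, ?_⟩) fun hc => hc ⟨h1, by linarith⟩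
        · rw [mem_closedBall_zero_iff]; linarith
        · rw [mem_closedBall_zero_iff, Real.norm_eq_abs]; linarith
      simp [this]
  rw [← lintegral_indicator measurableSet_Ioi, ← lintegral_indicator measurableSet_Ioc]
  refine lintegral_congr fun y => ?_
  by_cases hy : y ∈ Set.Ioc (0 : ℝ) 1
  · rw [Set.indicator_of_mem hy, Set.indicator_of_mem (Set.mem_Ioi.2 hy.1),
      setLIntegral_eq_of_support_subset]
    intro z hne
    by_contra hzb
    exact hne (hz y z (Or.inl hzb))
  · rw [Set.indicator_of_notMem hy]
    refine Set.indicator_apply_eq_zero.2 fun _ => ?_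
    simp only [hz y _ (Or.inr hy), lintegral_zero]

/-- The Carleman inequality with constant `1`. -/
theorem carleman (h : WeakData n a W Wy Wt f Wx g) (ha : -1 < a) (ha0 : a ≤ 0) {α : ℝ}
    (hα : 2 < α) :
    ENNReal.ofReal (α ^ 3) *
        ∫⁻ p in openHalf n, ENNReal.ofReal (Real.exp (2 * α * phi a p) * W p ^ 2 * p.2.1 ^ a)
      ≤ (∫⁻ p in openHalf n,
          ENNReal.ofReal (Real.exp (2 * α * phi a p) * f p ^ 2 * p.2.1 ^ (-a)))
        + ENNReal.ofReal α * ∫⁻ q, ENNReal.ofReal (g q ^ 2) := by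
  have hα0 : 0 < α := by linarith
  -- The largest scale with 4αε ≤ 1; it depends on α but not on the index of the approximating
  -- sequence, so the factor 2 holds for all its terms.
  have hε : (0 : ℝ) < 1 / (4 * α) := by positivity
  have hε2 : 1 / (4 * α) ≤ 1 / 2 := one_div_le_one_div_of_le two_pos (by linarith)
  obtain ⟨ρ, hρ, hlim⟩ := exists_isMollAt (n := n) hε
  have hα3 : ENNReal.ofReal (α ^ 3) ≠ 0 := (ENNReal.ofReal_pos.2 (by positivity)).ne'
  rw [h.lintegral_eq_tanBox α]
  set J := ∫⁻ p in openHalf n,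
    ENNReal.ofReal (Real.exp (2 * α * phi a p) * f p ^ 2 * p.2.1 ^ (-a)) with hJ
  set B := ∫⁻ q, ENNReal.ofReal (g q ^ 2) with hB
  set I : ℕ → ℝ≥0∞ := fun k => ∫⁻ z in tanBox n, ∫⁻ y in Set.Ioc (0 : ℝ) 1,
    ENNReal.ofReal (y ^ a * (expWeight a α (‖z.1‖ ^ 2) y * conv (slice W y) (ρ k) z) ^ 2) with hI
  have h1 : ∀ k, I k ≤ (J + ENNReal.ofReal α * B) / ENNReal.ofReal (α ^ 3) := fun k => by
    have hmol := (hρ k).isMoll hε2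
    have h2 := (h.isSolFamily ha ha0).carleman ha ha0 hα hmol
    have h3 := h.lintegral_conv_f_le hα0 hε2 (by field_simp; norm_num) (hρ k)
    have h4 := lintegral_conv_sq_le h.normalDeriv.1.aestronglyMeasurable.aemeasurable
      (hρ k).contDiff.continuous.measurable (hρ k).lintegral (measurableSet_tanBox (n := n))
    have h5 : ENNReal.ofReal (2 * α ^ 3) * I k
        ≤ ENNReal.ofReal (1 / 4) * (2 * J) + ENNReal.ofReal (2 * α) * B := by
      refine h2.trans ?_
      gcongr
    have e : (2 : ℝ≥0∞) = ENNReal.ofReal 2 := by simp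
    -- The factor 2 lost by mollifying f is absorbed with room to spare: 1/4 · 2J ≤ 2J. Dividing
    -- everything by 2 gives constant 1.
    have h6 : ENNReal.ofReal (1 / 4) ≤ 1 := by
      rw [← ENNReal.ofReal_one]; exact ENNReal.ofReal_le_ofReal (by norm_num)
    rw [ENNReal.ofReal_mul two_pos.le, ENNReal.ofReal_mul two_pos.le, ← e, mul_assoc,
      mul_assoc] at h5
    have h7 : 2 * (ENNReal.ofReal (α ^ 3) * I k) ≤ 2 * (J + ENNReal.ofReal α * B) := by
      refine h5.trans ?_
      rw [mul_add]
      exact add_le_add (mul_le_of_le_one_left zero_le h6) le_rfl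
    rw [ENNReal.mul_le_mul_iff_right two_ne_zero ENNReal.ofNat_ne_top] at h7
    rwa [ENNReal.le_div_iff_mul_le (Or.inl hα3) (Or.inl ENNReal.ofReal_ne_top), mul_comm]
  have hmU : ∀ k, Measurable fun q : Tan n × ℝ => ENNReal.ofReal (q.2 ^ a
      * (expWeight a α (‖q.1.1‖ ^ 2) q.2 * conv (slice W q.2) (ρ k) q.1) ^ 2) := fun k =>
    ((measurable_snd.pow_const a).mul (((measurable_expWeight α).mul
      ((h.isSolFamily ha ha0).measurable_U ((hρ k).isMoll hε2))).pow_const 2)).ennreal_ofReal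
  have h2 : ∫⁻ z in tanBox n, ∫⁻ y in Set.Ioc (0 : ℝ) 1,
        ENNReal.ofReal (y ^ a * (expWeight a α (‖z.1‖ ^ 2) y * slice W y z) ^ 2)
      ≤ liminf I atTop := by
    -- Fatou's lemma is used twice, in z and in y; pointwise convergence of the mollifications holds
    -- since each slice of W is continuous.
    refine le_trans (lintegral_mono fun z => ?_)
      (lintegral_liminf_le fun k => (hmU k).lintegral_prod_right)
    refine le_trans (le_of_eq (lintegral_congr fun y => ?_))
      (lintegral_liminf_le fun k => (hmU k).comp (measurable_const.prodMk measurable_id))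
    refine (Tendsto.liminf_eq ?_).symm
    exact (ENNReal.continuous_ofReal.tendsto _).comp
      ((((hlim _ (h.continuous_slice_right y) z).const_mul _).pow 2).const_mul _)
  have h3 : liminf I atTop ≤ (J + ENNReal.ofReal α * B) / ENNReal.ofReal (α ^ 3) :=
    liminf_le_of_frequently_le' (Frequently.of_forall h1)
  have h4 := h2.trans h3
  rwa [ENNReal.le_div_iff_mul_le (Or.inl hα3) (Or.inl ENNReal.ofReal_ne_top), mul_comm] at h4

end WeakData

end Carleman

theorem lemma3p3 (n : ℕ) (s a : ℝ) (hs : 1 / 2 ≤ s) (hs1 : s < 1) (ha : a = 1 - 2 * s) :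
    ∃ C : ℝ≥0,
      ∀ (W Wy Wt f : Carleman.Pt n → ℝ) (Wx : Fin n → Carleman.Pt n → ℝ)
        (g : EuclideanSpace ℝ (Fin n) × ℝ → ℝ),
        ContinuousOn W (Carleman.closedHalf n) →
        (∀ p : Carleman.Pt n, p.2.1 = 0 → W p = 0) →
        closure (Function.support W ∩ Carleman.closedHalf n) ⊆ Carleman.halfBallCylinder n →
        (∀ i, Carleman.IsDerivContUpTo W (Carleman.dirX i) (Wx i)) →
        Carleman.IsDerivContUpTo W (Carleman.dirT n) Wt →
        Carleman.IsWeakDerivY W Wy →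
        AEMeasurable f (volume.restrict (Carleman.openHalf n)) →
        ∫⁻ p in Carleman.openHalf n, ENNReal.ofReal (f p ^ 2 * p.2.1 ^ (-a)) < (⊤ : ℝ≥0∞) →
        Carleman.IsWeakSol a Wx Wy Wt f →
        Carleman.IsWeightedNormalDeriv a Wy g →
        ∀ α : ℝ, 2 < α →
          ENNReal.ofReal (α ^ 3) *
              ∫⁻ p in Carleman.openHalf n,
                ENNReal.ofReal (Real.exp (2 * α * Carleman.phi a p) * W p ^ 2 * p.2.1 ^ a)
            ≤ C * (∫⁻ p in Carleman.openHalf n,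
                ENNReal.ofReal (Real.exp (2 * α * Carleman.phi a p) * f p ^ 2 * p.2.1 ^ (-a)))
              + C * ENNReal.ofReal α * ∫⁻ q, ENNReal.ofReal (g q ^ 2) := by
  refine ⟨1, fun W Wy Wt f Wx g hW h0 hsupp hx ht hy hf hfi hsol hg α hα => ?_⟩
  have hae := hf.ae_eq_mk
  -- Passing to a measurable representative changes f only on a null set of the half-space, which
  -- affects neither the weak equation nor the weighted norms.
  have h : Carleman.WeakData n a W Wy Wt (hf.mk f) Wx g := by
    refine ⟨hW, h0, hsupp, hx, ht, hy, hf.measurable_mk, ?_, fun η hη => ?_, hg⟩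
    · refine lt_of_eq_of_lt (lintegral_congr_ae ?_) hfi
      exact hae.mono fun p hp => by simp only [hp]
    · rw [hsol η hη]
      congr 1
      exact integral_congr_ae (hae.mono fun p hp => by simp only [hp])
  have h1 := h.carleman (by linarith) (by linarith) hα
  have h2 : ∫⁻ p in Carleman.openHalf n,
        ENNReal.ofReal (Real.exp (2 * α * Carleman.phi a p) * hf.mk f p ^ 2 * p.2.1 ^ (-a))
      = ∫⁻ p in Carleman.openHalf n,
        ENNReal.ofReal (Real.exp (2 * α * Carleman.phi a p) * f p ^ 2 * p.2.1 ^ (-a)) :=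
    lintegral_congr_ae (hae.mono fun p hp => by simp only [hp])
  rw [h2] at h1
  simpa using h1
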